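/- Let $1\le r\le\omega$ and let $\mathcal G\rightrightarrows M$ be a Lie groupoid of class $C^r$ (finite-dimensional Hausdorff manifolds without boundary) with source $\alpha$, target $\beta$ and unit inclusion $\iota_M:M\to\mathcal G$. A *bisection* is a $C^r$ map $\sigma:M\to\mathcal G$ such that $\alpha\circ\sigma=\mathrm{id}_M$ and $\beta\circ\sigma$ is a $C^r$ diffeomorphism of $M$; bisections form the group $\mathrm{Bis}^r(\mathcal G)$ under $(\sigma\star\tau)(x)=\sigma(\beta(\tau(x)))\,\tau(x)$, and $\operatorname{supp}\sigma$ and $\operatorname{supp}(\beta\circ\sigma)$ are the closures of $\{x:\sigma(x)\ne\iota_M(x)\}$ and $\{x:\beta(\sigma(x))\neq x\}$. Let $\Gamma\le\mathrm{Bis}^r(\mathcal G)$ be a subgroup and let $I\Gamma$ be the set of $C^r$ maps $\mathbb R\times M\to\mathcal G$, $(t,x)\mapsto\sigma_t(x)$, with $\sigma_t\in\Gamma$ for all $t$ and $\sigma_0=\iota_M$. "$C^1$ close on $A$" refers to the $C^1$ compact-open topology over $A$, i.e. to closeness of the maps and of their first derivatives on compact subsets of $A$. For $x\in M$ let $L_x=\beta(\mathcal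 G_x^o)$, where $\mathcal G_x^o$ is the connected component of $\iota_M(x)$ in $\alpha^{-1}(x)$; this is the leaf through $x$ of the foliation $\mathcal F_{\mathcal G}$ of $M$ determined by $\mathcal G$, and $\dim L_x$ is the dimension of its tangent space $d\beta(\ker d\alpha)$ at $x$, the differentials being taken at $\iota_M(x)$. Assume: (L) For all relatively compact open $U,V\subset M$ with $\overline U\subset V$ there is a $C^1$ neighbourhood $W$ of $\iota_M$ such that for every $\sigma\in I\Gamma$ with $\sigma_t\in W$ for all $t$: if $r\ne\omega$, there is $\tau\in I\Gamma$ with $\tau_t=\sigma_t$ on $U$ and $\operatorname{supp}\tau_t\subset V$ for all $t$; if $r=\omega$, there are $\tau\in I\Gamma$ such that, locally uniformly in $t$, $\tau_t$ is arbitrarily $C^1$ close to $\sigma_t$ on $U$ and arbitrarily $C^1$ close to $\iota_M$ on $M\setminus V$. (Fiberwise transitivity) For every $x\in M$ there are $k=\dim\alpha^{-1}(x)$ isotopies $\sigma^1,\dots,\sigma^k\in I\Gamma$ such that $\partial_t\sigma^1_t(x)|_{t=0},\dots,\partial_t\sigma^k_t(x)|_{t=0}$ are linearly independent. Let $(x_1,\dots,x_n)\in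 M^n$ be pairwise distinct, put $L_i=L_{x_i}$, and assume that for each $i$ either $\dim L_i\ge2$ or $x_j\notin L_i$ for all $j\ne i$. Let $(y_1,\dots,y_n)\in M^n$ be pairwise distinct with $y_i\in L_i$, and let $V_i\subset M$ be an open neighbourhood of $L_i$, $i=1,\dots,n$. Then: (a) if $r\neq\omega$, there is $\sigma\in\Gamma$ with $\beta(\sigma(x_i))=y_i$ for all $i$ and $\operatorname{supp}(\beta\circ\sigma)\subset V_1\cup\dots\cup V_n$; (b) if $r=\omega$, then for every $C^1$ compact-open neighbourhood of $\mathrm{id}_M$ over $M\setminus(V_1\cup\dots\cup V_n)$ there is $\sigma\in\Gamma$ with $\beta(\sigma(x_i))=y_i$ for all $i$ and $\beta\circ\sigma$ in that neighbourhood. -/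

import Mathlib

open Set Filter Topology Manifold
open scoped ContDiff

/-- A Lie groupoid `G ⇉ M` of class `C^r` over real, finite-dimensional, boundaryless manifolds.
The product `mul g h` is meaningful only for composable pairs, i.e. `src g = tgt h`; its values on
other pairs are irrelevant. Since `src` is a submersion, the set of composable pairs is an embedded
submanifold of `G × G`, and smoothness of `mul` on that submanifold is `ContMDiffOn`. -/
structure LieGroupoid (r : WithTop ℕ∞) (E F M G : Type*)
    [NormedAddCommGroup E] [NormedSpace ℝ E] [NormedAddCommGroup F] [NormedSpace ℝ F]
    [TopologicalSpace M] [ChartedSpace E M] [TopologicalSpace G] [ChartedSpace F G] where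
  /-- the source map, written `α` -/
  src : G → M
  /-- the target map, written `β` -/
  tgt : G → M
  /-- the inclusion `ι_M` of the units -/
  unit : M → G
  /-- inversion -/
  inv : G → G
  /-- the partial multiplication -/
  mul : G → G → G
  src_unit : ∀ x, src (unit x) = x
  tgt_unit : ∀ x, tgt (unit x) = x
  src_mul : ∀ g h, src g = tgt h → src (mul g h) = src h
  tgt_mul : ∀ g h, src g = tgt h → tgt (mul g h) = tgt g
  mul_assoc : ∀ g h k, src g = tgt h → src h = tgt k → mul (mul g h) k = mul g (mul h k)
  unit_mul : ∀ g, mul (unit (tgt g)) g = g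
  mul_unit : ∀ g, mul g (unit (src g)) = g
  src_inv : ∀ g, src (inv g) = tgt g
  tgt_inv : ∀ g, tgt (inv g) = src g
  inv_mul : ∀ g, mul (inv g) g = unit (src g)
  mul_inv : ∀ g, mul g (inv g) = unit (tgt g)
  contMDiff_src : ContMDiff 𝓘(ℝ, F) 𝓘(ℝ, E) r src
  contMDiff_tgt : ContMDiff 𝓘(ℝ, F) 𝓘(ℝ, E) r tgt
  contMDiff_unit : ContMDiff 𝓘(ℝ, E) 𝓘(ℝ, F) r unit
  contMDiff_inv : ContMDiff 𝓘(ℝ, F) 𝓘(ℝ, F) r inv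
  contMDiffOn_mul : ContMDiffOn (𝓘(ℝ, F).prod 𝓘(ℝ, F)) 𝓘(ℝ, F) r
    (fun p : G × G => mul p.1 p.2) {p | src p.1 = tgt p.2}
  /-- the source map is a submersion (hence so is the target map) -/
  src_submersion : Manifold.IsSubmersion 𝓘(ℝ, F) 𝓘(ℝ, E) r src

namespace LieGroupoid

section

variable {r : WithTop ℕ∞} {E F M G : Type*}
  [NormedAddCommGroup E] [NormedSpace ℝ E] [NormedAddCommGroup F] [NormedSpace ℝ F]
  [TopologicalSpace M] [ChartedSpace E M] [TopologicalSpace G] [ChartedSpace F G]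

/-- A bisection of class `C^r`: a `C^r` section `σ` of the source map such that `β ∘ σ` is a
`C^r` diffeomorphism of `M`. -/
@[ext] structure Bisection (𝒢 : LieGroupoid r E F M G) where
  toFun : M → G
  contMDiff_toFun : ContMDiff 𝓘(ℝ, E) 𝓘(ℝ, F) r toFun
  src_toFun : ∀ x, 𝒢.src (toFun x) = x
  exists_diffeo : ∃ Φ : Diffeomorph 𝓘(ℝ, E) 𝓘(ℝ, E) M M r, ∀ x, 𝒢.tgt (toFun x) = Φ x

namespace Bisection

variable {𝒢 : LieGroupoid r E F M G}

instance : CoeFun 𝒢.Bisection (fun _ => M → G) := ⟨Bisection.toFun⟩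

/-- The diffeomorphism `β ∘ σ` of `M`. -/
noncomputable def diffeo (σ : 𝒢.Bisection) : Diffeomorph 𝓘(ℝ, E) 𝓘(ℝ, E) M M r :=
  σ.exists_diffeo.choose

theorem tgt_apply (σ : 𝒢.Bisection) (x : M) : 𝒢.tgt (σ x) = σ.diffeo x :=
  σ.exists_diffeo.choose_spec x

/-- The unit bisection `ι_M`. -/
instance : One 𝒢.Bisection :=
  ⟨{ toFun := 𝒢.unit
     contMDiff_toFun := 𝒢.contMDiff_unit
     src_toFun := 𝒢.src_unit
     exists_diffeo := ⟨Diffeomorph.refl _ _ _, fun x => 𝒢.tgt_unit x⟩ }⟩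

/-- The product `(σ ⋆ τ)(x) = σ(β(τ(x))) . τ(x)`. -/
instance : Mul 𝒢.Bisection :=
  ⟨fun σ τ =>
   { toFun := fun x => 𝒢.mul (σ (𝒢.tgt (τ x))) (τ x)
     contMDiff_toFun := by
       have h1 : ContMDiff 𝓘(ℝ, E) 𝓘(ℝ, F) r (fun x => σ (𝒢.tgt (τ x))) :=
         σ.contMDiff_toFun.comp (𝒢.contMDiff_tgt.comp τ.contMDiff_toFun)
       exact 𝒢.contMDiffOn_mul.comp_contMDiff (h1.prodMk τ.contMDiff_toFun)
         (fun x => σ.src_toFun _)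
     src_toFun := fun x => by
       rw [𝒢.src_mul _ _ (σ.src_toFun _), τ.src_toFun]
     exists_diffeo := ⟨τ.diffeo.trans σ.diffeo, fun x => by
       rw [𝒢.tgt_mul _ _ (σ.src_toFun _), tgt_apply, tgt_apply]; rfl⟩ }⟩

/-- The inverse `σ⁻¹(x) = (σ((β ∘ σ)⁻¹(x)))⁻¹`. -/
noncomputable instance : Inv 𝒢.Bisection :=
  ⟨fun σ =>
   { toFun := fun x => 𝒢.inv (σ (σ.diffeo.symm x))
     contMDiff_toFun :=
       𝒢.contMDiff_inv.comp (σ.contMDiff_toFun.comp σ.diffeo.symm.contMDiff)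
     src_toFun := fun x => by
       rw [𝒢.src_inv, tgt_apply, Diffeomorph.apply_symm_apply]
     exists_diffeo := ⟨σ.diffeo.symm, fun x => by
       rw [𝒢.tgt_inv, σ.src_toFun]⟩ }⟩

theorem one_apply (x : M) : (1 : 𝒢.Bisection) x = 𝒢.unit x := rfl

theorem mul_apply (σ τ : 𝒢.Bisection) (x : M) :
    (σ * τ) x = 𝒢.mul (σ (𝒢.tgt (τ x))) (τ x) := rfl

theorem inv_apply (σ : 𝒢.Bisection) (x : M) :
    σ⁻¹ x = 𝒢.inv (σ (σ.diffeo.symm x)) := rfl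

/-- The group `Bis^r(G)` of all `C^r` bisections. -/
noncomputable instance : Group 𝒢.Bisection :=
  Group.ofLeftAxioms
    (fun σ τ ρ => by
      ext x
      simp only [mul_apply]
      rw [𝒢.tgt_mul _ _ (τ.src_toFun _),
        𝒢.mul_assoc _ _ _ (σ.src_toFun _) (τ.src_toFun _)])
    (fun σ => by
      ext x
      simp only [mul_apply, one_apply]
      rw [𝒢.unit_mul])
    (fun σ => by
      ext x
      simp only [mul_apply, one_apply, inv_apply]
      rw [tgt_apply, Diffeomorph.symm_apply_apply, 𝒢.inv_mul, σ.src_toFun])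

/-- The support of a bisection: the closure of the set where it differs from `ι_M`. -/
def support (σ : 𝒢.Bisection) : Set M := closure {x | σ x ≠ 𝒢.unit x}

/-- The induced map `β ∘ σ : M → M`. -/
def baseMap (σ : 𝒢.Bisection) : M → M := fun x => 𝒢.tgt (σ x)

/-- The support of `β ∘ σ`: the closure of the set of points that it moves. -/
def baseSupport (σ : 𝒢.Bisection) : Set M := closure {x | σ.baseMap x ≠ x}

end Bisection

/-- `IΓ`: the `C^r` isotopies `ℝ × M → G` in `Γ` which start at `ι_M`. -/
structure Isotopy {𝒢 : LieGroupoid r E F M G} (Γ : Subgroup 𝒢.Bisection) where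
  toFun : ℝ → 𝒢.Bisection
  mem : ∀ t, toFun t ∈ Γ
  map_zero : toFun 0 = 1
  contMDiff : ContMDiff (𝓘(ℝ, ℝ).prod 𝓘(ℝ, E)) 𝓘(ℝ, F) r (fun p : ℝ × M => toFun p.1 p.2)

instance {𝒢 : LieGroupoid r E F M G} (Γ : Subgroup 𝒢.Bisection) :
    CoeFun (Isotopy Γ) (fun _ => ℝ → 𝒢.Bisection) := ⟨Isotopy.toFun⟩

/-- The vector `∂σ_t(x)/∂t` at `t = 0`. It is tangent to `G` at `σ_0(x)`, which is the unit at `x`. -/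
noncomputable def Isotopy.velocity {𝒢 : LieGroupoid r E F M G} {Γ : Subgroup 𝒢.Bisection}
    (σ : Isotopy Γ) (x : M) : TangentSpace 𝓘(ℝ, F) (𝒢.unit x) :=
  (mfderiv 𝓘(ℝ, ℝ) 𝓘(ℝ, F) (fun t : ℝ => σ t x) 0 (1 : ℝ) : F)

/-- The tangent space at the unit of `x` of the source fibre `α⁻¹(x)`. -/
noncomputable def fiberTangent (𝒢 : LieGroupoid r E F M G) (x : M) :
    Submodule ℝ (TangentSpace 𝓘(ℝ, F) (𝒢.unit x)) :=
  (mfderiv 𝓘(ℝ, F) 𝓘(ℝ, E) 𝒢.src (𝒢.unit x)).ker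

/-- Fiberwise transitivity: at every `x` there are `k = dim α⁻¹(x)` isotopies in `Γ` whose
velocities at `x` are linearly independent. -/
def FiberwiseTransitive {𝒢 : LieGroupoid r E F M G} (Γ : Subgroup 𝒢.Bisection) : Prop :=
  ∀ x : M, ∃ σ : Fin (Module.finrank ℝ (𝒢.fiberTangent x)) → Isotopy Γ,
    LinearIndependent ℝ (fun j => (σ j).velocity x)

/-- The component of the unit of `x` in the source fibre `α⁻¹(x)`. -/
def fiberComponent (𝒢 : LieGroupoid r E F M G) (x : M) : Set G :=
  connectedComponentIn (𝒢.src ⁻¹' {x}) (𝒢.unit x)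

/-- The leaf through `x` of the foliation of `M` determined by the groupoid: the image under `β` of
the component of the unit of `x` in the source fibre. -/
def leaf (𝒢 : LieGroupoid r E F M G) (x : M) : Set M := 𝒢.tgt '' 𝒢.fiberComponent x

/-- The dimension of the leaf through `x`, i.e. of its tangent space at `x`, which is the image
of the tangent space of the source fibre under the differential of `β` (the image of the anchor). -/
noncomputable def leafDim (𝒢 : LieGroupoid r E F M G) (x : M) : ℕ :=
  Module.finrank ℝ ((𝒢.fiberTangent x).map
    (mfderiv 𝓘(ℝ, F) 𝓘(ℝ, E) 𝒢.tgt (𝒢.unit x)).toLinearMap)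

end

end LieGroupoid

section

variable (E F : Type*) {M N : Type*}
  [NormedAddCommGroup E] [NormedSpace ℝ E] [NormedAddCommGroup F] [NormedSpace ℝ F]
  [TopologicalSpace M] [ChartedSpace E M] [IsManifold 𝓘(ℝ, E) 1 M]
  [TopologicalSpace N] [ChartedSpace F N] [IsManifold 𝓘(ℝ, F) 1 N]

/-- The weak `C^1` topology (`C^1` compact-open topology) over a set `A` of source points, on maps
`M → N`: the compact-open topology for the tangent maps `Tf`, restricted to the part of `TM` over
`A`. Two `C^1` maps are close if, over a compact subset of `A`, both the maps and their
first derivatives are close. It is only used at maps which are at least `C^1`. -/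
@[reducible] def c1TopologyOn (A : Set M) : TopologicalSpace (M → N) :=
  TopologicalSpace.generateFrom
    {S | ∃ (K : Set (TangentBundle 𝓘(ℝ, E) M)) (O : Set (TangentBundle 𝓘(ℝ, F) N)),
      IsCompact K ∧ (∀ v ∈ K, v.proj ∈ A) ∧ IsOpen O ∧
      S = {f : M → N | MapsTo (tangentMap 𝓘(ℝ, E) 𝓘(ℝ, F) f) K O}}

/-- The corresponding topology on one-parameter families `t ↦ f_t` of maps `M → N`: the
compact-open topology for `(t, v) ↦ Tf_t(v)`, restricted to vectors `v` over `A`. Two families are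
close if `f_t` and `g_t` are `C^1` close over a compact subset of `A`, uniformly for `t` in a
compact set. -/
@[reducible] def c1FamilyTopologyOn (A : Set M) : TopologicalSpace (ℝ → M → N) :=
  TopologicalSpace.generateFrom
    {S | ∃ (K : Set (ℝ × TangentBundle 𝓘(ℝ, E) M)) (O : Set (TangentBundle 𝓘(ℝ, F) N)),
      IsCompact K ∧ (∀ p ∈ K, p.2.proj ∈ A) ∧ IsOpen O ∧
      S = {f : ℝ → M → N | MapsTo (fun p => tangentMap 𝓘(ℝ, E) 𝓘(ℝ, F) (f p.1) p.2) K O}}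

end

namespace LieGroupoid

section

variable {r : WithTop ℕ∞} {E F M G : Type*}
  [NormedAddCommGroup E] [NormedSpace ℝ E] [NormedAddCommGroup F] [NormedSpace ℝ F]
  [TopologicalSpace M] [ChartedSpace E M] [IsManifold 𝓘(ℝ, E) 1 M]
  [TopologicalSpace G] [ChartedSpace F G] [IsManifold 𝓘(ℝ, F) 1 G]

/-- The (L)-condition (locality). For all relatively compact open `U`, `V` with
`closure U ⊆ V` there is a `C^1` neighbourhood `W` of `ι_M` such that for each isotopy `σ` in `Γ`
with all `σ_t` in `W`:
* if `r ≠ ω`, some isotopy `τ` in `Γ` has `τ_t = σ_t` on `U` and `supp τ_t ⊆ V` for all `t`;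
* if `r = ω`, there are isotopies `τ` in `Γ` such that `τ_t` is arbitrarily `C^1` close to `σ_t` on
  `U` and arbitrarily `C^1` close to `ι_M` outside `V`. -/
def LCondition {𝒢 : LieGroupoid r E F M G} (Γ : Subgroup 𝒢.Bisection) : Prop :=
  ∀ U V : Set M, IsOpen U → IsOpen V → IsCompact (closure U) → IsCompact (closure V) →
    closure U ⊆ V →
    ∃ W ∈ @nhds (M → G) (c1TopologyOn E F univ) 𝒢.unit,
      ∀ σ : Isotopy Γ, (∀ t, (σ t : M → G) ∈ W) →
        (r ≠ ω → ∃ τ : Isotopy Γ,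
          (∀ t, ∀ x ∈ U, τ t x = σ t x) ∧ ∀ t, (τ t).support ⊆ V) ∧
        (r = ω →
          ∀ W₁ ∈ @nhds (ℝ → M → G) (c1FamilyTopologyOn E F U) (fun t => σ t),
          ∀ W₂ ∈ @nhds (ℝ → M → G) (c1FamilyTopologyOn E F Vᶜ) (fun _ => 𝒢.unit),
          ∃ τ : Isotopy Γ, (fun t => (τ t : M → G)) ∈ W₁ ∧ (fun t => (τ t : M → G)) ∈ W₂)

end

end LieGroupoid

/-! One argument serves both regularity cases. Call a reflexive and transitive relation on
configurations in `M^n` a motion relation in `V` (`IsMotionRel`) if it contains every short move,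
along an isotopy in `Γ`, of one point in `V` of an injective configuration while the other points
stay put. Two things are shown: a motion relation in a set containing all the leaves relates `x` to
`y` (`IsMotionRel.rel`), and "realized by an element of `Γ` with the required support or closeness"
is a motion relation (`isMotionRel_supported`, `isMotionRel_frequently`).

For the first, fiberwise transitivity and the submersion theorem show that products of isotopies
reach all arrows near a given one in its source fibre (`Isotopy.eventually_exists_multi`). A motion
relation therefore relates the targets of neighbouring arrows, and connectedness of the fibre
component spreads this over the leaf (`rel_of_mem_leaf`). The points held fixed are obstacles.
Either the leaf misses them, or it has dimension at least two; then the target map has rank at least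
two on the fibre, and arrows ending at an obstacle do not separate the fibre locally
(`exists_isPreconnected_diff_fiber`). Points are moved one at a time, by way of an intermediate
configuration that prevents collisions when the points of `x` and `y` overlap.

For the second, if `r ≠ ω`, (L) localizes the motion of one point away from the others. If `r = ω`,
(L) gives only approximations, so the points land near their goals and a small element of `Γ` must
correct the error at all of them at once. This requires the velocities of isotopies at several
distinct points to span the product of the fibre tangent spaces (`exists_isotopies_span`). Let `D`
be the span of these velocity vectors. Every isotopy keeps the configuration in one slice of a flow
box tangent to `D` (`hasDerivAt_snd_flowBox`). By (L), isotopies approximate the motion of a single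
point, so that motion cannot leave the slice either and its velocity lies in `D`
(`single_vel_mem_span`). Fiberwise transitivity at each point then gives the whole product. -/

/-! ### Local non-separation by fibres, and relations on connected sets -/

theorem isPreconnected_ball_diff_center {W : Type*} [NormedAddCommGroup W] [InnerProductSpace ℝ W]
    (hW : 1 < Module.rank ℝ W) (c : W) {δ : ℝ} (hδ : 0 < δ) :
    IsPreconnected (Metric.ball c δ \ {c}) := by
  have h := (isConnected_compl_singleton_of_one_lt_rank hW (0 : W)).isPreconnected
  have himg : OpenPartialHomeomorph.univBall c δ '' {0}ᶜ = Metric.ball c δ \ {c} := by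
    have hinj : InjOn (OpenPartialHomeomorph.univBall c δ) univ := by
      have := (OpenPartialHomeomorph.univBall c δ).injOn
      rwa [OpenPartialHomeomorph.univBall_source] at this
    have hall : OpenPartialHomeomorph.univBall c δ '' univ = Metric.ball c δ := by
      have := (OpenPartialHomeomorph.univBall c δ).image_source_eq_target
      rwa [OpenPartialHomeomorph.univBall_source,
        OpenPartialHomeomorph.univBall_target _ hδ] at this
    rw [compl_eq_univ_sdiff, hinj.image_sdiff, univ_inter, hall, image_singleton,
      OpenPartialHomeomorph.univBall_apply_zero]
  rw [← himg]
  exact h.image _ (OpenPartialHomeomorph.contDiff_univBall (n := 0)).continuous.continuousOn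

/-- Near a point where a map has rank at least two, the fibre through the point does not separate:
there are small neighbourhoods on which its complement is preconnected and accumulates at the
point. -/
theorem exists_isPreconnected_diff_fiber {P E : Type*}
    [NormedAddCommGroup P] [NormedSpace ℝ P] [FiniteDimensional ℝ P]
    [NormedAddCommGroup E] [NormedSpace ℝ E] [FiniteDimensional ℝ E]
    {f : P → E} {f' : P →L[ℝ] E} {a : P} (hf : HasStrictFDerivAt f f' a)
    {v : Fin 2 → P} (hv : LinearIndependent ℝ (fun j => f' (v j))) {S : Set P} (hS : S ∈ 𝓝 a) :
    ∃ N ∈ 𝓝 a, N ⊆ S ∧ IsPreconnected (N \ f ⁻¹' {f a}) ∧ a ∈ closure (N \ f ⁻¹' {f a}) := by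
  classical
  let W := EuclideanSpace ℝ (Fin 2)
  let T : W →ₗ[ℝ] E :=
    (Fintype.linearCombination ℝ (fun j => f' (v j))).comp
      (EuclideanSpace.equiv (Fin 2) ℝ).toLinearMap
  have hT : Function.Injective T := by
    have h1 : Function.Injective (Fintype.linearCombination ℝ (fun j => f' (v j))) :=
      hv.fintypeLinearCombination_injective
    exact h1.comp (EuclideanSpace.equiv (Fin 2) ℝ).injective
  -- Projecting `E` to the plane spanned by the two vectors `f' (v j)` makes `L ∘ f` a submersion at
  -- `a`, and the implicit function chart `e` straightens it. The fibre of `f` through `a` lies in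
  -- that of `L ∘ f`, which in the chart is the centre of a disc times a ball.
  obtain ⟨ℓ, hℓ⟩ := T.exists_leftInverse_of_injective (LinearMap.ker_eq_bot.2 hT)
  let L : E →L[ℝ] W := LinearMap.toContinuousLinearMap ℓ
  have hψ : HasStrictFDerivAt (fun t => L (f t)) (L.comp f') a := L.hasStrictFDerivAt.comp a hf
  have hsurj : (L.comp f').range = ⊤ := by
    rw [eq_top_iff]
    intro w _
    refine ⟨∑ j, w j • v j, ?_⟩
    have h2 : ℓ (T w) = w := by
      have := LinearMap.congr_fun hℓ w
      simpa using this
    have h3 : T w = f' (∑ j, w j • v j) := by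
      simp [T, Fintype.linearCombination_apply]
      rfl
    change ℓ (f' _) = w
    rw [← h3, h2]
  let e := hψ.implicitToOpenPartialHomeomorph _ _ hsurj
  have ha : a ∈ e.source := hψ.mem_implicitToOpenPartialHomeomorph_source hsurj
  have hea : e a = (L (f a), 0) := hψ.implicitToOpenPartialHomeomorph_self hsurj
  have hefst : ∀ t, (e t).1 = L (f t) := fun t =>
    hψ.implicitToOpenPartialHomeomorph_fst hsurj t
  have hnhds : e.target ∩ e.symm ⁻¹' (S) ∈ 𝓝 (e a) := by
    refine Filter.inter_mem (e.open_target.mem_nhds (e.map_source ha)) ?_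
    have := e.continuousAt_symm (e.map_source ha)
    apply this
    rwa [e.left_inv ha]
  obtain ⟨δ, hδ, hball⟩ := Metric.mem_nhds_iff.1 hnhds
  rw [hea] at hball
  have hprod : Metric.ball ((L (f a) : W), (0 : (L.comp f').ker)) δ =
    Metric.ball (L (f a)) δ ×ˢ Metric.ball 0 δ := (ball_prod_same _ _ _).symm
  set B := Metric.ball ((L (f a) : W), (0 : (L.comp f').ker)) δ with hB
  set B' : Set (W × (L.comp f').ker) :=
    (Metric.ball (L (f a)) δ \ {L (f a)}) ×ˢ Metric.ball 0 δ with hB'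
  have hrank : 1 < Module.rank ℝ W := by
    rw [← Module.finrank_eq_rank, finrank_euclideanSpace]
    norm_num
  have hB'B : B' ⊆ B := by
    rw [hprod]; exact prod_mono sdiff_subset Subset.rfl
  have hBt : B ⊆ e.target := fun y hy => (hball hy).1
  have hpre : IsPreconnected B' :=
    (isPreconnected_ball_diff_center hrank _ hδ).prod (convex_ball _ _).isPreconnected
  have hclos : B ⊆ closure B' := by
    rw [hB', closure_prod_eq, hprod]
    refine prod_mono ?_ subset_closure
    have : Nontrivial W := by
      rw [← rank_pos_iff_nontrivial (R := ℝ)]; exact lt_trans (by norm_num) hrank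
    have hd : Dense ({L (f a)}ᶜ : Set W) := dense_compl_singleton _
    intro y hy
    have := (Metric.isOpen_ball (x := L (f a)) (ε := δ)).inter_closure (t := {L (f a)}ᶜ)
    rw [hd.closure_eq, inter_univ] at this
    exact this hy
  have hcont : ContinuousOn e.symm B := e.continuousOn_symm.mono hBt
  -- The complement of the fibre of `f` is squeezed between a preconnected set and its closure, so
  -- the exact shape of that fibre does not matter.
  have hT1 : e.symm '' B' ⊆ e.symm '' B \ f ⁻¹' {f a} := by
    rintro _ ⟨y, hy, rfl⟩
    refine ⟨⟨y, hB'B hy, rfl⟩, fun h => ?_⟩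
    have h1 : (e (e.symm y)).1 = L (f (e.symm y)) := hefst _
    rw [e.right_inv (hBt (hB'B hy)), show f (e.symm y) = f a from h] at h1
    exact hy.1.2 h1
  have hT2 : e.symm '' B ⊆ closure (e.symm '' B') := by
    rintro _ ⟨y, hy, rfl⟩
    have h1 : y ∈ closure B' := hclos hy
    have h2 : ContinuousWithinAt e.symm B' y := (hcont y hy).mono hB'B
    exact h2.mem_closure_image h1
  have haB : a ∈ e.symm '' B :=
    ⟨e a, by rw [hea]; exact Metric.mem_ball_self hδ, e.left_inv ha⟩
  refine ⟨e.symm '' B, ?_, ?_, ?_, ?_⟩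
  · rw [e.symm_image_eq_source_inter_preimage hBt]
    exact (e.isOpen_inter_preimage Metric.isOpen_ball).mem_nhds
      ⟨ha, by rw [mem_preimage, hea]; exact Metric.mem_ball_self hδ⟩
  · rintro _ ⟨y, hy, rfl⟩
    exact (hball hy).2
  · exact (hpre.image _ (hcont.mono hB'B)).subset_closure hT1 (sdiff_subset.trans hT2)
  · exact closure_mono hT1 (hT2 haB)

/-- A transitive relation which locally relates all pairs of points outside a thin set relates all
pairs of points outside that set, on a preconnected set. -/
theorem IsPreconnected.rel_of_locally_rel {Y : Type*} [TopologicalSpace Y] {X D : Set Y}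
    (hX : IsPreconnected X) {ρ : Y → Y → Prop} (htrans : ∀ a b c, ρ a b → ρ b c → ρ a c)
    (hloc : ∀ g ∈ X, ∃ N ∈ 𝓝[X] g, ∀ h ∈ N \ D, ∀ h' ∈ N \ D, ρ h h')
    (hD : ∀ g ∈ X, (𝓝[X \ D] g).NeBot) {g g' : Y} (hg : g ∈ X \ D) (hg' : g' ∈ X \ D) :
    ρ g g' := by
  -- The induction on `X` also passes through points of `D`, where `ρ` gives no information. `P`
  -- only constrains points off `D` near `a` and `b`, and it is symmetric; `hD` supplies the
  -- intermediate point that makes it transitive.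
  let P : Y → Y → Prop := fun a b => ∃ N ∈ 𝓝[X] a, ∃ N' ∈ 𝓝[X] b,
    ∀ h ∈ N \ D, ∀ h' ∈ N' \ D, ρ h h' ∧ ρ h' h
  have key : P g g' := by
    refine hX.induction₂ P (fun a ha => ?_) ?_ ?_ hg.1 hg'.1
    · obtain ⟨N, hN, hρ⟩ := hloc a ha
      have h1 : ∀ᶠ b in 𝓝[X] a, N ∈ 𝓝[X] b := eventually_eventually_nhdsWithin.2 hN
      filter_upwards [h1] with b hb
      exact ⟨N, hN, N, hb, fun h hh h' hh' => ⟨hρ h hh h' hh', hρ h' hh' h hh⟩⟩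
    · rintro a b c - hb - ⟨N₁, h₁, N₂, h₂, h12⟩ ⟨N₃, h₃, N₄, h₄, h34⟩
      have hne := hD b hb
      have h5 : (N₂ ∩ N₃) ∩ (X \ D) ∈ 𝓝[X \ D] b :=
        inter_mem (nhdsWithin_mono _ sdiff_subset (inter_mem h₂ h₃)) self_mem_nhdsWithin
      obtain ⟨m, ⟨hm2, hm3⟩, hm⟩ := hne.nonempty_of_mem h5
      refine ⟨N₁, h₁, N₄, h₄, fun h hh h' hh' => ⟨?_, ?_⟩⟩
      · exact htrans _ m _ (h12 h hh m ⟨hm2, hm.2⟩).1 (h34 m ⟨hm3, hm.2⟩ h' hh').1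
      · exact htrans _ m _ (h34 m ⟨hm3, hm.2⟩ h' hh').2 (h12 h hh m ⟨hm2, hm.2⟩).2
    · rintro a b - - ⟨N₁, h₁, N₂, h₂, h12⟩
      exact ⟨N₂, h₂, N₁, h₁, fun h hh h' hh' => (h12 h' hh' h hh).symm⟩
  obtain ⟨N, hN, N', hN', h⟩ := key
  exact (h g ⟨mem_of_mem_nhdsWithin hg.1 hN, hg.2⟩ g'
    ⟨mem_of_mem_nhdsWithin hg'.1 hN', hg'.2⟩).1

namespace LieGroupoid

/-! ### Action of bisections on arrows; leaves are equivalence classes -/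

section Groupoid

variable {r : WithTop ℕ∞} {E F M G : Type*}
  [NormedAddCommGroup E] [NormedSpace ℝ E] [NormedAddCommGroup F] [NormedSpace ℝ F]
  [TopologicalSpace M] [ChartedSpace E M] [TopologicalSpace G] [ChartedSpace F G]
  {𝒢 : LieGroupoid r E F M G}

/-- Bisections act on arrows by left multiplication. -/
instance : MulAction 𝒢.Bisection G where
  smul σ g := 𝒢.mul (σ (𝒢.tgt g)) g
  one_smul g := 𝒢.unit_mul g
  mul_smul σ τ g := by
    change 𝒢.mul (𝒢.mul (σ (𝒢.tgt (τ (𝒢.tgt g)))) (τ (𝒢.tgt g))) g =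
      𝒢.mul (σ (𝒢.tgt (𝒢.mul (τ (𝒢.tgt g)) g))) (𝒢.mul (τ (𝒢.tgt g)) g)
    rw [𝒢.tgt_mul _ _ (τ.src_toFun _), 𝒢.mul_assoc _ _ _ (σ.src_toFun _) (τ.src_toFun _)]

theorem Bisection.smul_def (σ : 𝒢.Bisection) (g : G) : σ • g = 𝒢.mul (σ (𝒢.tgt g)) g := rfl

theorem Bisection.src_smul (σ : 𝒢.Bisection) (g : G) : 𝒢.src (σ • g) = 𝒢.src g :=
  𝒢.src_mul _ _ (σ.src_toFun _)

theorem Bisection.tgt_smul (σ : 𝒢.Bisection) (g : G) : 𝒢.tgt (σ • g) = σ.baseMap (𝒢.tgt g) :=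
  𝒢.tgt_mul _ _ (σ.src_toFun _)

theorem Bisection.smul_unit (σ : 𝒢.Bisection) (x : M) : σ • 𝒢.unit x = σ x := by
  have h := 𝒢.mul_unit (σ x)
  rw [σ.src_toFun] at h
  rw [smul_def, 𝒢.tgt_unit, h]

theorem Bisection.mul_apply_eq_smul (σ τ : 𝒢.Bisection) (x : M) : (σ * τ) x = σ • τ x := rfl

theorem Bisection.baseMap_one : (1 : 𝒢.Bisection).baseMap = id :=
  funext fun x => 𝒢.tgt_unit x

theorem Bisection.baseMap_mul (σ τ : 𝒢.Bisection) :
    (σ * τ).baseMap = σ.baseMap ∘ τ.baseMap :=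
  funext fun x => σ.tgt_smul (τ x)

theorem Bisection.baseMap_inv_apply (σ : 𝒢.Bisection) (x : M) :
    σ⁻¹.baseMap (σ.baseMap x) = x := by
  have h : (σ⁻¹ * σ).baseMap x = x := by rw [inv_mul_cancel, baseMap_one]; rfl
  rwa [baseMap_mul] at h

theorem Bisection.baseMap_eq_of_apply_eq_unit {σ : 𝒢.Bisection} {x : M} (h : σ x = 𝒢.unit x) :
    σ.baseMap x = x := by
  rw [baseMap, h, 𝒢.tgt_unit]

theorem Bisection.baseSupport_subset_support (σ : 𝒢.Bisection) : σ.baseSupport ⊆ σ.support :=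
  closure_mono fun _ hx h => hx (baseMap_eq_of_apply_eq_unit h)

theorem Bisection.baseSupport_one : (1 : 𝒢.Bisection).baseSupport = ∅ := by
  simp [baseSupport, baseMap_one]

theorem Bisection.baseSupport_mul_subset (σ τ : 𝒢.Bisection) :
    (σ * τ).baseSupport ⊆ σ.baseSupport ∪ τ.baseSupport := by
  rw [baseSupport, baseSupport, baseSupport, ← closure_union]
  refine closure_mono fun x hx => ?_
  by_contra h
  simp only [mem_union, mem_ofPred_eq, not_or, not_not] at h
  exact hx (by rw [baseMap_mul, Function.comp_apply, h.2, h.1])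

theorem Bisection.contMDiff_baseMap (σ : 𝒢.Bisection) :
    ContMDiff 𝓘(ℝ, E) 𝓘(ℝ, E) r σ.baseMap :=
  𝒢.contMDiff_tgt.comp σ.contMDiff_toFun

theorem continuousOn_mul : ContinuousOn (fun p : G × G => 𝒢.mul p.1 p.2)
    {p | 𝒢.src p.1 = 𝒢.tgt p.2} :=
  𝒢.contMDiffOn_mul.continuousOn

theorem src_of_mem_fiberComponent {x : M} {g : G} (hg : g ∈ 𝒢.fiberComponent x) :
    𝒢.src g = x :=
  connectedComponentIn_subset (𝒢.src ⁻¹' {x}) (𝒢.unit x) hg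

theorem unit_mem_fiberComponent (x : M) : 𝒢.unit x ∈ 𝒢.fiberComponent x :=
  mem_connectedComponentIn (𝒢.src_unit x)

theorem isPreconnected_fiberComponent (x : M) : IsPreconnected (𝒢.fiberComponent x) :=
  isPreconnected_connectedComponentIn

theorem subset_fiberComponent {x : M} {g : G} (hg : g ∈ 𝒢.fiberComponent x) {S : Set G}
    (hS : IsPreconnected S) (hgS : g ∈ S) (hSx : ∀ h ∈ S, 𝒢.src h = x) :
    S ⊆ 𝒢.fiberComponent x := by
  rw [fiberComponent, connectedComponentIn_eq hg]
  exact hS.subset_connectedComponentIn hgS hSx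

theorem continuousOn_mul_right (g : G) :
    ContinuousOn (fun h => 𝒢.mul h g) (𝒢.src ⁻¹' {𝒢.tgt g}) :=
  continuousOn_mul.comp (continuous_id.prodMk continuous_const).continuousOn
    fun _ hh => hh

/-- Right translation by `g` is continuous on the source fibre over `tgt g` and sends the unit there
to `g`, so it carries a component into a component. With the analogous argument for inverses this
makes lying on a common leaf an equivalence relation. -/
theorem mul_mem_fiberComponent {x : M} {g h : G} (hg : g ∈ 𝒢.fiberComponent x)
    (hh : h ∈ 𝒢.fiberComponent (𝒢.tgt g)) : 𝒢.mul h g ∈ 𝒢.fiberComponent x := by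
  have hsub : (fun k => 𝒢.mul k g) '' 𝒢.fiberComponent (𝒢.tgt g) ⊆ 𝒢.fiberComponent x := by
    refine subset_fiberComponent hg ?_ ?_ ?_
    · exact (isPreconnected_fiberComponent _).image _
        ((continuousOn_mul_right g).mono (connectedComponentIn_subset _ _))
    · exact ⟨_, unit_mem_fiberComponent _, 𝒢.unit_mul g⟩
    · rintro _ ⟨k, hk, rfl⟩
      change 𝒢.src (𝒢.mul k g) = x
      rw [𝒢.src_mul _ _ (src_of_mem_fiberComponent hk), src_of_mem_fiberComponent hg]
  exact hsub ⟨h, hh, rfl⟩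

theorem inv_mem_fiberComponent {x : M} {g : G} (hg : g ∈ 𝒢.fiberComponent x) :
    𝒢.inv g ∈ 𝒢.fiberComponent (𝒢.tgt g) := by
  have hx := src_of_mem_fiberComponent hg
  have ht : 𝒢.tgt (𝒢.inv g) = x := by rw [𝒢.tgt_inv, hx]
  have hsub : (fun k => 𝒢.mul k (𝒢.inv g)) '' 𝒢.fiberComponent x ⊆
      𝒢.fiberComponent (𝒢.tgt g) := by
    refine subset_fiberComponent (unit_mem_fiberComponent _) ?_ ?_ ?_
    · refine (isPreconnected_fiberComponent _).image _
        ((continuousOn_mul_right _).mono ?_)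
      rw [ht]
      exact connectedComponentIn_subset _ _
    · exact ⟨g, hg, 𝒢.mul_inv g⟩
    · rintro _ ⟨k, hk, rfl⟩
      change 𝒢.src (𝒢.mul k _) = _
      rw [𝒢.src_mul _ _ ((src_of_mem_fiberComponent hk).trans ht.symm), 𝒢.src_inv]
  refine hsub ⟨𝒢.unit x, unit_mem_fiberComponent x, ?_⟩
  have := 𝒢.unit_mul (𝒢.inv g)
  rwa [ht] at this

theorem mem_leaf_self (x : M) : x ∈ 𝒢.leaf x :=
  ⟨_, unit_mem_fiberComponent x, 𝒢.tgt_unit x⟩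

theorem mem_leaf_symm {x y : M} (h : y ∈ 𝒢.leaf x) : x ∈ 𝒢.leaf y := by
  obtain ⟨g, hg, rfl⟩ := h
  exact ⟨_, inv_mem_fiberComponent hg, by rw [𝒢.tgt_inv, src_of_mem_fiberComponent hg]⟩

theorem mem_leaf_trans {x y z : M} (h : y ∈ 𝒢.leaf x) (h' : z ∈ 𝒢.leaf y) : z ∈ 𝒢.leaf x := by
  obtain ⟨g, hg, rfl⟩ := h
  obtain ⟨k, hk, rfl⟩ := h'
  exact ⟨_, mul_mem_fiberComponent hg hk, 𝒢.tgt_mul _ _ (src_of_mem_fiberComponent hk)⟩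

theorem notMem_leaf_of_mem_leaf {x y u : M} (hxy : y ∉ 𝒢.leaf x) (hu : u ∈ 𝒢.leaf y) :
    u ∉ 𝒢.leaf x :=
  fun h => hxy (mem_leaf_trans h (mem_leaf_symm hu))

end Groupoid

/-! ### Smooth families of bisections and products of isotopies -/

section Smooth

variable {r : WithTop ℕ∞} {E F M G : Type*}
  [NormedAddCommGroup E] [NormedSpace ℝ E] [NormedAddCommGroup F] [NormedSpace ℝ F]
  [TopologicalSpace M] [ChartedSpace E M] [TopologicalSpace G] [ChartedSpace F G]
  {𝒢 : LieGroupoid r E F M G} {Γ : Subgroup 𝒢.Bisection}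
  {P Q : Type*} [NormedAddCommGroup P] [NormedSpace ℝ P] [NormedAddCommGroup Q] [NormedSpace ℝ Q]

/-- A family of bisections of class `C^r` jointly in the parameter and the point. -/
def JointlySmooth (a : P → 𝒢.Bisection) : Prop :=
  ContMDiff (𝓘(ℝ, P).prod 𝓘(ℝ, E)) 𝓘(ℝ, F) r (fun p : P × M => a p.1 p.2)

theorem Isotopy.jointlySmooth (σ : Isotopy Γ) : JointlySmooth (fun t => σ t) := σ.contMDiff

theorem JointlySmooth.const (σ : 𝒢.Bisection) : JointlySmooth (fun _ : P => σ) :=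
  σ.contMDiff_toFun.comp contMDiff_snd

theorem JointlySmooth.comp {a : P → 𝒢.Bisection} (ha : JointlySmooth a) {f : Q → P}
    (hf : ContDiff ℝ r f) : JointlySmooth (fun q => a (f q)) :=
  ContMDiff.comp (g := fun p : P × M => a p.1 p.2) ha
    ((hf.contMDiff.comp contMDiff_fst).prodMk contMDiff_snd)

theorem JointlySmooth.smul {a : P → 𝒢.Bisection} (ha : JointlySmooth a) :
    ContMDiff (𝓘(ℝ, P).prod 𝓘(ℝ, F)) 𝓘(ℝ, F) r (fun p : P × G => a p.1 • p.2) := by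
  have h1 : ContMDiff (𝓘(ℝ, P).prod 𝓘(ℝ, F)) 𝓘(ℝ, F) r
      (fun p : P × G => a p.1 (𝒢.tgt p.2)) :=
    ContMDiff.comp (g := fun p : P × M => a p.1 p.2) ha
      (contMDiff_fst.prodMk (𝒢.contMDiff_tgt.comp contMDiff_snd))
  exact 𝒢.contMDiffOn_mul.comp_contMDiff (h1.prodMk contMDiff_snd) fun p => (a p.1).src_toFun _

theorem JointlySmooth.mul {a b : P → 𝒢.Bisection} (ha : JointlySmooth a)
    (hb : JointlySmooth b) : JointlySmooth (fun p => a p * b p) :=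
  ContMDiff.comp (g := fun p : P × G => a p.1 • p.2) ha.smul (contMDiff_fst.prodMk hb)

theorem JointlySmooth.baseMap {a : P → 𝒢.Bisection} (ha : JointlySmooth a) :
    ContMDiff (𝓘(ℝ, P).prod 𝓘(ℝ, E)) 𝓘(ℝ, E) r (fun p : P × M => (a p.1).baseMap p.2) :=
  𝒢.contMDiff_tgt.comp ha

theorem JointlySmooth.apply {a : P → 𝒢.Bisection} (ha : JointlySmooth a) (x : M) :
    ContMDiff 𝓘(ℝ, P) 𝓘(ℝ, F) r (fun p => a p x) :=
  ContMDiff.comp (g := fun p : P × M => a p.1 p.2) ha (contMDiff_id.prodMk contMDiff_const)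

/-- An isotopy from a jointly smooth family of elements of `Γ`. -/
def Isotopy.ofJointlySmooth (a : ℝ → 𝒢.Bisection) (ha : JointlySmooth a) (hΓ : ∀ t, a t ∈ Γ)
    (h0 : a 0 = 1) : Isotopy Γ := ⟨a, hΓ, h0, ha⟩

/-- The isotopy `t ↦ σ_{ε sin t}`. -/
noncomputable def Isotopy.sinReparam (σ : Isotopy Γ) (ε : ℝ) : Isotopy Γ :=
  Isotopy.ofJointlySmooth (fun t => σ (ε * Real.sin t))
    (σ.jointlySmooth.comp (contDiff_const.mul Real.contDiff_sin)) (fun _ => σ.mem _)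
    (by simp [σ.map_zero])

/-- The ordered product of the isotopies `τ j` at the times `t j`. -/
def Isotopy.multi {N : ℕ} (τ : Fin N → Isotopy Γ) (t : Fin N → ℝ) : 𝒢.Bisection :=
  (List.ofFn fun j => (τ j) (t j)).prod

theorem Isotopy.multi_succ {N : ℕ} (τ : Fin (N + 1) → Isotopy Γ) (t : Fin (N + 1) → ℝ) :
    Isotopy.multi τ t =
      (τ 0) (t 0) * Isotopy.multi (fun j => τ j.succ) (fun j => t j.succ) := by
  simp [Isotopy.multi, List.ofFn_succ]

theorem Isotopy.multi_mem {N : ℕ} (τ : Fin N → Isotopy Γ) (t : Fin N → ℝ) :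
    Isotopy.multi τ t ∈ Γ := by
  induction N with
  | zero => simp [Isotopy.multi, one_mem]
  | succ N ih => rw [Isotopy.multi_succ]; exact mul_mem ((τ 0).mem _) (ih _ _)

theorem Isotopy.multi_zero {N : ℕ} (τ : Fin N → Isotopy Γ) : Isotopy.multi τ 0 = 1 := by
  induction N with
  | zero => simp [Isotopy.multi]
  | succ N ih =>
    rw [Isotopy.multi_succ, Pi.zero_apply, (τ 0).map_zero, one_mul]
    exact ih _

theorem Isotopy.multi_single {N : ℕ} (τ : Fin N → Isotopy Γ) (j : Fin N) (s : ℝ) :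
    Isotopy.multi τ (Pi.single j s) = τ j s := by
  induction N with
  | zero => exact j.elim0
  | succ N ih =>
    rw [Isotopy.multi_succ]
    refine Fin.cases ?_ (fun i => ?_) j
    · have h : (fun i : Fin N => (Pi.single 0 s : Fin (N + 1) → ℝ) i.succ) = 0 := by
        funext i; simp [Fin.succ_ne_zero]
      rw [h, Isotopy.multi_zero, Pi.single_eq_same, mul_one]
    · have h : (fun k : Fin N => (Pi.single i.succ s : Fin (N + 1) → ℝ) k.succ) =
          Pi.single i s := by
        funext k; simp [Pi.single_apply]
      rw [h, ih, Pi.single_eq_of_ne (Fin.succ_ne_zero i).symm, (τ 0).map_zero, one_mul]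

theorem Isotopy.multi_jointlySmooth {N : ℕ} (τ : Fin N → Isotopy Γ) :
    JointlySmooth (fun t => Isotopy.multi τ t) := by
  induction N with
  | zero => simpa [Isotopy.multi] using JointlySmooth.const (1 : 𝒢.Bisection)
  | succ N ih =>
    simp_rw [Isotopy.multi_succ]
    exact ((τ 0).jointlySmooth.comp (contDiff_apply ℝ ℝ 0)).mul
      ((ih fun j => τ j.succ).comp
        (contDiff_pi.2 fun j => contDiff_apply ℝ ℝ j.succ))

end Smooth

/-! ### Derivatives in the model spaces and velocities of isotopies -/

section FlatDerivative

variable {E F H M N L : Type*}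
  [NormedAddCommGroup E] [NormedSpace ℝ E] [NormedAddCommGroup F] [NormedSpace ℝ F]
  [NormedAddCommGroup H] [NormedSpace ℝ H]
  [TopologicalSpace M] [ChartedSpace E M] [TopologicalSpace N] [ChartedSpace F N]
  [TopologicalSpace L] [ChartedSpace H L]

variable (E F) in
/-- The manifold derivative as a linear map between the model spaces. -/
noncomputable def flatDeriv (f : M → N) (x : M) : E →L[ℝ] F := mfderiv 𝓘(ℝ, E) 𝓘(ℝ, F) f x

theorem hasFDerivAt_flatDeriv {f : M → N} {x : M}
    (hf : MDifferentiableAt 𝓘(ℝ, E) 𝓘(ℝ, F) f x) :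
    HasFDerivAt (fun w => extChartAt 𝓘(ℝ, F) (f x) (f ((extChartAt 𝓘(ℝ, E) x).symm w)))
      (flatDeriv E F f x) (extChartAt 𝓘(ℝ, E) x x) := by
  have h : HasFDerivWithinAt (writtenInExtChartAt 𝓘(ℝ, E) 𝓘(ℝ, F) x f) (flatDeriv E F f x)
    (range 𝓘(ℝ, E)) (extChartAt 𝓘(ℝ, E) x x) := hf.hasMFDerivAt.2
  rw [ModelWithCorners.range_eq_univ, hasFDerivWithinAt_univ] at h
  exact h

theorem flatDeriv_comp {g : N → L} {f : M → N} {x : M}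
    (hg : MDifferentiableAt 𝓘(ℝ, F) 𝓘(ℝ, H) g (f x))
    (hf : MDifferentiableAt 𝓘(ℝ, E) 𝓘(ℝ, F) f x) :
    flatDeriv E H (g ∘ f) x = (flatDeriv F H g (f x)).comp (flatDeriv E F f x) :=
  mfderiv_comp x hg hf

theorem flatDeriv_id (x : M) : flatDeriv E E (id : M → M) x = ContinuousLinearMap.id ℝ E :=
  mfderiv_id

theorem flatDeriv_const (c : N) (x : M) : flatDeriv E F (fun _ : M => c) x = 0 := mfderiv_const

end FlatDerivative

section Velocity

variable {r : WithTop ℕ∞} {E F M G : Type*}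
  [NormedAddCommGroup E] [NormedSpace ℝ E] [NormedAddCommGroup F] [NormedSpace ℝ F]
  [TopologicalSpace M] [ChartedSpace E M] [TopologicalSpace G] [ChartedSpace F G]
  {𝒢 : LieGroupoid r E F M G} {Γ : Subgroup 𝒢.Bisection}

/-- The velocity of an isotopy at `x`, as a vector of the model space of `G`. -/
noncomputable def Isotopy.vel (σ : Isotopy Γ) (x : M) : F :=
  flatDeriv ℝ F (fun t : ℝ => σ t x) 0 1

/-- The tangent space of the source fibre at the unit of `x`, in the model space of `G`. -/
noncomputable def fiberDir (𝒢 : LieGroupoid r E F M G) (x : M) : Submodule ℝ F :=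
  (flatDeriv F E 𝒢.src (𝒢.unit x)).ker

theorem Isotopy.mdifferentiableAt_apply (hr : 1 ≤ r) (σ : Isotopy Γ) (x : M) (t : ℝ) :
    MDifferentiableAt 𝓘(ℝ, ℝ) 𝓘(ℝ, F) (fun t : ℝ => σ t x) t :=
  (σ.jointlySmooth.apply x).mdifferentiableAt (zero_lt_one.trans_le hr).ne'

theorem Isotopy.apply_zero (σ : Isotopy Γ) (x : M) : σ 0 x = 𝒢.unit x := by
  rw [σ.map_zero, Bisection.one_apply]

theorem Isotopy.hasDerivAt_vel (hr : 1 ≤ r) (σ : Isotopy Γ) (x : M) :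
    HasDerivAt (fun t => extChartAt 𝓘(ℝ, F) (𝒢.unit x) (σ t x)) (σ.vel x) 0 := by
  have h := hasFDerivAt_flatDeriv (σ.mdifferentiableAt_apply hr x 0)
  rw [σ.apply_zero] at h
  exact h.hasDerivAt

theorem flatDeriv_src_comp_unit (hr : 1 ≤ r) (x : M) (w : E) :
    flatDeriv F E 𝒢.src (𝒢.unit x) (flatDeriv E F 𝒢.unit x w) = w := by
  have hr0 : r ≠ 0 := (zero_lt_one.trans_le hr).ne'
  have h := flatDeriv_comp (x := x) (𝒢.contMDiff_src.mdifferentiableAt hr0 (x := 𝒢.unit x))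
    (𝒢.contMDiff_unit.mdifferentiableAt hr0)
  rw [show 𝒢.src ∘ 𝒢.unit = id from funext 𝒢.src_unit, flatDeriv_id] at h
  exact (congrArg (fun L : E →L[ℝ] E => L w) h).symm

theorem mem_fiberDir {x : M} {v : F} :
    v ∈ 𝒢.fiberDir x ↔ flatDeriv F E 𝒢.src (𝒢.unit x) v = 0 := Iff.rfl

theorem Isotopy.vel_mem_fiberDir (hr : 1 ≤ r) (σ : Isotopy Γ) (x : M) :
    σ.vel x ∈ 𝒢.fiberDir x := by
  have hr0 : r ≠ 0 := (zero_lt_one.trans_le hr).ne'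
  rw [mem_fiberDir]
  have h := flatDeriv_comp (x := (0 : ℝ))
    (𝒢.contMDiff_src.mdifferentiableAt hr0 (x := σ 0 x)) (σ.mdifferentiableAt_apply hr x 0)
  rw [show 𝒢.src ∘ (fun t : ℝ => σ t x) = fun _ => x from funext fun t => (σ t).src_toFun x,
    flatDeriv_const, σ.apply_zero] at h
  exact (congrArg (fun L : ℝ →L[ℝ] E => L 1) h).symm

theorem hasFDerivAt_chart_unit (hr : 1 ≤ r) (x : M) :
    HasFDerivAt (fun w => extChartAt 𝓘(ℝ, F) (𝒢.unit x)
      (𝒢.unit ((extChartAt 𝓘(ℝ, E) x).symm w)))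
      (flatDeriv E F 𝒢.unit x) (extChartAt 𝓘(ℝ, E) x x) :=
  hasFDerivAt_flatDeriv
    (𝒢.contMDiff_unit.mdifferentiableAt (zero_lt_one.trans_le hr).ne')

/-- Velocities are tangent to the source fibre, and there are as many independent ones as its
dimension. -/
theorem FiberwiseTransitive.exists_span [FiniteDimensional ℝ F] (hr : 1 ≤ r)
    (hT : FiberwiseTransitive Γ) (x : M) :
    ∃ (k : ℕ) (σ : Fin k → Isotopy Γ), LinearIndependent ℝ (fun j => (σ j).vel x) ∧
      Submodule.span ℝ (range fun j => (σ j).vel x) = 𝒢.fiberDir x := by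
  obtain ⟨σ, hσ⟩ := hT x
  have hσ' : LinearIndependent ℝ (fun j => (σ j).vel x) := hσ
  refine ⟨_, σ, hσ', ?_⟩
  refine Submodule.eq_of_le_of_finrank_eq ?_ ?_
  · rw [Submodule.span_le]
    rintro _ ⟨j, rfl⟩
    exact (σ j).vel_mem_fiberDir hr x
  · rw [finrank_span_eq_card hσ', Fintype.card_fin]
    rfl

end Velocity

/-! ### The submersion theorem at a configuration of units -/

section Open

variable {r : WithTop ℕ∞} {E F M G : Type*}
  [NormedAddCommGroup E] [NormedSpace ℝ E] 
  [NormedAddCommGroup F] [NormedSpace ℝ F]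
  [TopologicalSpace M] [ChartedSpace E M] [IsManifold 𝓘(ℝ, E) r M]
  [TopologicalSpace G] [ChartedSpace F G] [IsManifold 𝓘(ℝ, F) r G]
  {𝒢 : LieGroupoid r E F M G} {Γ : Subgroup 𝒢.Bisection}

theorem JointlySmooth.contDiffAt_chart {P : Type*} [NormedAddCommGroup P] [NormedSpace ℝ P]
    {ι : Type*} [Fintype ι] {a : P → 𝒢.Bisection} (ha : JointlySmooth a) (q : ι → M) {p : P}
    {w : ι → E} (hw : ∀ i, w i ∈ (extChartAt 𝓘(ℝ, E) (q i)).target) {g : ι → G}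
    (hg : ∀ i, a p ((extChartAt 𝓘(ℝ, E) (q i)).symm (w i)) ∈
      (extChartAt 𝓘(ℝ, F) (g i)).source) :
    ContDiffAt ℝ r (fun z : P × (ι → E) => fun i => extChartAt 𝓘(ℝ, F) (g i)
      (a z.1 ((extChartAt 𝓘(ℝ, E) (q i)).symm (z.2 i)))) (p, w) := by
  rw [contDiffAt_pi]
  intro i
  rw [← contMDiffAt_iff_contDiffAt]
  have h1 : ContMDiffAt 𝓘(ℝ, P × (ι → E)) 𝓘(ℝ, E) r
      (fun z : P × (ι → E) => (extChartAt 𝓘(ℝ, E) (q i)).symm (z.2 i)) (p, w) := by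
    have hs : ContMDiffAt 𝓘(ℝ, E) 𝓘(ℝ, E) r (extChartAt 𝓘(ℝ, E) (q i)).symm (w i) :=
      (contMDiffOn_extChartAt_symm (q i)).contMDiffAt
        ((isOpen_extChartAt_target (q i)).mem_nhds (hw i))
    have hl : ContMDiffAt 𝓘(ℝ, P × (ι → E)) 𝓘(ℝ, E) r
        (fun z : P × (ι → E) => z.2 i) (p, w) :=
      (((contDiff_apply ℝ E i).comp contDiff_snd).contMDiff).contMDiffAt
    exact ContMDiffAt.comp (g := (extChartAt 𝓘(ℝ, E) (q i)).symm) (p, w) hs hl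
  have h2 : ContMDiffAt 𝓘(ℝ, P × (ι → E)) (𝓘(ℝ, P).prod 𝓘(ℝ, E)) r
      (fun z : P × (ι → E) => (z.1, (extChartAt 𝓘(ℝ, E) (q i)).symm (z.2 i))) (p, w) :=
    (contDiff_fst.contMDiff.contMDiffAt).prodMk h1
  have h3 := ContMDiffAt.comp (g := fun z : P × M => a z.1 z.2) (p, w) ha.contMDiffAt h2
  exact ContMDiffAt.comp (g := extChartAt 𝓘(ℝ, F) (g i)) (p, w)
    (contMDiffAt_extChartAt' (by simpa using hg i)) h3

/-- If the velocities of `τ` span the tangent space of the source fibre at a configuration of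
points, then the product family covers a neighbourhood of the units. -/
theorem Isotopy.eventually_exists_multi [FiniteDimensional ℝ E] [FiniteDimensional ℝ F]
    (hr : 1 ≤ r) {ι : Type*} [Fintype ι] (q : ι → M) {N : ℕ}
    (τ : Fin N → Isotopy Γ)
    (hτ : ∀ v : ι → F, (∀ i, v i ∈ 𝒢.fiberDir (q i)) →
      v ∈ Submodule.span ℝ (range fun j => fun i => (τ j).vel (q i)))
    {S : Set (Fin N → ℝ)} (hS : S ∈ 𝓝 0) :
    ∀ᶠ u in 𝓝 (fun i => 𝒢.unit (q i)), ∃ t ∈ S, ∀ i, u i = Isotopy.multi τ t (𝒢.src (u i)) := by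
  classical
  set c : ι → E := fun i => extChartAt 𝓘(ℝ, E) (q i) (q i) with hc
  have hcs : ∀ i, (extChartAt 𝓘(ℝ, E) (q i)).symm (c i) = q i := fun i => extChartAt_to_inv _
  set f : (Fin N → ℝ) × (ι → E) → (ι → F) := fun z => fun i =>
    extChartAt 𝓘(ℝ, F) (𝒢.unit (q i))
      (Isotopy.multi τ z.1 ((extChartAt 𝓘(ℝ, E) (q i)).symm (z.2 i))) with hf
  have hm0 : ∀ x, Isotopy.multi τ 0 x = 𝒢.unit x := fun x => by
    rw [Isotopy.multi_zero, Bisection.one_apply]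
  have hfd : ContDiffAt ℝ r f (0, c) :=
    (Isotopy.multi_jointlySmooth τ).contDiffAt_chart q (fun i => mem_extChartAt_target _)
      (fun i => by rw [hcs, hm0]; exact mem_extChartAt_source _)
  have hr0 : r ≠ 0 := (zero_lt_one.trans_le hr).ne'
  have hstr := hfd.hasStrictFDerivAt hr0
  set f' := fderiv ℝ f (0, c) with hf'
  have hsingle : ∀ j, f' (Pi.single j 1, 0) = fun i => (τ j).vel (q i) := by
    intro j
    have hl : HasDerivAt (fun s : ℝ => ((Pi.single j s : Fin N → ℝ), c))
        (Pi.single j 1, 0) 0 := by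
      refine HasDerivAt.prodMk ?_ (hasDerivAt_const _ _)
      exact hasDerivAt_single j (0 : ℝ)
    have h1 : HasDerivAt (f ∘ fun s : ℝ => ((Pi.single j s : Fin N → ℝ), c))
        (f' (Pi.single j 1, 0)) 0 := by
      refine HasFDerivAt.comp_hasDerivAt (0 : ℝ) ?_ hl
      rw [Pi.single_zero]
      exact hstr.hasFDerivAt
    have h2 : HasDerivAt (f ∘ fun s : ℝ => ((Pi.single j s : Fin N → ℝ), c))
        (fun i => (τ j).vel (q i)) 0 := by
      rw [hasDerivAt_pi]
      intro i
      have := (τ j).hasDerivAt_vel hr (q i)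
      simp only [hf, Function.comp_def, hcs, Isotopy.multi_single]
      exact this
    exact h1.unique h2
  have hbase : ∀ w, f' (0, w) = fun i =>
      (flatDeriv E F 𝒢.unit (q i)) (w i) := by
    intro w
    have hl : HasFDerivAt (fun w : ι → E => ((0 : Fin N → ℝ), w))
        (ContinuousLinearMap.inr ℝ (Fin N → ℝ) (ι → E)) c := hasFDerivAt_prodMk_right _ _
    have h1 : HasFDerivAt (f ∘ fun w : ι → E => ((0 : Fin N → ℝ), w))
        (f'.comp (ContinuousLinearMap.inr ℝ (Fin N → ℝ) (ι → E))) c :=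
      hstr.hasFDerivAt.comp c hl
    have h2 : HasFDerivAt (f ∘ fun w : ι → E => ((0 : Fin N → ℝ), w))
        (ContinuousLinearMap.pi fun i =>
          (flatDeriv E F 𝒢.unit (q i)).comp
            (ContinuousLinearMap.proj i)) c := by
      rw [hasFDerivAt_pi]
      intro i
      have h3 := (hasFDerivAt_chart_unit (𝒢 := 𝒢) hr (q i)).comp (f := fun w : ι → E => w i) c
        (hasFDerivAt_apply i c)
      simp only [hf, Function.comp_def, hm0]
      exact h3
    have := congrArg (fun L : (ι → E) →L[ℝ] (ι → F) => L w) (h1.unique h2)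
    simpa using this
  have hsurj : f'.range = ⊤ := by
    rw [eq_top_iff]
    intro v _
    -- Moving the base points by `w`, the source component of `v`, accounts for `v` up to a vector
    -- tangent to the source fibres, which `hτ` handles.
    let w : ι → E := fun i =>
      flatDeriv F E 𝒢.src (𝒢.unit (q i)) (v i)
    have hker : ∀ i, (v - f' (0, w)) i ∈ 𝒢.fiberDir (q i) := by
      intro i
      rw [mem_fiberDir, hbase, Pi.sub_apply, map_sub, flatDeriv_src_comp_unit hr, sub_self]
    have hsp := hτ _ hker
    rw [Submodule.mem_span_range_iff_exists_fun] at hsp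
    obtain ⟨b, hb⟩ := hsp
    refine ⟨∑ j, b j • (Pi.single j 1, 0) + (0, w), ?_⟩
    change f' _ = v
    rw [map_add, map_sum]
    simp_rw [map_smul, hsingle]
    rw [hb, sub_add_cancel]
  have hmap := hstr.map_nhds_eq_of_surj hsurj
  have hf0 : f (0, c) = fun i => extChartAt 𝓘(ℝ, F) (𝒢.unit (q i)) (𝒢.unit (q i)) := by
    funext i; simp only [hf, hcs, hm0]
  have hcont : ContinuousAt (fun z : (Fin N → ℝ) × (ι → E) => fun i =>
      Isotopy.multi τ z.1 ((extChartAt 𝓘(ℝ, E) (q i)).symm (z.2 i))) (0, c) := by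
    rw [continuousAt_pi]
    intro i
    have h1 : ContinuousAt (fun z : (Fin N → ℝ) × (ι → E) =>
        (z.1, (extChartAt 𝓘(ℝ, E) (q i)).symm (z.2 i))) (0, c) := by
      refine continuousAt_fst.prodMk ?_
      refine ContinuousAt.comp (g := (extChartAt 𝓘(ℝ, E) (q i)).symm)
        (f := fun z : (Fin N → ℝ) × (ι → E) => z.2 i) (continuousAt_extChartAt_symm _) ?_
      exact ((continuous_apply i).comp continuous_snd).continuousAt
    exact ContinuousAt.comp (g := fun z : (Fin N → ℝ) × M => Isotopy.multi τ z.1 z.2)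
      (Isotopy.multi_jointlySmooth τ).continuous.continuousAt h1
  have hgood : {z : (Fin N → ℝ) × (ι → E) | z.1 ∈ S ∧ ∀ i,
      Isotopy.multi τ z.1 ((extChartAt 𝓘(ℝ, E) (q i)).symm (z.2 i)) ∈
        (extChartAt 𝓘(ℝ, F) (𝒢.unit (q i))).source} ∈ 𝓝 ((0 : Fin N → ℝ), c) := by
    refine Filter.Eventually.and (continuousAt_fst hS) ?_
    rw [Filter.eventually_all]
    intro i
    have := (continuousAt_pi.1 hcont) i
    refine this.eventually ?_
    simp only [hcs, hm0]
    exact extChartAt_source_mem_nhds _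
  have himg : f '' {z | z.1 ∈ S ∧ ∀ i,
      Isotopy.multi τ z.1 ((extChartAt 𝓘(ℝ, E) (q i)).symm (z.2 i)) ∈
        (extChartAt 𝓘(ℝ, F) (𝒢.unit (q i))).source} ∈ 𝓝 (f (0, c)) := by
    rw [← hmap]; exact image_mem_map hgood
  have hchart : ContinuousAt (fun u : ι → G => fun i =>
      extChartAt 𝓘(ℝ, F) (𝒢.unit (q i)) (u i)) (fun i => 𝒢.unit (q i)) := by
    rw [continuousAt_pi]
    intro i
    exact ContinuousAt.comp (g := extChartAt 𝓘(ℝ, F) (𝒢.unit (q i)))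
      (f := fun u : ι → G => u i) (continuousAt_extChartAt _) (continuous_apply i).continuousAt
  rw [hf0] at himg
  have hsrc : ∀ᶠ u : ι → G in 𝓝 (fun i => 𝒢.unit (q i)),
      ∀ i, u i ∈ (extChartAt 𝓘(ℝ, F) (𝒢.unit (q i))).source := by
    rw [Filter.eventually_all]
    intro i
    exact (continuous_apply i).continuousAt (x := fun i => 𝒢.unit (q i))
      (extChartAt_source_mem_nhds (I := 𝓘(ℝ, F)) (𝒢.unit (q i)))
  filter_upwards [hchart himg, hsrc] with u hu hus
  obtain ⟨z, ⟨hz1, hz2⟩, hz⟩ := hu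
  have key : ∀ i, u i = Isotopy.multi τ z.1 ((extChartAt 𝓘(ℝ, E) (q i)).symm (z.2 i)) :=
    fun i => ((extChartAt 𝓘(ℝ, F) (𝒢.unit (q i))).injOn (hus i) (hz2 i)
      (congrFun hz i).symm)
  refine ⟨z.1, hz1, fun i => ?_⟩
  have h5 := key i
  have h6 : 𝒢.src (u i) = (extChartAt 𝓘(ℝ, E) (q i)).symm (z.2 i) := by
    rw [h5, Bisection.src_toFun]
  rw [h6]; exact h5

end Open

/-! ### Locally realized relations along a source fibre -/

section Local

variable {r : WithTop ℕ∞} {E F M G : Type*}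
  [NormedAddCommGroup E] [NormedSpace ℝ E] [NormedAddCommGroup F] [NormedSpace ℝ F]
  [TopologicalSpace M] [ChartedSpace E M] [TopologicalSpace G] [ChartedSpace F G]
  {𝒢 : LieGroupoid r E F M G} {Γ : Subgroup 𝒢.Bisection}

theorem mul_inv_mul {g h : G} (hgh : 𝒢.src h = 𝒢.src g) :
    𝒢.mul (𝒢.mul h (𝒢.inv g)) g = h := by
  rw [𝒢.mul_assoc _ _ _ (by rw [hgh, 𝒢.tgt_inv]) (𝒢.src_inv g), 𝒢.inv_mul, ← hgh, 𝒢.mul_unit]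

theorem src_mul_inv {g h : G} (hgh : 𝒢.src h = 𝒢.src g) :
    𝒢.src (𝒢.mul h (𝒢.inv g)) = 𝒢.tgt g := by
  rw [𝒢.src_mul _ _ (by rw [hgh, 𝒢.tgt_inv]), 𝒢.src_inv]

theorem tgt_mul_inv {g h : G} (hgh : 𝒢.src h = 𝒢.src g) :
    𝒢.tgt (𝒢.mul h (𝒢.inv g)) = 𝒢.tgt h :=
  𝒢.tgt_mul _ _ (by rw [hgh, 𝒢.tgt_inv])

theorem tendsto_mul_inv (g : G) :
    Tendsto (fun p : G × G => 𝒢.mul p.2 (𝒢.inv p.1))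
      (𝓝[𝒢.src ⁻¹' {𝒢.src g}] g ×ˢ 𝓝[𝒢.src ⁻¹' {𝒢.src g}] g) (𝓝 (𝒢.unit (𝒢.tgt g))) := by
  have h : ContinuousOn (fun p : G × G => 𝒢.mul p.2 (𝒢.inv p.1))
      ((𝒢.src ⁻¹' {𝒢.src g}) ×ˢ (𝒢.src ⁻¹' {𝒢.src g})) := by
    refine continuousOn_mul.comp (f := fun p : G × G => (p.2, 𝒢.inv p.1))
      (continuous_snd.prodMk (𝒢.contMDiff_inv.continuous.comp continuous_fst)).continuousOn ?_
    rintro ⟨a, b⟩ ⟨ha, hb⟩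
    change 𝒢.src b = 𝒢.tgt (𝒢.inv a)
    rw [𝒢.tgt_inv, show 𝒢.src a = 𝒢.src g from ha, show 𝒢.src b = 𝒢.src g from hb]
  have h1 := h (g, g) ⟨rfl, rfl⟩
  rw [ContinuousWithinAt, nhdsWithin_prod_eq, 𝒢.mul_inv] at h1
  exact h1

/-- Dividing by `g` transports statements about arrows near a unit to arrows near `g` in its source
fibre. -/
theorem eventually_fiber_of_eventually_unit {g : G} {p : G → Prop}
    (hp : ∀ᶠ u in 𝓝 (𝒢.unit (𝒢.tgt g)), p u) :
    ∀ᶠ h in 𝓝[𝒢.src ⁻¹' {𝒢.src g}] g, p (𝒢.mul h (𝒢.inv g)) := by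
  have h1 : Tendsto (fun h : G => (g, h)) (𝓝[𝒢.src ⁻¹' {𝒢.src g}] g)
      (𝓝[𝒢.src ⁻¹' {𝒢.src g}] g ×ˢ 𝓝[𝒢.src ⁻¹' {𝒢.src g}] g) :=
    (tendsto_const_pure.mono_right
      (pure_le_nhdsWithin (show g ∈ 𝒢.src ⁻¹' {𝒢.src g} from rfl))).prodMk tendsto_id
  exact ((tendsto_mul_inv (𝒢 := 𝒢) g).comp h1).eventually hp

variable (Γ) in
/-- A relation between points of `M` which is realized by every isotopy near a point. -/
def LocallyRealized (ρ : M → M → Prop) (z : M) : Prop :=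
  ∀ σ : Isotopy Γ, ∀ᶠ p : ℝ × M in 𝓝 (0, z), ρ p.2 ((σ p.1).baseMap p.2)

/-- For small times all factors but the first leave a point close to `z`, where the hypothesis
applies to the first factor; transitivity composes the two moves. -/
theorem LocallyRealized.multi {ρ : M → M → Prop} (hrefl : ∀ a, ρ a a)
    (htrans : ∀ a b c, ρ a b → ρ b c → ρ a c) {z : M} (hz : LocallyRealized Γ ρ z) {N : ℕ}
    (τ : Fin N → Isotopy Γ) :
    ∀ᶠ p : (Fin N → ℝ) × M in 𝓝 (0, z), ρ p.2 ((Isotopy.multi τ p.1).baseMap p.2) := by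
  induction N with
  | zero =>
    refine Eventually.of_forall fun p => ?_
    simp [Isotopy.multi, Bisection.baseMap_one, hrefl]
  | succ N ih =>
    have hc : Continuous fun p : (Fin (N + 1) → ℝ) × M => ((fun j : Fin N => p.1 j.succ), p.2) :=
      (continuous_pi fun j => (continuous_apply j.succ).comp continuous_fst).prodMk continuous_snd
    have h1 : ∀ᶠ p : (Fin (N + 1) → ℝ) × M in 𝓝 (0, z),
        ρ p.2 ((Isotopy.multi (fun j => τ j.succ) fun j => p.1 j.succ).baseMap p.2) :=
      (hc.tendsto ((0 : Fin (N + 1) → ℝ), z)).eventually (ih fun j => τ j.succ)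
    have hc2 : Continuous fun p : (Fin (N + 1) → ℝ) × M => (p.1 0,
        (Isotopy.multi (fun j => τ j.succ) fun j => p.1 j.succ).baseMap p.2) :=
      ((continuous_apply 0).comp continuous_fst).prodMk
        ((Isotopy.multi_jointlySmooth fun j => τ j.succ).baseMap.continuous.comp hc)
    have h2 := hc2.tendsto ((0 : Fin (N + 1) → ℝ), z)
    change Tendsto _ _ (𝓝 ((0 : ℝ), (Isotopy.multi (fun j => τ j.succ) 0).baseMap z)) at h2
    rw [Isotopy.multi_zero, Bisection.baseMap_one, id] at h2
    filter_upwards [h1, h2.eventually (hz (τ 0))] with p hp1 hp2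
    rw [Isotopy.multi_succ, Bisection.baseMap_mul]
    exact htrans _ _ _ hp1 hp2

variable [FiniteDimensional ℝ E] [FiniteDimensional ℝ F]
  [IsManifold 𝓘(ℝ, E) r M] [IsManifold 𝓘(ℝ, F) r G]

theorem Isotopy.eventually_exists_multi_point (hr : 1 ≤ r) {z : M} {N : ℕ} (τ : Fin N → Isotopy Γ)
    (hτ : 𝒢.fiberDir z ≤ Submodule.span ℝ (range fun j => (τ j).vel z))
    {S : Set (Fin N → ℝ)} (hS : S ∈ 𝓝 0) :
    ∀ᶠ u in 𝓝 (𝒢.unit z), ∃ t ∈ S, u = Isotopy.multi τ t (𝒢.src u) := by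
  have h := Isotopy.eventually_exists_multi hr (fun _ : Unit => z) τ (fun v hv => by
    obtain ⟨b, hb⟩ := (Submodule.mem_span_range_iff_exists_fun ℝ).1 (hτ (hv ()))
    refine (Submodule.mem_span_range_iff_exists_fun ℝ).2 ⟨b, funext fun i => ?_⟩
    simpa using hb) hS
  have hc : Continuous fun u : G => fun _ : Unit => u := continuous_pi fun _ => continuous_id
  filter_upwards [(hc.tendsto (𝒢.unit z)).eventually h] with u hu
  obtain ⟨t, ht, hut⟩ := hu
  exact ⟨t, ht, hut ()⟩

theorem Isotopy.eventually_exists_multi_fiber (hr : 1 ≤ r) {g : G} {N : ℕ} (τ : Fin N → Isotopy Γ)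
    (hτ : 𝒢.fiberDir (𝒢.tgt g) ≤ Submodule.span ℝ (range fun j => (τ j).vel (𝒢.tgt g)))
    {S : Set (Fin N → ℝ)} (hS : S ∈ 𝓝 0) :
    ∀ᶠ h in 𝓝[𝒢.src ⁻¹' {𝒢.src g}] g, ∃ t ∈ S, h = Isotopy.multi τ t • g := by
  filter_upwards [eventually_fiber_of_eventually_unit
    (Isotopy.eventually_exists_multi_point hr τ hτ hS), self_mem_nhdsWithin] with h hh hhg
  obtain ⟨t, ht, hht⟩ := hh
  refine ⟨t, ht, ?_⟩
  have hhg' : 𝒢.src h = 𝒢.src g := hhg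
  rw [src_mul_inv hhg'] at hht
  rw [Bisection.smul_def, ← hht, mul_inv_mul hhg']

/-- A transitive relation realized by all isotopies near a point relates the targets of all pairs of
nearby arrows in a source fibre. -/
theorem LocallyRealized.exists_nhds (hr : 1 ≤ r) (hT : FiberwiseTransitive Γ)
    {ρ : M → M → Prop} (hrefl : ∀ a, ρ a a)
    (htrans : ∀ a b c, ρ a b → ρ b c → ρ a c) {g : G} (hz : LocallyRealized Γ ρ (𝒢.tgt g)) :
    ∃ N ∈ 𝓝[𝒢.src ⁻¹' {𝒢.src g}] g, ∀ h ∈ N, ∀ h' ∈ N, ρ (𝒢.tgt h) (𝒢.tgt h') := by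
  obtain ⟨k, τ, -, hτ⟩ := hT.exists_span hr (𝒢.tgt g)
  have h1 := hz.multi hrefl htrans τ
  rw [nhds_prod_eq] at h1
  obtain ⟨S, hS, A, hA, hSA⟩ := eventually_prod_iff.1 h1
  -- For `h`, `h'` near `g` in the fibre, the quotient of `h'` by `h` is near the unit at `tgt g`,
  -- but its source is the varying point `tgt h`. It is a value of the product family at that point,
  -- so `tgt h` moves to `tgt h'`. This is why the submersion theorem covers a full neighbourhood of
  -- the unit and not just a fibre.
  have h2 := (tendsto_mul_inv (𝒢 := 𝒢) g).eventually
    (Isotopy.eventually_exists_multi_point hr τ hτ.ge (S := {t | S t}) hS)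
  have h3 : ∀ᶠ h in 𝓝[𝒢.src ⁻¹' {𝒢.src g}] g, A (𝒢.tgt h) :=
    (𝒢.contMDiff_tgt.continuous.continuousAt.tendsto.mono_left nhdsWithin_le_nhds).eventually hA
  have h4 : ∀ᶠ h in 𝓝[𝒢.src ⁻¹' {𝒢.src g}] g, 𝒢.src h = 𝒢.src g := self_mem_nhdsWithin
  have h5 : ∀ᶠ p in 𝓝[𝒢.src ⁻¹' {𝒢.src g}] g ×ˢ 𝓝[𝒢.src ⁻¹' {𝒢.src g}] g,
      ρ (𝒢.tgt p.1) (𝒢.tgt p.2) := by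
    filter_upwards [h2, (h3.and h4).prod_inl _, h4.prod_inr _] with p hp hp1 hp2
    obtain ⟨t, ht, hpt⟩ := hp
    have hsrc : 𝒢.src p.2 = 𝒢.src p.1 := hp2.trans hp1.2.symm
    rw [src_mul_inv hsrc] at hpt
    have := hSA ht hp1.1
    rwa [Bisection.baseMap, ← hpt, tgt_mul_inv hsrc] at this
  exact eventually_prod_self_iff.1 h5

/-- The arrows reached from `g` by the product family form a continuous image of a Euclidean space,
hence lie in one component, and they fill a neighbourhood in the fibre. -/
theorem fiberComponent_mem_nhdsWithin (hr : 1 ≤ r) (hT : FiberwiseTransitive Γ) {x : M} {g : G}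
    (hg : g ∈ 𝒢.fiberComponent x) : 𝒢.fiberComponent x ∈ 𝓝[𝒢.src ⁻¹' {𝒢.src g}] g := by
  obtain ⟨k, τ, -, hτ⟩ := hT.exists_span hr (𝒢.tgt g)
  filter_upwards [Isotopy.eventually_exists_multi_fiber hr τ hτ.ge univ_mem] with h hh
  obtain ⟨t, -, rfl⟩ := hh
  have hc : Continuous fun t => Isotopy.multi τ t • g :=
    (Isotopy.multi_jointlySmooth τ).smul.continuous.comp
      (continuous_id.prodMk continuous_const)
  refine subset_fiberComponent hg (isPreconnected_range hc) ⟨0, ?_⟩ ?_ ⟨t, rfl⟩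
  · change Isotopy.multi τ 0 • g = g
    rw [Isotopy.multi_zero, one_smul]
  · rintro _ ⟨s, rfl⟩
    change 𝒢.src (_ • g) = x
    rw [Bisection.src_smul, src_of_mem_fiberComponent hg]

end Local

/-! ### Two independent directions of motion in the base -/

section RankTwo

variable {r : WithTop ℕ∞} {E F M G : Type*}
  [NormedAddCommGroup E] [NormedSpace ℝ E] [NormedAddCommGroup F] [NormedSpace ℝ F]
  [TopologicalSpace M] [ChartedSpace E M] [TopologicalSpace G] [ChartedSpace F G]
  {𝒢 : LieGroupoid r E F M G} {Γ : Subgroup 𝒢.Bisection}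

/-- The velocity at `x` of the motion of the base induced by an isotopy. -/
noncomputable def Isotopy.baseVel (σ : Isotopy Γ) (x : M) : E :=
  flatDeriv ℝ E (fun t : ℝ => (σ t).baseMap x) 0 1

theorem Isotopy.baseMap_zero (σ : Isotopy Γ) (x : M) : (σ 0).baseMap x = x := by
  rw [σ.map_zero, Bisection.baseMap_one, id]

theorem Isotopy.mdifferentiableAt_baseMap (hr : 1 ≤ r) (σ : Isotopy Γ) (x : M) (t : ℝ) :
    MDifferentiableAt 𝓘(ℝ, ℝ) 𝓘(ℝ, E) (fun t : ℝ => (σ t).baseMap x) t :=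
  (𝒢.contMDiff_tgt.comp (σ.jointlySmooth.apply x)).mdifferentiableAt
    (zero_lt_one.trans_le hr).ne'

theorem Isotopy.hasDerivAt_baseVel (hr : 1 ≤ r) (σ : Isotopy Γ) (x : M) :
    HasDerivAt (fun t => extChartAt 𝓘(ℝ, E) x ((σ t).baseMap x)) (σ.baseVel x) 0 := by
  have h := hasFDerivAt_flatDeriv (σ.mdifferentiableAt_baseMap hr x 0)
  rw [σ.baseMap_zero] at h
  exact h.hasDerivAt

theorem Isotopy.baseVel_eq (hr : 1 ≤ r) (σ : Isotopy Γ) (x : M) :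
    σ.baseVel x = flatDeriv F E 𝒢.tgt (𝒢.unit x) (σ.vel x) := by
  have h := flatDeriv_comp (x := (0 : ℝ))
    (𝒢.contMDiff_tgt.mdifferentiableAt (zero_lt_one.trans_le hr).ne' (x := σ 0 x))
    (σ.mdifferentiableAt_apply hr x 0)
  rw [σ.apply_zero] at h
  exact congrArg (fun L : ℝ →L[ℝ] E => L 1) h

variable (Γ) in
/-- Two isotopies move the base point in linearly independent directions. -/
def HasRankTwo (x : M) : Prop :=
  ∃ σ : Fin 2 → Isotopy Γ, LinearIndependent ℝ fun j => (σ j).baseVel x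

/-- The target differential carries velocities spanning the fibre directions to vectors spanning the
tangent space of the leaf; two of these can be chosen independent. -/
theorem hasRankTwo_of_two_le_leafDim [FiniteDimensional ℝ E] [FiniteDimensional ℝ F]
    (hr : 1 ≤ r) (hT : FiberwiseTransitive Γ) {x : M}
    (hx : 2 ≤ 𝒢.leafDim x) : HasRankTwo Γ x := by
  obtain ⟨k, τ, -, hτ⟩ := hT.exists_span hr x
  have h1 : 2 ≤ Module.finrank ℝ
      ((𝒢.fiberDir x).map (flatDeriv F E 𝒢.tgt (𝒢.unit x)).toLinearMap) := hx
  have h2 : (𝒢.fiberDir x).map (flatDeriv F E 𝒢.tgt (𝒢.unit x)).toLinearMap =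
      Submodule.span ℝ (range fun j => (τ j).baseVel x) := by
    rw [← hτ, Submodule.map_span, ← range_comp]
    congr 2
    funext j
    exact ((τ j).baseVel_eq hr x).symm
  rw [h2] at h1
  obtain ⟨f, hf, -, hli⟩ := Submodule.exists_fun_fin_finrank_span_eq ℝ
    (range fun j => (τ j).baseVel x)
  choose i hi using hf
  refine ⟨fun j => τ (i (Fin.castLE h1 j)), ?_⟩
  have h3 := hli.comp (Fin.castLE h1) (Fin.castLE_injective h1)
  rwa [show f ∘ Fin.castLE h1 = fun j => (τ (i (Fin.castLE h1 j))).baseVel x from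
    funext fun j => (hi _).symm] at h3

/-- Conjugating the two isotopies by `s` pushes their base velocities forward by the differential of
a diffeomorphism, which is injective. -/
theorem HasRankTwo.baseMap (hr : 1 ≤ r) {x : M} (hx : HasRankTwo Γ x) {s : 𝒢.Bisection}
    (hs : s ∈ Γ) : HasRankTwo Γ (s.baseMap x) := by
  obtain ⟨σ, hσ⟩ := hx
  have hr0 : r ≠ 0 := (zero_lt_one.trans_le hr).ne'
  let σ' : Fin 2 → Isotopy Γ := fun j => Isotopy.ofJointlySmooth (fun t => s * σ j t * s⁻¹)
    (((JointlySmooth.const s).mul (σ j).jointlySmooth).mul (JointlySmooth.const _))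
    (fun t => mul_mem (mul_mem hs ((σ j).mem t)) (inv_mem hs))
    (by rw [(σ j).map_zero, mul_one, mul_inv_cancel])
  have hd : ∀ (b : 𝒢.Bisection) (y : M), MDifferentiableAt 𝓘(ℝ, E) 𝓘(ℝ, E) b.baseMap y :=
    fun b y => b.contMDiff_baseMap.mdifferentiableAt hr0
  have hinj : (flatDeriv E E s.baseMap x).ker = ⊥ := by
    rw [LinearMap.ker_eq_bot]
    have h := flatDeriv_comp (hd s⁻¹ (s.baseMap x)) (hd s x)
    rw [show s⁻¹.baseMap ∘ s.baseMap = id from funext s.baseMap_inv_apply, flatDeriv_id] at h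
    refine Function.LeftInverse.injective (g := flatDeriv E E s⁻¹.baseMap (s.baseMap x))
      fun v => ?_
    exact (congrArg (fun L : E →L[ℝ] E => L v) h).symm
  have h2 : LinearIndependent ℝ fun j => flatDeriv E E s.baseMap x ((σ j).baseVel x) :=
    hσ.map' (flatDeriv E E s.baseMap x).toLinearMap hinj
  suffices h : ∀ j, (σ' j).baseVel (s.baseMap x) = flatDeriv E E s.baseMap x ((σ j).baseVel x) by
    exact ⟨σ', by simpa only [h] using h2⟩
  intro j
  have h := flatDeriv_comp (f := fun t => (σ j t).baseMap x)
    (hd s ((σ j 0).baseMap x)) ((σ j).mdifferentiableAt_baseMap hr x 0)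
  rw [(σ j).baseMap_zero] at h
  have h3 : (fun t => (s * σ j t * s⁻¹).baseMap (s.baseMap x)) =
      s.baseMap ∘ fun t => (σ j t).baseMap x := by
    funext t
    simp only [Bisection.baseMap_mul, Function.comp_apply, Bisection.baseMap_inv_apply]
  change flatDeriv ℝ E (fun t => (s * σ j t * s⁻¹).baseMap (s.baseMap x)) 0 1 = _
  rw [h3, h]
  rfl

end RankTwo

/-! ### Joining points of a leaf around a finite set -/

section Leaf

variable {r : WithTop ℕ∞} {E F M G : Type*}
  [NormedAddCommGroup E] [NormedSpace ℝ E] [FiniteDimensional ℝ E]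
  [NormedAddCommGroup F] [NormedSpace ℝ F] [FiniteDimensional ℝ F]
  [TopologicalSpace M] [ChartedSpace E M] [TopologicalSpace G] [ChartedSpace F G]
  [IsManifold 𝓘(ℝ, E) r M] [IsManifold 𝓘(ℝ, F) r G]
  {𝒢 : LieGroupoid r E F M G} {Γ : Subgroup 𝒢.Bisection}

/-- If the leaf has dimension at least two, the arrows of a source fibre which end at a given point
do not separate the source fibre locally. -/
theorem exists_isPreconnected_diff_tgt [T1Space M] (hr : 1 ≤ r) (hT : FiberwiseTransitive Γ) {g : G}
    (hg : HasRankTwo Γ (𝒢.tgt g)) {Z : Set M} (hZ : Z.Finite) (hgZ : 𝒢.tgt g ∈ Z)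
    {U : Set G} (hU : U ∈ 𝓝[𝒢.src ⁻¹' {𝒢.src g}] g) :
    ∃ K ⊆ U \ 𝒢.tgt ⁻¹' Z, K ⊆ 𝒢.src ⁻¹' {𝒢.src g} ∧ IsPreconnected K ∧ g ∈ closure K ∧
      ∃ N ∈ 𝓝[𝒢.src ⁻¹' {𝒢.src g}] g, N \ 𝒢.tgt ⁻¹' Z ⊆ K := by
  set z := 𝒢.tgt g with hz
  have hr0 : r ≠ 0 := (zero_lt_one.trans_le hr).ne'
  obtain ⟨k, τ, -, hτ⟩ := hT.exists_span hr z
  obtain ⟨σ, hσ⟩ := hg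
  -- The block `τ` makes the products cover the fibre near `g`; the block `σ` gives the endpoint map
  -- `f` rank at least two.
  let θ : Fin (k + 2) → Isotopy Γ := Fin.append τ σ
  have hθ : 𝒢.fiberDir z ≤ Submodule.span ℝ (range fun j => (θ j).vel z) := by
    rw [← hτ]
    refine Submodule.span_mono ?_
    rintro _ ⟨j, rfl⟩
    exact ⟨Fin.castAdd 2 j, by simp [θ]⟩
  have hJ := Isotopy.multi_jointlySmooth θ
  have hbc : ContMDiff 𝓘(ℝ, Fin (k + 2) → ℝ) 𝓘(ℝ, E) r
      (fun t => (Isotopy.multi θ t).baseMap z) :=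
    𝒢.contMDiff_tgt.comp (hJ.apply z)
  have hb0 : (Isotopy.multi θ 0).baseMap z = z := by
    rw [Isotopy.multi_zero, Bisection.baseMap_one, id]
  have hb1 : ∀ j s, Isotopy.multi θ (Pi.single j s) = θ j s := Isotopy.multi_single θ
  set f : (Fin (k + 2) → ℝ) → E := fun t =>
    extChartAt 𝓘(ℝ, E) z ((Isotopy.multi θ t).baseMap z) with hf
  have hfd : ContDiffAt ℝ r f 0 := by
    rw [← contMDiffAt_iff_contDiffAt]
    refine ContMDiffAt.comp (g := extChartAt 𝓘(ℝ, E) z) 0 ?_ hbc.contMDiffAt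
    rw [hb0]; exact contMDiffAt_extChartAt
  have hstr := hfd.hasStrictFDerivAt hr0
  have hv : LinearIndependent ℝ
      fun j => fderiv ℝ f 0 (Pi.single (Fin.natAdd k j : Fin (k + 2)) (1 : ℝ)) := by
    convert hσ using 1
    funext j
    have hl : HasDerivAt (fun s : ℝ => (Pi.single (Fin.natAdd k j) s : Fin (k + 2) → ℝ))
        (Pi.single (Fin.natAdd k j) 1) 0 := hasDerivAt_single _ (0 : ℝ)
    have h1 : HasDerivAt (f ∘ fun s : ℝ => (Pi.single (Fin.natAdd k j) s : Fin (k + 2) → ℝ))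
        (fderiv ℝ f 0 (Pi.single (Fin.natAdd k j) 1)) 0 := by
      refine HasFDerivAt.comp_hasDerivAt (0 : ℝ) ?_ hl
      rw [Pi.single_zero]
      exact hstr.hasFDerivAt
    refine h1.unique ?_
    have h2 := (σ j).hasDerivAt_baseVel hr z
    simp only [hf, Function.comp_def, hb1, θ, Fin.append_right]
    exact h2
  have hsm : Continuous fun t => Isotopy.multi θ t • g :=
    hJ.smul.continuous.comp (continuous_id.prodMk continuous_const)
  have hsm0 : Isotopy.multi θ 0 • g = g := by rw [Isotopy.multi_zero, one_smul]
  have hsrc : ∀ t, Isotopy.multi θ t • g ∈ 𝒢.src ⁻¹' {𝒢.src g} := fun t =>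
    Bisection.src_smul _ g
  -- For these times the endpoint stays in the chart at `z` and can meet `Z` only at `z`, so hitting
  -- `Z` amounts to `f t = f 0` (`hiff`).
  have hS : {t | Isotopy.multi θ t • g ∈ U ∧
      (Isotopy.multi θ t).baseMap z ∈ (extChartAt 𝓘(ℝ, E) z).source ∧
      (Isotopy.multi θ t).baseMap z ∉ Z \ {z}} ∈ 𝓝 (0 : Fin (k + 2) → ℝ) := by
    refine Filter.Eventually.and ?_ (Filter.Eventually.and ?_ ?_)
    · have h1 : Tendsto (fun t => Isotopy.multi θ t • g) (𝓝 0)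
          (𝓝[𝒢.src ⁻¹' {𝒢.src g}] g) := by
        refine tendsto_nhdsWithin_iff.2 ⟨?_, Eventually.of_forall hsrc⟩
        have := hsm.tendsto 0
        rwa [hsm0] at this
      exact h1 hU
    · have := hbc.continuous.tendsto 0
      rw [hb0] at this
      exact this (extChartAt_source_mem_nhds z)
    · have := hbc.continuous.tendsto 0
      rw [hb0] at this
      exact this ((hZ.sdiff).isClosed.isOpen_compl.mem_nhds (by simp))
  obtain ⟨N, hN, hNS, hNc, hN0⟩ := exists_isPreconnected_diff_fiber hstr hv hS
  have hiff : ∀ t ∈ N, (f t = f 0 ↔ 𝒢.tgt (Isotopy.multi θ t • g) ∈ Z) := by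
    intro t ht
    rw [Bisection.tgt_smul, ← hz]
    have h1 := hNS ht
    constructor
    · intro h
      have : (Isotopy.multi θ t).baseMap z = z := by
        refine (extChartAt 𝓘(ℝ, E) z).injOn h1.2.1 (mem_extChartAt_source _) ?_
        rw [hf] at h
        simpa only [hb0] using h
      rwa [this]
    · intro h
      have : (Isotopy.multi θ t).baseMap z = z := by
        by_contra hne
        exact h1.2.2 ⟨h, hne⟩
      simp only [hf, this, hb0]
  refine ⟨(fun t => Isotopy.multi θ t • g) '' (N \ f ⁻¹' {f 0}), ?_, ?_, ?_, ?_, ?_⟩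
  · rintro _ ⟨t, ⟨ht, htf⟩, rfl⟩
    exact ⟨(hNS ht).1, fun h => htf ((hiff t ht).2 h)⟩
  · rintro _ ⟨t, -, rfl⟩
    exact hsrc t
  · exact hNc.image _ hsm.continuousOn
  · have := mem_closure_image hsm.continuousAt hN0
    rwa [hsm0] at this
  · refine ⟨_, inter_mem (Isotopy.eventually_exists_multi_fiber hr θ hθ hN)
      self_mem_nhdsWithin, ?_⟩
    rintro h ⟨⟨⟨t, ht, rfl⟩, -⟩, hZt⟩
    exact ⟨t, ⟨ht, fun hft => hZt ((hiff t ht).1 hft)⟩, rfl⟩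

/-- A transitive relation which is realized by all isotopies near all points of a leaf outside a
finite set relates all pairs of points of the leaf outside that set, if the set does not meet
the leaf or the leaf has dimension at least two. -/
theorem rel_of_mem_leaf [T1Space M] (hr : 1 ≤ r) (hT : FiberwiseTransitive Γ) {x : M} {Z : Set M}
    (hZ : Z.Finite) {ρ : M → M → Prop} (hrefl : ∀ a, ρ a a)
    (htrans : ∀ a b c, ρ a b → ρ b c → ρ a c)
    (hρ : ∀ z ∈ 𝒢.leaf x, z ∉ Z → LocallyRealized Γ ρ z)
    (hdim : (∀ z ∈ 𝒢.leaf x, z ∉ Z) ∨ ∀ z ∈ 𝒢.leaf x, HasRankTwo Γ z)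
    {a b : M} (ha : a ∈ 𝒢.leaf x) (hb : b ∈ 𝒢.leaf x) (haZ : a ∉ Z) (hbZ : b ∉ Z) : ρ a b := by
  obtain ⟨g, hg, rfl⟩ := ha
  obtain ⟨g', hg', rfl⟩ := hb
  have hsub : 𝒢.fiberComponent x ⊆ 𝒢.src ⁻¹' {x} := connectedComponentIn_subset _ _
  have hrank : ∀ k ∈ 𝒢.fiberComponent x, 𝒢.tgt k ∈ Z → HasRankTwo Γ (𝒢.tgt k) := fun k hk hkZ =>
    hdim.elim (fun h => absurd hkZ (h _ ⟨k, hk, rfl⟩)) fun h => h _ ⟨k, hk, rfl⟩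
  have hout : ∀ k ∈ 𝒢.fiberComponent x, 𝒢.tgt k ∉ Z → ∃ N ∈ 𝓝[𝒢.src ⁻¹' {x}] k,
      ∀ h ∈ N, ∀ h' ∈ N, ρ (𝒢.tgt h) (𝒢.tgt h') := by
    intro k hk hkZ
    have := (hρ _ ⟨k, hk, rfl⟩ hkZ).exists_nhds hr hT hrefl htrans
    rwa [src_of_mem_fiberComponent hk] at this
  have hin : ∀ k ∈ 𝒢.fiberComponent x, 𝒢.tgt k ∈ Z →
      ∃ K ⊆ 𝒢.fiberComponent x \ 𝒢.tgt ⁻¹' Z, IsPreconnected K ∧ k ∈ closure K ∧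
        ∃ N ∈ 𝓝[𝒢.src ⁻¹' {x}] k, N \ 𝒢.tgt ⁻¹' Z ⊆ K := by
    intro k hk hkZ
    obtain ⟨K, h1, -, h2⟩ := exists_isPreconnected_diff_tgt hr hT (hrank k hk hkZ) hZ hkZ
      (fiberComponent_mem_nhdsWithin hr hT hk)
    rw [src_of_mem_fiberComponent hk] at h2
    exact ⟨K, h1, h2⟩
  -- The argument takes place in the fibre component, with the arrows ending in `Z` removed. Near
  -- such an arrow the remaining ones lie in a preconnected set `K`, along which the relation
  -- propagates; density of the remaining arrows bridges the removed ones.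
  refine (isPreconnected_fiberComponent x).rel_of_locally_rel (D := 𝒢.tgt ⁻¹' Z)
    (ρ := fun h h' => ρ (𝒢.tgt h) (𝒢.tgt h')) (fun a b c => htrans _ _ _) ?_ ?_
    ⟨hg, haZ⟩ ⟨hg', hbZ⟩
  · intro k hk
    by_cases hkZ : 𝒢.tgt k ∈ Z
    · obtain ⟨K, hKX, hKc, -, N, hN, hNK⟩ := hin k hk hkZ
      refine ⟨N, nhdsWithin_mono _ hsub hN, fun h hh h' hh' => ?_⟩
      refine hKc.induction₂' (fun h h' => ρ (𝒢.tgt h) (𝒢.tgt h')) ?_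
        (fun a b c _ _ _ => htrans _ _ _) (hNK hh) (hNK hh')
      intro m hm
      obtain ⟨N', hN', hρ'⟩ := hout m (hKX hm).1 (hKX hm).2
      have hm' : m ∈ N' := mem_of_mem_nhdsWithin (hsub (hKX hm).1) hN'
      filter_upwards [nhdsWithin_mono _ ((hKX.trans sdiff_subset).trans hsub) hN'] with m' h'm'
      exact ⟨hρ' m hm' m' h'm', hρ' m' h'm' m hm'⟩
    · obtain ⟨N, hN, hρ'⟩ := hout k hk hkZ
      exact ⟨N, nhdsWithin_mono _ hsub hN, fun h hh h' hh' => hρ' h hh.1 h' hh'.1⟩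
  · intro k hk
    rw [← mem_closure_iff_nhdsWithin_neBot]
    by_cases hkZ : 𝒢.tgt k ∈ Z
    · obtain ⟨K, hKX, -, hkK, -⟩ := hin k hk hkZ
      exact closure_mono hKX hkK
    · exact subset_closure ⟨hk, hkZ⟩

/-- The group acts transitively on each leaf. -/
theorem exists_baseMap_eq_of_mem_leaf [T1Space M] (hr : 1 ≤ r) (hT : FiberwiseTransitive Γ)
    {x y : M} (hy : y ∈ 𝒢.leaf x) : ∃ s ∈ Γ, s.baseMap x = y := by
  refine rel_of_mem_leaf hr hT (x := x) finite_empty (ρ := fun a b => ∃ s ∈ Γ, s.baseMap a = b)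
    (fun a => ⟨1, one_mem _, by rw [Bisection.baseMap_one, id]⟩) ?_ ?_ (Or.inl fun _ _ => id)
    (mem_leaf_self x) hy id id
  · rintro a b c ⟨s, hs, rfl⟩ ⟨s', hs', rfl⟩
    exact ⟨s' * s, mul_mem hs' hs, by rw [Bisection.baseMap_mul]; rfl⟩
  · exact fun z _ _ σ => Eventually.of_forall fun p => ⟨_, σ.mem p.1, rfl⟩

theorem hasRankTwo_of_mem_leaf [T1Space M] (hr : 1 ≤ r) (hT : FiberwiseTransitive Γ) {x z : M}
    (hx : 2 ≤ 𝒢.leafDim x) (hz : z ∈ 𝒢.leaf x) : HasRankTwo Γ z := by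
  obtain ⟨s, hs, rfl⟩ := exists_baseMap_eq_of_mem_leaf hr hT hz
  exact (hasRankTwo_of_two_le_leafDim hr hT hx).baseMap hr hs

/-- If `x` lies in `Z`, its unit is in the closure of a set of arrows of the component ending
outside `Z`, so that set is nonempty. -/
theorem exists_mem_leaf_notMem [T1Space M] (hr : 1 ≤ r) (hT : FiberwiseTransitive Γ) {x : M}
    (hx : 2 ≤ 𝒢.leafDim x) {Z : Set M} (hZ : Z.Finite) : ∃ w ∈ 𝒢.leaf x, w ∉ Z := by
  by_cases hxZ : x ∈ Z
  · have hu := unit_mem_fiberComponent (𝒢 := 𝒢) x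
    obtain ⟨K, hK, -, -, hcl, -⟩ := exists_isPreconnected_diff_tgt hr hT (g := 𝒢.unit x)
      (by rw [𝒢.tgt_unit]; exact hasRankTwo_of_two_le_leafDim hr hT hx) hZ
      (by rwa [𝒢.tgt_unit]) (fiberComponent_mem_nhdsWithin hr hT hu)
    obtain ⟨k, hk⟩ := closure_nonempty_iff.1 ⟨_, hcl⟩
    exact ⟨_, ⟨k, (hK hk).1, rfl⟩, (hK hk).2⟩
  · exact ⟨x, mem_leaf_self x, hxZ⟩

end Leaf

/-! ### Moving configurations one point at a time -/

section Configuration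

variable {r : WithTop ℕ∞} {E F M G : Type*}
  [NormedAddCommGroup E] [NormedSpace ℝ E] [FiniteDimensional ℝ E]
  [NormedAddCommGroup F] [NormedSpace ℝ F] [FiniteDimensional ℝ F]
  [TopologicalSpace M] [ChartedSpace E M] [TopologicalSpace G] [ChartedSpace F G]
  [IsManifold 𝓘(ℝ, E) r M] [IsManifold 𝓘(ℝ, F) r G]
  {𝒢 : LieGroupoid r E F M G} {Γ : Subgroup 𝒢.Bisection}

variable (Γ) in
/-- A relation between configurations of points in which every isotopy is realized as a motion of a
single point inside `V`. -/
structure IsMotionRel {n : ℕ} (V : Set M) (R : (Fin n → M) → (Fin n → M) → Prop) : Prop where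
  refl : ∀ z, R z z
  trans : ∀ z z' z'', R z z' → R z' z'' → R z z''
  realized : ∀ (z : Fin n → M), Function.Injective z → ∀ i, z i ∈ V →
    LocallyRealized Γ (fun a b => R (Function.update z i a) (Function.update z i b)) (z i)

theorem injective_update {α β : Type*} [DecidableEq α] {z : α → β} (hz : Function.Injective z)
    {i : α} {b : β} (hb : ∀ j, j ≠ i → z j ≠ b) : Function.Injective (Function.update z i b) := by
  intro j k hjk
  by_cases hj : j = i <;> by_cases hk : k = i
  · rw [hj, hk]
  · subst hj
    rw [Function.update_self, Function.update_of_ne hk] at hjk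
    exact absurd hjk.symm (hb k hk)
  · subst hk
    rw [Function.update_self, Function.update_of_ne hj] at hjk
    exact absurd hjk (hb j hj)
  · rw [Function.update_of_ne hj, Function.update_of_ne hk] at hjk
    exact hz hjk

variable {n : ℕ} {V : Set M} {R : (Fin n → M) → (Fin n → M) → Prop}

/-- The remaining points of the configuration are the finite obstacle set of `rel_of_mem_leaf`: the
leaf either avoids them or is large enough to go around them. -/
theorem IsMotionRel.update [T1Space M] (hR : IsMotionRel Γ V R) (hr : 1 ≤ r)
    (hT : FiberwiseTransitive Γ) {x : M} (hxV : 𝒢.leaf x ⊆ V) {z : Fin n → M}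
    (hz : Function.Injective z) {i : Fin n} {b : M} (hzi : z i ∈ 𝒢.leaf x) (hb : b ∈ 𝒢.leaf x)
    (hbz : ∀ j, j ≠ i → z j ≠ b)
    (hdim : 2 ≤ 𝒢.leafDim x ∨ ∀ j, j ≠ i → z j ∉ 𝒢.leaf x) : R z (Function.update z i b) := by
  have key := rel_of_mem_leaf hr hT (x := x) (Z := z '' {j | j ≠ i}) (toFinite _)
    (ρ := fun a b => R (Function.update z i a) (Function.update z i b))
    (fun a => hR.refl _) (fun a b c => hR.trans _ _ _) ?_ ?_ hzi hb ?_ ?_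
  · simpa using key
  · intro w hw hwZ
    have h := hR.realized (Function.update z i w)
      (injective_update hz fun j hj h => hwZ ⟨j, hj, h⟩) i
      (by rw [Function.update_self]; exact hxV hw)
    simpa using h
  · refine hdim.symm.imp ?_ fun h w hw => hasRankTwo_of_mem_leaf hr hT h hw
    rintro h _ hw ⟨j, hj, rfl⟩
    exact h j hj hw
  · rintro ⟨j, hj, h⟩
    exact hj (hz h)
  · rintro ⟨j, hj, h⟩
    exact hbz j hj h

/-- Replacing coordinates of `p` by those of `p'` one by one passes through mixed configurations;
`hpp'` is what keeps these injective. -/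
theorem IsMotionRel.move [T1Space M] (hR : IsMotionRel Γ V R) (hr : 1 ≤ r)
    (hT : FiberwiseTransitive Γ) {x : Fin n → M} (hxV : ∀ i, 𝒢.leaf (x i) ⊆ V)
    (hdim : ∀ i, 2 ≤ 𝒢.leafDim (x i) ∨ ∀ j, j ≠ i → x j ∉ 𝒢.leaf (x i)) {p p' : Fin n → M}
    (hp : Function.Injective p) (hp' : Function.Injective p')
    (hpp' : ∀ i j, i ≠ j → p i ≠ p' j) (hpx : ∀ i, p i ∈ 𝒢.leaf (x i))
    (hpx' : ∀ i, p' i ∈ 𝒢.leaf (x i)) : R p p' := by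
  classical
  have key : ∀ s : Finset (Fin n), R p (s.piecewise p' p) := by
    intro s
    induction s using Finset.induction_on with
    | empty => simpa using hR.refl p
    | insert i s hi ih =>
      refine hR.trans _ _ _ ih ?_
      rw [Finset.piecewise_insert]
      have hleaf : ∀ j, s.piecewise p' p j ∈ 𝒢.leaf (x j) := fun j => by
        by_cases hj : j ∈ s
        · rw [Finset.piecewise_eq_of_mem _ _ _ hj]; exact hpx' j
        · rw [Finset.piecewise_eq_of_notMem _ _ _ hj]; exact hpx j
      refine hR.update hr hT (hxV i) ?_ (hleaf i) (hpx' i) ?_ ?_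
      · intro j k hjk
        by_contra hne
        by_cases hj : j ∈ s <;> by_cases hk : k ∈ s <;> simp only [hj, hk,
          Finset.piecewise_eq_of_mem, Finset.piecewise_eq_of_notMem, not_false_eq_true] at hjk
        · exact hne (hp' hjk)
        · exact hpp' k j (Ne.symm hne) hjk.symm
        · exact hpp' j k hne hjk
        · exact hne (hp hjk)
      · intro j hj
        by_cases hjs : j ∈ s
        · rw [Finset.piecewise_eq_of_mem _ _ _ hjs]; exact fun h => hj (hp' h)
        · rw [Finset.piecewise_eq_of_notMem _ _ _ hjs]; exact hpp' j i hj
      -- Each point stays on the leaf of its own `x j`, so a leaf that misses `x j` also misses the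
      -- current position.
      · exact (hdim i).imp_right fun h j hj => notMem_leaf_of_mem_leaf (h j hj) (hleaf j)
  simpa using key Finset.univ

/-- A point of `x` may be the goal of another point, for instance when `y` permutes `x`, so a direct
one-by-one move could collide. Passing through `w` separates departure from arrival. Coincidences
with the same index are harmless and are allowed. -/
theorem exists_intermediate_configuration [T1Space M] (hr : 1 ≤ r) (hT : FiberwiseTransitive Γ)
    {x y : Fin n → M} (hx : Function.Injective x)
    (hdim : ∀ i, 2 ≤ 𝒢.leafDim (x i) ∨ ∀ j, j ≠ i → x j ∉ 𝒢.leaf (x i))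
    (hxy : ∀ i, y i ∈ 𝒢.leaf (x i)) :
    ∃ w : Fin n → M, Function.Injective w ∧ (∀ i, w i ∈ 𝒢.leaf (x i)) ∧
      ∀ i j, i ≠ j → w i ≠ x j ∧ w i ≠ y j := by
  classical
  have key : ∀ s : Finset (Fin n), ∃ w : Fin n → M, ∀ i ∈ s, w i ∈ 𝒢.leaf (x i) ∧
      ∀ j, i ≠ j → w i ≠ x j ∧ w i ≠ y j ∧ (j ∈ s → w i ≠ w j) := by
    intro s
    induction s using Finset.induction_on with
    | empty => exact ⟨x, by simp⟩
    | insert a s ha ih =>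
      obtain ⟨w, hw⟩ := ih
      obtain ⟨b, hb, hbj⟩ : ∃ b ∈ 𝒢.leaf (x a),
          ∀ j, a ≠ j → b ≠ x j ∧ b ≠ y j ∧ (j ∈ s → b ≠ w j) := by
        rcases hdim a with h | h
        · obtain ⟨b, hb, hbZ⟩ := exists_mem_leaf_notMem hr hT h
            (Z := range x ∪ range y ∪ range w) (toFinite _)
          refine ⟨b, hb, fun j _ => ⟨?_, ?_, fun _ => ?_⟩⟩ <;> rintro rfl <;> simp at hbZ
        -- When the leaf of `x a` contains no other `x j`, keeping `x a` works: `y j` and `w j` lie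
        -- on different leaves.
        · refine ⟨x a, mem_leaf_self _, fun j hj => ⟨fun h' => hj (hx h'), fun h' => ?_,
            fun hjs h' => ?_⟩⟩
          · exact notMem_leaf_of_mem_leaf (h j (Ne.symm hj)) (hxy j) (h' ▸ mem_leaf_self _)
          · exact notMem_leaf_of_mem_leaf (h j (Ne.symm hj)) (hw j hjs).1
              (h' ▸ mem_leaf_self _)
      refine ⟨Function.update w a b, fun i hi => ?_⟩
      by_cases hia : i = a
      · subst hia
        rw [Function.update_self]
        refine ⟨hb, fun j hj => ⟨(hbj j hj).1, (hbj j hj).2.1, fun hjs => ?_⟩⟩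
        rw [Function.update_of_ne (Ne.symm hj)]
        exact (hbj j hj).2.2 ((Finset.mem_insert.1 hjs).resolve_left (Ne.symm hj))
      · have his := (Finset.mem_insert.1 hi).resolve_left hia
        rw [Function.update_of_ne hia]
        refine ⟨(hw i his).1, fun j hj => ⟨((hw i his).2 j hj).1, ((hw i his).2 j hj).2.1,
          fun hjs => ?_⟩⟩
        by_cases hja : j = a
        · subst hja
          rw [Function.update_self]
          exact Ne.symm ((hbj i (Ne.symm hj)).2.2 his)
        · rw [Function.update_of_ne hja]
          exact ((hw i his).2 j hj).2.2 ((Finset.mem_insert.1 hjs).resolve_left hja)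
  obtain ⟨w, hw⟩ := key Finset.univ
  refine ⟨w, fun i j hij => ?_, fun i => (hw i (Finset.mem_univ i)).1, fun i j hij =>
    ⟨((hw i (Finset.mem_univ i)).2 j hij).1, ((hw i (Finset.mem_univ i)).2 j hij).2.1⟩⟩
  by_contra hne
  exact ((hw i (Finset.mem_univ i)).2 j hne).2.2 (Finset.mem_univ j) hij

/-- Multiple transitivity along the leaves. -/
theorem IsMotionRel.rel [T1Space M] (hR : IsMotionRel Γ V R) (hr : 1 ≤ r)
    (hT : FiberwiseTransitive Γ) {x y : Fin n → M} (hx : Function.Injective x)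
    (hdim : ∀ i, 2 ≤ 𝒢.leafDim (x i) ∨ ∀ j, j ≠ i → x j ∉ 𝒢.leaf (x i))
    (hy : Function.Injective y) (hxy : ∀ i, y i ∈ 𝒢.leaf (x i))
    (hxV : ∀ i, 𝒢.leaf (x i) ⊆ V) : R x y := by
  obtain ⟨w, hw, hwx, hwxy⟩ := exists_intermediate_configuration hr hT hx hdim hxy
  exact hR.trans _ w _
    (hR.move hr hT hxV hdim hx hw (fun i j hij h => (hwxy j i (Ne.symm hij)).1 h.symm)
      (fun i => mem_leaf_self _) hwx)
    (hR.move hr hT hxV hdim hw hy (fun i j hij => (hwxy i j hij).2) hwx hxy)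

end Configuration

end LieGroupoid

/-! ### `C^1` closeness and short-time reparametrization -/

section TangentFamily

variable {P E F M N : Type*} [NormedAddCommGroup P] [NormedSpace ℝ P]
  [NormedAddCommGroup E] [NormedSpace ℝ E] [NormedAddCommGroup F] [NormedSpace ℝ F]
  [TopologicalSpace M] [ChartedSpace E M] [IsManifold 𝓘(ℝ, E) 1 M]
  [TopologicalSpace N] [ChartedSpace F N] [IsManifold 𝓘(ℝ, F) 1 N]

/-- The tangent maps of a jointly `C^1` family are jointly continuous. -/
theorem continuous_tangentMap_family {H : P × M → N}
    (hH : ContMDiff (𝓘(ℝ, P).prod 𝓘(ℝ, E)) 𝓘(ℝ, F) 1 H) :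
    Continuous fun p : P × TangentBundle 𝓘(ℝ, E) M =>
      tangentMap 𝓘(ℝ, E) 𝓘(ℝ, F) (fun x => H (p.1, x)) p.2 := by
  -- The tangent map of the member at `t` is the full tangent map of `H` restricted to vectors with
  -- zero component in the parameter direction.
  have h0 : Continuous fun t : P => (⟨t, 0⟩ : TangentBundle 𝓘(ℝ, P) P) :=
    Bundle.Trivialization.continuous_zeroSection ℝ
  have h1 : Continuous fun p : P × TangentBundle 𝓘(ℝ, E) M =>
      (equivTangentBundleProd 𝓘(ℝ, P) P 𝓘(ℝ, E) M).symm (⟨p.1, 0⟩, p.2) :=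
    (contMDiff_equivTangentBundleProd_symm (n := 0)).continuous.comp
      ((h0.comp continuous_fst).prodMk continuous_snd)
  refine ((hH.continuous_tangentMap le_rfl).comp h1).congr ?_
  rintro ⟨t, v⟩
  have hin : MDifferentiableAt 𝓘(ℝ, E) (𝓘(ℝ, P).prod 𝓘(ℝ, E)) (fun y : M => (t, y)) v.proj :=
    mdifferentiableAt_const.prodMk mdifferentiableAt_id
  have hd := tangentMap_comp_at v (hH.mdifferentiable one_ne_zero (t, v.proj)) hin
  rw [tangentMap_prod_right] at hd
  exact hd.symm

end TangentFamily

theorem exists_isOpen_nested {M : Type*} [TopologicalSpace M] [LocallyCompactSpace M] [T2Space M]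
    {z : M} {V : Set M} (hV : IsOpen V) (hz : z ∈ V) :
    ∃ U V' : Set M, IsOpen U ∧ IsOpen V' ∧ IsCompact (closure U) ∧ IsCompact (closure V') ∧
      z ∈ U ∧ closure U ⊆ V' ∧ closure V' ⊆ V := by
  obtain ⟨V', hV', hzV', hV'V, hV'c⟩ := exists_open_between_and_isCompact_closure
    (isCompact_singleton (x := z)) hV (singleton_subset_iff.2 hz)
  obtain ⟨U, hU, hzU, hUV', hUc⟩ := exists_open_between_and_isCompact_closure
    (isCompact_singleton (x := z)) hV' hzV'
  exact ⟨U, V', hU, hV', hUc, hV'c, singleton_subset_iff.1 hzU, hUV', hV'V⟩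

namespace LieGroupoid

section C1

variable {r : WithTop ℕ∞} {E F M G : Type*}
  [NormedAddCommGroup E] [NormedSpace ℝ E] [NormedAddCommGroup F] [NormedSpace ℝ F]
  [TopologicalSpace M] [ChartedSpace E M] [TopologicalSpace G] [ChartedSpace F G]
  {𝒢 : LieGroupoid r E F M G} {Γ : Subgroup 𝒢.Bisection}

theorem Isotopy.eventually_exists_sinReparam (σ : Isotopy Γ) {ε : ℝ} (hε : 0 < ε) :
    ∀ᶠ s in 𝓝 (0 : ℝ), ∃ t, σ s = σ.sinReparam ε t := by
  filter_upwards [Metric.ball_mem_nhds (0 : ℝ) hε] with s hs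
  rw [Metric.mem_ball, Real.dist_eq, sub_zero, abs_lt] at hs
  refine ⟨Real.arcsin (s / ε), ?_⟩
  change σ s = σ (ε * Real.sin (Real.arcsin (s / ε)))
  rw [Real.sin_arcsin (by rw [le_div_iff₀ hε]; linarith) (by rw [div_le_iff₀ hε]; linarith),
    mul_div_cancel₀ _ hε.ne']

variable [IsManifold 𝓘(ℝ, E) 1 M] [IsManifold 𝓘(ℝ, F) 1 G]

theorem Isotopy.tendsto_c1TopologyOn (hr : 1 ≤ r) (σ : Isotopy Γ) :
    Tendsto (fun t => (σ t : M → G)) (𝓝 0) (@nhds (M → G) (c1TopologyOn E F univ) 𝒢.unit) := by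
  rw [TopologicalSpace.tendsto_nhds_generateFrom_iff]
  rintro _ ⟨K, O, hK, -, hO, rfl⟩ hmem
  have hc := continuous_tangentMap_family (P := ℝ) (H := fun p : ℝ × M => σ p.1 p.2)
    (σ.jointlySmooth.of_le hr)
  refine hK.eventually_forall_of_forall_eventually
    (P := fun t v => tangentMap 𝓘(ℝ, E) 𝓘(ℝ, F) (σ t) v ∈ O) fun v hv => ?_
  refine (hc.tendsto (0, v)).eventually (hO.mem_nhds ?_)
  have h0 : (fun x => σ 0 x) = 𝒢.unit := funext σ.apply_zero
  change tangentMap 𝓘(ℝ, E) 𝓘(ℝ, F) (fun x => σ 0 x) v ∈ O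
  rw [h0]
  exact hmem hv

/-- (L) asks for the whole isotopy to lie in `W`, while only its short times are known to. The times
`ε * sin t` stay short, yet still fill an interval around `0`, as `eventually_exists_sinReparam`
records. -/
theorem Isotopy.exists_sinReparam_mem (hr : 1 ≤ r) (σ : Isotopy Γ) {W : Set (M → G)}
    (hW : W ∈ @nhds (M → G) (c1TopologyOn E F univ) 𝒢.unit) :
    ∃ ε > 0, ∀ t, (σ.sinReparam ε t : M → G) ∈ W := by
  obtain ⟨ε, hε, h⟩ := Metric.eventually_nhds_iff.1 (σ.tendsto_c1TopologyOn hr hW)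
  refine ⟨ε / 2, half_pos hε, fun t => h ?_⟩
  rw [Real.dist_eq, sub_zero, abs_mul, abs_of_pos (half_pos hε)]
  nlinarith [Real.abs_sin_le_one t]

end C1

/-! ### The non-analytic case -/

section Supported

variable {r : WithTop ℕ∞} {E F M G : Type*}
  [NormedAddCommGroup E] [NormedSpace ℝ E] [FiniteDimensional ℝ E]
  [NormedAddCommGroup F] [NormedSpace ℝ F]
  [TopologicalSpace M] [T2Space M] [ChartedSpace E M] [TopologicalSpace G] [ChartedSpace F G]
  [IsManifold 𝓘(ℝ, E) 1 M] [IsManifold 𝓘(ℝ, F) 1 G]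
  {𝒢 : LieGroupoid r E F M G} {Γ : Subgroup 𝒢.Bisection}

/-- (L) is applied near `z i` inside `V` with the other points removed: the localized isotopy agrees
with the given one near `z i` and is the unit at the other points. -/
theorem isMotionRel_supported (hr : 1 ≤ r) (hω : r ≠ ω) (hL : LCondition Γ) {V : Set M}
    (hV : IsOpen V) (n : ℕ) :
    IsMotionRel Γ V fun z z' : Fin n → M =>
      ∃ σ ∈ Γ, σ.baseSupport ⊆ V ∧ ∀ i, σ.baseMap (z i) = z' i where
  refl z := ⟨1, one_mem _, by simp [Bisection.baseSupport_one], fun i => by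
    rw [Bisection.baseMap_one, id]⟩
  trans := by
    rintro z z' z'' ⟨σ, hσ, hσV, h⟩ ⟨σ', hσ', hσV', h'⟩
    refine ⟨σ' * σ, mul_mem hσ' hσ,
      (Bisection.baseSupport_mul_subset _ _).trans (union_subset hσV' hσV), fun i => ?_⟩
    rw [Bisection.baseMap_mul, Function.comp_apply, h, h']
  realized := by
    intro z hz i hi σ
    have := ChartedSpace.locallyCompactSpace E M
    have hfin : (z '' {j | j ≠ i}).Finite := toFinite _
    obtain ⟨U, V', hU, hV', hUc, hV'c, hzU, hUV', hV'V⟩ := exists_isOpen_nested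
      (hV.sdiff hfin.isClosed) (z := z i) ⟨hi, by rintro ⟨j, hj, h⟩; exact hj (hz h)⟩
    obtain ⟨W, hW, hWτ⟩ := hL U V' hU hV' hUc hV'c hUV'
    obtain ⟨ε, hε, hεW⟩ := σ.exists_sinReparam_mem hr hW
    obtain ⟨τ, hτ, hτV⟩ := (hWτ _ hεW).1 hω
    filter_upwards [(σ.eventually_exists_sinReparam hε).prod_inl_nhds (z i),
      Eventually.prod_inr_nhds (hU.mem_nhds hzU) (0 : ℝ)] with p hp hpU
    obtain ⟨t, ht⟩ := hp
    refine ⟨τ t, τ.mem t, ?_, fun j => ?_⟩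
    · exact (Bisection.baseSupport_subset_support _).trans
        ((hτV t).trans (subset_closure.trans (hV'V.trans sdiff_subset)))
    · by_cases hj : j = i
      · subst hj
        rw [Function.update_self, Function.update_self, Bisection.baseMap, hτ t _ hpU, ht]
        rfl
      · rw [Function.update_of_ne hj, Function.update_of_ne hj]
        refine Bisection.baseMap_eq_of_apply_eq_unit ?_
        by_contra hne
        exact (hV'V (subset_closure (hτV t (subset_closure hne)))).2 ⟨j, hj, rfl⟩

end Supported

end LieGroupoid

/-! ### Flow boxes and their invariance under isotopies -/

/-- A linear map which sends a family of `finrank D` vectors of `D` to the standard basis of the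
first factor sends all of `D` to the first factor. -/
theorem snd_eq_zero_of_map_eq_single {X C : Type*} [AddCommGroup X] [Module ℝ X]
    [FiniteDimensional ℝ X] [AddCommGroup C] [Module ℝ C] {D : Submodule ℝ X} {d : ℕ}
    (hd : Module.finrank ℝ D = d) (T : X →ₗ[ℝ] (Fin d → ℝ) × C) {v : Fin d → X}
    (hv : ∀ j, v j ∈ D) (hT : ∀ j, T (v j) = (Pi.single j 1, 0)) {v₀ : X} (hv₀ : v₀ ∈ D) :
    (T v₀).2 = 0 := by
  let T₁ : D →ₗ[ℝ] (Fin d → ℝ) := (LinearMap.fst ℝ _ _).comp (T.comp D.subtype)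
  have hsum : ∀ a : Fin d → ℝ, T (∑ j, a j • v j) = (a, 0) := by
    intro a
    rw [map_sum]
    simp_rw [map_smul, hT]
    ext1
    · rw [Prod.fst_sum]
      funext i
      simp [Pi.single_apply]
    · rw [Prod.snd_sum]; simp
  have hsurj : Function.Surjective T₁ := fun a =>
    ⟨⟨∑ j, a j • v j, D.sum_mem fun j _ => D.smul_mem _ (hv j)⟩, by
      change (T (∑ j, a j • v j)).1 = a
      rw [hsum]⟩
  -- Surjectivity onto a space of the same dimension gives injectivity, so `v₀` is the combination
  -- of the `v j` with the same first component.
  have hinj : Function.Injective T₁ :=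
    (LinearMap.injective_iff_surjective_of_finrank_eq_finrank
      (by rw [hd, Module.finrank_fin_fun])).2 hsurj
  have h0 : (⟨v₀, hv₀⟩ : D) = ⟨∑ j, (T v₀).1 j • v j,
      D.sum_mem fun j _ => D.smul_mem _ (hv j)⟩ := by
    refine hinj ?_
    change (T v₀).1 = (T (∑ j, (T v₀).1 j • v j)).1
    rw [hsum]
  have h1 : v₀ = ∑ j, (T v₀).1 j • v j := congrArg Subtype.val h0
  rw [h1, hsum]

namespace LieGroupoid

section FlowBox

variable {r : WithTop ℕ∞} {E F M G : Type*}
  [NormedAddCommGroup E] [NormedSpace ℝ E]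
  [NormedAddCommGroup F] [NormedSpace ℝ F]
  [TopologicalSpace M] [ChartedSpace E M]
  [TopologicalSpace G] [ChartedSpace F G]
  {𝒢 : LieGroupoid r E F M G} {Γ : Subgroup 𝒢.Bisection} {ι : Type*}

/-- The configuration of the units at `q`, in charts. -/
noncomputable def unitCoords (𝒢 : LieGroupoid r E F M G) (q : ι → M) : ι → F :=
  fun i => extChartAt 𝓘(ℝ, F) (𝒢.unit (q i)) (𝒢.unit (q i))

/-- The arrow with given coordinates in the chart at the unit of `q i`. -/
noncomputable def ofCoords (𝒢 : LieGroupoid r E F M G) (q : ι → M) (u : ι → F) (i : ι) : G :=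
  (extChartAt 𝓘(ℝ, F) (𝒢.unit (q i))).symm (u i)

/-- The coordinates of a family of arrows in the charts at the units of `q`. -/
noncomputable def coords (𝒢 : LieGroupoid r E F M G) (q : ι → M) (k : ι → G) : ι → F :=
  fun i => extChartAt 𝓘(ℝ, F) (𝒢.unit (q i)) (k i)

theorem ofCoords_unitCoords (q : ι → M) (i : ι) :
    𝒢.ofCoords q (𝒢.unitCoords q) i = 𝒢.unit (q i) :=
  extChartAt_to_inv _

theorem ofCoords_coords {q : ι → M} {k : ι → G} {i : ι}
    (hk : k i ∈ (extChartAt 𝓘(ℝ, F) (𝒢.unit (q i))).source) :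
    𝒢.ofCoords q (𝒢.coords q k) i = k i :=
  (extChartAt 𝓘(ℝ, F) (𝒢.unit (q i))).left_inv hk

theorem Isotopy.hasDerivAt_coords [Fintype ι] (hr : 1 ≤ r) (q : ι → M) (σ : Isotopy Γ) :
    HasDerivAt (fun t => 𝒢.coords q fun i => σ t (q i)) (fun i => σ.vel (q i)) 0 :=
  hasDerivAt_pi.2 fun i => σ.hasDerivAt_vel hr (q i)

variable [Fintype ι] [IsManifold 𝓘(ℝ, F) r G]

theorem JointlySmooth.contDiffAt_smul_chart {P : Type*} [NormedAddCommGroup P] [NormedSpace ℝ P]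
    {a : P → 𝒢.Bisection} (ha : JointlySmooth a) (g : ι → G) {p : P} {u : ι → F}
    (hu : ∀ i, u i ∈ (extChartAt 𝓘(ℝ, F) (g i)).target)
    (hg : ∀ i, a p • (extChartAt 𝓘(ℝ, F) (g i)).symm (u i) ∈
      (extChartAt 𝓘(ℝ, F) (g i)).source) :
    ContDiffAt ℝ r (fun z : P × (ι → F) => fun i => extChartAt 𝓘(ℝ, F) (g i)
      (a z.1 • (extChartAt 𝓘(ℝ, F) (g i)).symm (z.2 i))) (p, u) := by
  rw [contDiffAt_pi]
  intro i
  rw [← contMDiffAt_iff_contDiffAt]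
  have h1 : ContMDiffAt 𝓘(ℝ, P × (ι → F)) 𝓘(ℝ, F) r
      (fun z : P × (ι → F) => (extChartAt 𝓘(ℝ, F) (g i)).symm (z.2 i)) (p, u) := by
    have hs : ContMDiffAt 𝓘(ℝ, F) 𝓘(ℝ, F) r (extChartAt 𝓘(ℝ, F) (g i)).symm (u i) :=
      (contMDiffOn_extChartAt_symm (g i)).contMDiffAt
        ((isOpen_extChartAt_target (g i)).mem_nhds (hu i))
    have hl : ContMDiffAt 𝓘(ℝ, P × (ι → F)) 𝓘(ℝ, F) r
        (fun z : P × (ι → F) => z.2 i) (p, u) :=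
      (((contDiff_apply ℝ F i).comp contDiff_snd).contMDiff).contMDiffAt
    exact ContMDiffAt.comp (g := (extChartAt 𝓘(ℝ, F) (g i)).symm) (p, u) hs hl
  have h2 : ContMDiffAt 𝓘(ℝ, P × (ι → F)) (𝓘(ℝ, P).prod 𝓘(ℝ, F)) r
      (fun z : P × (ι → F) => (z.1, (extChartAt 𝓘(ℝ, F) (g i)).symm (z.2 i))) (p, u) :=
    (contDiff_fst.contMDiff.contMDiffAt).prodMk h1
  have h3 := ContMDiffAt.comp (g := fun z : P × G => a z.1 • z.2) (p, u) ha.smul.contMDiffAt h2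
  exact ContMDiffAt.comp (g := extChartAt 𝓘(ℝ, F) (g i)) (p, u)
    (contMDiffAt_extChartAt' (by simpa using hg i)) h3

/-- Coordinates near the units of `q` adapted to the motions generated by the isotopies `τ`: the
second component is constant along these motions. -/
theorem exists_flowBox [FiniteDimensional ℝ F] (hr : 1 ≤ r) (q : ι → M) {d : ℕ}
    (τ : Fin d → Isotopy Γ) (hτ : LinearIndependent ℝ fun j => fun i => (τ j).vel (q i))
    {C : Submodule ℝ (ι → F)}
    (hC : IsCompl (Submodule.span ℝ (range fun j => fun i => (τ j).vel (q i))) C) :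
    ∃ β : (ι → F) → (Fin d → ℝ) × C, β (𝒢.unitCoords q) = 0 ∧
      (∃ β' : (ι → F) →L[ℝ] (Fin d → ℝ) × C, HasFDerivAt β β' (𝒢.unitCoords q) ∧
        ∀ v, (β' v).2 = 0 → v ∈ Submodule.span ℝ (range fun j => fun i => (τ j).vel (q i))) ∧
      ∀ᶠ y in 𝓝 (𝒢.unitCoords q), ContDiffAt ℝ 1 β y ∧
        (∀ i, 𝒢.ofCoords q y i = Isotopy.multi τ (β y).1 •
          𝒢.ofCoords q (𝒢.unitCoords q + (β y).2) i) ∧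
        ∀ᶠ z in 𝓝 (β y), β (𝒢.coords q fun i => Isotopy.multi τ z.1 •
          𝒢.ofCoords q (𝒢.unitCoords q + z.2) i) = z := by
  set c := 𝒢.unitCoords q with hc
  set D := Submodule.span ℝ (range fun j => fun i => (τ j).vel (q i)) with hD
  have hr0 : r ≠ 0 := (zero_lt_one.trans_le hr).ne'
  -- Arrows with coordinates in the transversal `c + C` are moved by the product family. At `0` the
  -- derivative sends `(t, w)` to `∑ t j • vel j + w`, an isomorphism because `C` complements the
  -- span of the velocities; `β` is the local inverse.
  set Φ : (Fin d → ℝ) × C → (ι → F) := fun z =>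
    𝒢.coords q fun i => Isotopy.multi τ z.1 • 𝒢.ofCoords q (c + z.2) i with hΦ
  have hm0 : ∀ g : G, Isotopy.multi τ 0 • g = g := fun g => by
    rw [Isotopy.multi_zero, one_smul]
  have hΦd : ContDiffAt ℝ r Φ 0 := by
    have h1 := (Isotopy.multi_jointlySmooth τ).contDiffAt_smul_chart
      (fun i => 𝒢.unit (q i)) (p := 0) (u := c) (fun i => mem_extChartAt_target _) (fun i => by
        rw [hm0, show (extChartAt 𝓘(ℝ, F) (𝒢.unit (q i))).symm (c i) = 𝒢.unit (q i) from
          ofCoords_unitCoords q i]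
        exact mem_extChartAt_source _)
    have h2 : ContDiff ℝ r fun z : (Fin d → ℝ) × C => (z.1, c + (z.2 : ι → F)) :=
      contDiff_fst.prodMk (contDiff_const.add (C.subtypeL.contDiff.comp contDiff_snd))
    exact ContDiffAt.comp (f := fun z : (Fin d → ℝ) × C => (z.1, c + (z.2 : ι → F)))
      (0 : (Fin d → ℝ) × C) (by simpa using h1) h2.contDiffAt
  have hΦ' := hΦd.hasStrictFDerivAt hr0
  set f' := fderiv ℝ Φ 0 with hf'
  have hΦ0 : Φ 0 = c := by
    funext i
    change extChartAt 𝓘(ℝ, F) (𝒢.unit (q i)) (Isotopy.multi τ 0 • 𝒢.ofCoords q (c + 0) i) = c i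
    rw [hm0, add_zero, ofCoords_unitCoords]
    rfl
  have hsingle : ∀ j, f' (Pi.single j 1, 0) = fun i => (τ j).vel (q i) := by
    intro j
    have hl : HasDerivAt (fun s : ℝ => ((Pi.single j s : Fin d → ℝ), (0 : C)))
        (Pi.single j 1, 0) 0 :=
      (hasDerivAt_single j (0 : ℝ)).prodMk (hasDerivAt_const _ _)
    have h1 : HasDerivAt (Φ ∘ fun s : ℝ => ((Pi.single j s : Fin d → ℝ), (0 : C)))
        (f' (Pi.single j 1, 0)) 0 := by
      refine HasFDerivAt.comp_hasDerivAt (0 : ℝ) ?_ hl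
      rw [Pi.single_zero]
      exact hΦ'.hasFDerivAt
    refine h1.unique ?_
    refine ((τ j).hasDerivAt_coords hr q).congr_of_eventuallyEq (Eventually.of_forall fun s => ?_)
    change 𝒢.coords q (fun i => Isotopy.multi τ (Pi.single j s) • 𝒢.ofCoords q (c + 0) i) = _
    simp only [Isotopy.multi_single, add_zero, hc, ofCoords_unitCoords, Bisection.smul_unit]
  have hvert : ∀ w : C, f' (0, w) = w := by
    intro w
    have hl : HasFDerivAt (fun w : C => ((0 : Fin d → ℝ), w))
        (ContinuousLinearMap.inr ℝ (Fin d → ℝ) C) 0 := hasFDerivAt_prodMk_right _ _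
    have h1 : HasFDerivAt (Φ ∘ fun w : C => ((0 : Fin d → ℝ), w))
        (f'.comp (ContinuousLinearMap.inr ℝ (Fin d → ℝ) C)) 0 :=
      hΦ'.hasFDerivAt.comp (0 : C) hl
    have h2 : HasFDerivAt (Φ ∘ fun w : C => ((0 : Fin d → ℝ), w)) C.subtypeL 0 := by
      have h3 : HasFDerivAt (fun w : C => c + (w : ι → F)) C.subtypeL 0 :=
        (C.subtypeL.hasFDerivAt).const_add c
      refine h3.congr_of_eventuallyEq ?_
      have h4 : ∀ᶠ w : C in 𝓝 0, ∀ i, (c + (w : ι → F)) i ∈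
          (extChartAt 𝓘(ℝ, F) (𝒢.unit (q i))).target := by
        rw [Filter.eventually_all]
        intro i
        have h5 : Continuous fun w : C => (c + (w : ι → F)) i :=
          (continuous_apply i).comp (continuous_const.add continuous_subtype_val)
        refine (h5.tendsto 0) ?_
        simpa [hc, unitCoords] using extChartAt_target_mem_nhds (I := 𝓘(ℝ, F)) (𝒢.unit (q i))
      filter_upwards [h4] with w hw
      funext i
      change extChartAt 𝓘(ℝ, F) (𝒢.unit (q i)) (Isotopy.multi τ 0 • 𝒢.ofCoords q (c + w) i) = _
      rw [hm0]
      exact (extChartAt 𝓘(ℝ, F) (𝒢.unit (q i))).right_inv (hw i)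
    have := congrArg (fun L : C →L[ℝ] (ι → F) => L w) (h1.unique h2)
    simpa using this
  have hform : ∀ z : (Fin d → ℝ) × C,
      f' z = (∑ j, z.1 j • fun i => (τ j).vel (q i)) + (z.2 : ι → F) := by
    intro z
    have hz : z = ∑ j, z.1 j • ((Pi.single j 1 : Fin d → ℝ), (0 : C)) + (0, z.2) := by
      ext1
      · rw [Prod.fst_add, Prod.fst_sum]
        funext i
        simp [Pi.single_apply]
      · rw [Prod.snd_add, Prod.snd_sum]; simp
    conv_lhs => rw [hz]
    rw [map_add, map_sum, hvert]
    simp_rw [map_smul, hsingle]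
  have hsumD : ∀ a : Fin d → ℝ, (∑ j, a j • fun i => (τ j).vel (q i)) ∈ D := fun a =>
    D.sum_mem fun j _ => D.smul_mem _ (Submodule.subset_span ⟨j, rfl⟩)
  have hker : f'.ker = ⊥ := by
    rw [LinearMap.ker_eq_bot']
    intro z hz
    have h1 : (∑ j, z.1 j • fun i => (τ j).vel (q i)) + (z.2 : ι → F) = 0 := by
      rw [← hform]; exact hz
    have h2 : (z.2 : ι → F) ∈ D := by
      rw [eq_neg_of_add_eq_zero_right h1]; exact D.neg_mem (hsumD _)
    have h3 : (z.2 : ι → F) = 0 := (Submodule.disjoint_def.1 hC.disjoint) _ h2 z.2.2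
    rw [h3, add_zero] at h1
    ext1
    · funext j
      exact Fintype.linearIndependent_iff.1 hτ _ h1 j
    · exact Subtype.ext h3
  have hrange : f'.range = ⊤ := by
    rw [eq_top_iff]
    intro v _
    obtain ⟨a, ha, b, hb, rfl⟩ := Submodule.mem_sup.1 (hC.sup_eq_top ▸ Submodule.mem_top (x := v))
    obtain ⟨t, rfl⟩ := (Submodule.mem_span_range_iff_exists_fun ℝ).1 ha
    exact ⟨(t, ⟨b, hb⟩), hform _⟩
  let Ψ' : ((Fin d → ℝ) × C) ≃L[ℝ] (ι → F) := ContinuousLinearEquiv.ofBijective f' hker hrange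
  have hΨ' : (Ψ' : ((Fin d → ℝ) × C) →L[ℝ] (ι → F)) = f' :=
    ContinuousLinearEquiv.coe_ofBijective _ _ _
  have hfd : HasFDerivAt Φ (Ψ' : ((Fin d → ℝ) × C) →L[ℝ] (ι → F)) 0 := by
    rw [hΨ']; exact hΦ'.hasFDerivAt
  have hstr : HasStrictFDerivAt Φ (Ψ' : ((Fin d → ℝ) × C) →L[ℝ] (ι → F)) 0 := by
    rw [hΨ']; exact hΦ'
  set β := hΦd.localInverse hfd hr0 with hβ
  have hβ0 : β c = 0 := by
    have := hΦd.localInverse_apply_image hfd hr0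
    rwa [hΦ0] at this
  have hβd : ContDiffAt ℝ r β c := by
    have := hΦd.to_localInverse hfd hr0
    rwa [hΦ0] at this
  have hβ' : HasFDerivAt β (Ψ'.symm : (ι → F) →L[ℝ] ((Fin d → ℝ) × C)) c := by
    have := hstr.to_localInverse.hasFDerivAt
    rwa [hΦ0] at this
  have hright : ∀ᶠ y in 𝓝 c, Φ (β y) = y := by
    have := hstr.eventually_right_inverse
    rwa [hΦ0] at this
  have hleft : ∀ᶠ z in 𝓝 (0 : (Fin d → ℝ) × C), β (Φ z) = z := hstr.eventually_left_inverse
  have hsource : ∀ᶠ z : (Fin d → ℝ) × C in 𝓝 0, ∀ i,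
      Isotopy.multi τ z.1 • 𝒢.ofCoords q (c + z.2) i ∈
        (extChartAt 𝓘(ℝ, F) (𝒢.unit (q i))).source := by
    rw [Filter.eventually_all]
    intro i
    have h1 : ContinuousAt (fun z : (Fin d → ℝ) × C => (z.1, 𝒢.ofCoords q (c + z.2) i)) 0 := by
      refine continuousAt_fst.prodMk ?_
      refine ContinuousAt.comp (g := (extChartAt 𝓘(ℝ, F) (𝒢.unit (q i))).symm)
        (f := fun z : (Fin d → ℝ) × C => (c + (z.2 : ι → F)) i) ?_ ?_
      · simpa [hc, unitCoords] using
          continuousAt_extChartAt_symm (I := 𝓘(ℝ, F)) (𝒢.unit (q i))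
      · exact ((continuous_apply i).comp (continuous_const.add
          (continuous_subtype_val.comp continuous_snd))).continuousAt
    have h2 := ContinuousAt.comp (g := fun z : (Fin d → ℝ) × G => Isotopy.multi τ z.1 • z.2)
      (Isotopy.multi_jointlySmooth τ).smul.continuous.continuousAt h1
    refine h2.eventually (p := fun g => g ∈ (extChartAt 𝓘(ℝ, F) (𝒢.unit (q i))).source) ?_
    change ∀ᶠ g in 𝓝 (Isotopy.multi τ 0 • 𝒢.ofCoords q (c + 0) i), _
    rw [hm0, add_zero, ofCoords_unitCoords]
    exact extChartAt_source_mem_nhds _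
  refine ⟨β, hβ0, ⟨_, hβ', fun v hv => ?_⟩, ?_⟩
  · have h1 : f' (Ψ'.symm v) = v := by
      rw [← hΨ']; exact Ψ'.apply_symm_apply v
    have hv' : (Ψ'.symm v).2 = 0 := hv
    rw [hform, hv', Submodule.coe_zero, add_zero] at h1
    rw [← h1]
    exact hsumD _
  · have hβc : Tendsto β (𝓝 c) (𝓝 0) := by
      have := hβd.continuousAt.tendsto
      rwa [hβ0] at this
    filter_upwards [(hβd.of_le hr).eventually (by simp), hright, hβc.eventually hsource,
      hβc.eventually hleft.eventually_nhds] with y h1 h2 h3 h4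
    refine ⟨h1, fun i => ?_, h4⟩
    have h5 : (extChartAt 𝓘(ℝ, F) (𝒢.unit (q i)))
        (Isotopy.multi τ (β y).1 • 𝒢.ofCoords q (c + (β y).2) i) = y i := congrFun h2 i
    rw [← (extChartAt 𝓘(ℝ, F) (𝒢.unit (q i))).left_inv (h3 i), h5]
    rfl

end FlowBox

section Invariance

variable {r : WithTop ℕ∞} {E F M G : Type*}
  [NormedAddCommGroup E] [NormedSpace ℝ E]
  [NormedAddCommGroup F] [NormedSpace ℝ F]
  [TopologicalSpace M] [ChartedSpace E M]
  [TopologicalSpace G] [ChartedSpace F G]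
  {𝒢 : LieGroupoid r E F M G} {Γ : Subgroup 𝒢.Bisection} {ι : Type*}

theorem Isotopy.eventually_mem_chart_source [Finite ι] (η : Isotopy Γ) (q : ι → M) :
    ∀ᶠ t in 𝓝 0, ∀ i, η t (q i) ∈ (extChartAt 𝓘(ℝ, F) (𝒢.unit (q i))).source := by
  rw [Filter.eventually_all]
  intro i
  have h := (η.jointlySmooth.apply (q i)).continuous.tendsto 0
  rw [η.apply_zero] at h
  exact h (extChartAt_source_mem_nhds _)

theorem Isotopy.differentiableAt_coords [IsManifold 𝓘(ℝ, F) r G] (hr : 1 ≤ r) (σ : Isotopy Γ)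
    (q : ι → M) {s : ℝ}
    (hs : ∀ i, σ s (q i) ∈ (extChartAt 𝓘(ℝ, F) (𝒢.unit (q i))).source) :
    DifferentiableAt ℝ (fun t => 𝒢.coords q fun i => σ t (q i)) s := by
  refine differentiableAt_pi.2 fun i => ?_
  have h : ContMDiffAt 𝓘(ℝ, ℝ) 𝓘(ℝ, F) r
      (fun t => extChartAt 𝓘(ℝ, F) (𝒢.unit (q i)) (σ t (q i))) s :=
    ContMDiffAt.comp (g := extChartAt 𝓘(ℝ, F) (𝒢.unit (q i))) s
      (contMDiffAt_extChartAt' (by simpa using hs i)) (σ.jointlySmooth.apply (q i)).contMDiffAt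
  exact (contMDiffAt_iff_contDiffAt.1 h).differentiableAt (zero_lt_one.trans_le hr).ne'

/-- Multiplied by `s` on the left, `η t` first undoes the flow of `τ` up to the times `a` and then
redoes it with the `j`-th time increased by `t`. It thus moves an arrow with flow times `a` in the
`j`-th coordinate direction of the flow box. -/
theorem Isotopy.exists_coordinate {d : ℕ} (τ : Fin d → Isotopy Γ) {s : 𝒢.Bisection} (hs : s ∈ Γ)
    (a : Fin d → ℝ) (j : Fin d) : ∃ η : Isotopy Γ, ∀ t, η t =
      s⁻¹ * Isotopy.multi τ (a + Pi.single j t) * ((Isotopy.multi τ a)⁻¹ * s) := by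
  have hf : ContDiff ℝ r fun t : ℝ => a + (Pi.single j t : Fin d → ℝ) :=
    contDiff_const.add (contDiff_single _ _ j)
  have h1 := ((JointlySmooth.const s⁻¹).mul ((Isotopy.multi_jointlySmooth τ).comp hf)).mul
    (JointlySmooth.const ((Isotopy.multi τ a)⁻¹ * s))
  refine ⟨Isotopy.ofJointlySmooth _ h1 (fun t => ?_) ?_, fun t => rfl⟩
  · exact mul_mem (mul_mem (inv_mem hs) (Isotopy.multi_mem _ _))
      (mul_mem (inv_mem (Isotopy.multi_mem _ _)) hs)
  · rw [Pi.single_zero, add_zero]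
    group

/-- If the velocities of `τ` span all velocities of isotopies at the configuration `q`, then the
isotopies move the units of `q` along the slices of a flow box of `τ`. -/
theorem hasDerivAt_snd_flowBox [Fintype ι] [FiniteDimensional ℝ F] [IsManifold 𝓘(ℝ, F) r G]
    (hr : 1 ≤ r) (q : ι → M) {d : ℕ} (τ : Fin d → Isotopy Γ)
    (hτ : LinearIndependent ℝ fun j => fun i => (τ j).vel (q i))
    (hall : ∀ η : Isotopy Γ, (fun i => η.vel (q i)) ∈
      Submodule.span ℝ (range fun j => fun i => (τ j).vel (q i)))
    {C : Submodule ℝ (ι → F)} {β : (ι → F) → (Fin d → ℝ) × C} (σ : Isotopy Γ) {s : ℝ}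
    (hs : ∀ i, σ s (q i) ∈ (extChartAt 𝓘(ℝ, F) (𝒢.unit (q i))).source)
    (hβ : ContDiffAt ℝ 1 β (𝒢.coords q fun i => σ s (q i)))
    (hβτ : ∀ i, 𝒢.ofCoords q (𝒢.coords q fun i => σ s (q i)) i =
      Isotopy.multi τ (β (𝒢.coords q fun i => σ s (q i))).1 •
        𝒢.ofCoords q (𝒢.unitCoords q + (β (𝒢.coords q fun i => σ s (q i))).2) i)
    (hβz : ∀ᶠ z in 𝓝 (β (𝒢.coords q fun i => σ s (q i))),
      β (𝒢.coords q fun i => Isotopy.multi τ z.1 •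
        𝒢.ofCoords q (𝒢.unitCoords q + z.2) i) = z) :
    HasDerivAt (fun t => (β (𝒢.coords q fun i => σ t (q i))).2) 0 s := by
  set y := 𝒢.coords q fun i => σ s (q i) with hy
  set c := 𝒢.unitCoords q with hc
  have hr0 : r ≠ 0 := (zero_lt_one.trans_le hr).ne'
  have hβd : HasFDerivAt β (fderiv ℝ β y) y := (hβ.differentiableAt one_ne_zero).hasFDerivAt
  have hcurve : HasDerivAt (β ∘ fun t => 𝒢.coords q fun i => σ t (q i)) _ s :=
    hβd.comp_hasDerivAt s (σ.differentiableAt_coords hr q hs).hasDerivAt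
  set h' := fderiv ℝ β y (deriv (fun t => 𝒢.coords q fun i => σ t (q i)) s)
  suffices hzero : h'.2 = 0 by
    have := (hasFDerivAt_snd (𝕜 := ℝ) (p := β y)).comp_hasDerivAt s hcurve
    rw [ContinuousLinearMap.coe_snd', hzero] at this
    exact this
  -- `H` reads the action of `σ s` in the flow box, so its derivative carries velocities at the
  -- units to velocities at the moved configuration. All velocities at the units lie in a
  -- `d`-dimensional space, and those of the `η j` already go to the basis of the first factor. The
  -- whole space is therefore sent into the first factor, including the velocity of `η₀`, whose
  -- image is that of `σ` at time `s`.
  set H : (ι → F) → (Fin d → ℝ) × C := fun u =>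
    β (𝒢.coords q fun i => σ s • 𝒢.ofCoords q u i) with hH
  have hσu : ∀ i, σ s • 𝒢.ofCoords q c i = σ s (q i) := fun i => by
    rw [hc, ofCoords_unitCoords, Bisection.smul_unit]
  have hHd : DifferentiableAt ℝ H c := by
    have h1 : DifferentiableAt ℝ (fun u => 𝒢.coords q fun i => σ s • 𝒢.ofCoords q u i) c := by
      have h2 := (JointlySmooth.const (P := ℝ) (σ s)).contDiffAt_smul_chart
        (fun i => 𝒢.unit (q i)) (p := 0) (u := c) (fun i => mem_extChartAt_target _)
        (fun i => by
          rw [show (extChartAt 𝓘(ℝ, F) (𝒢.unit (q i))).symm (c i) = 𝒢.unit (q i) from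
            ofCoords_unitCoords q i, Bisection.smul_unit]
          exact hs i)
      have h3 := ContDiffAt.comp (f := fun u : ι → F => ((0 : ℝ), u)) c h2
        (contDiff_const.prodMk contDiff_id).contDiffAt
      exact h3.differentiableAt hr0
    refine DifferentiableAt.comp (g := β) c ?_ h1
    simp only [hσu]
    exact hβ.differentiableAt one_ne_zero
  have hHη : ∀ η : Isotopy Γ, HasDerivAt (fun t => β (𝒢.coords q fun i => σ s • η t (q i)))
      (fderiv ℝ H c fun i => η.vel (q i)) 0 := by
    intro η
    have h1 : HasDerivAt (H ∘ fun t => 𝒢.coords q fun i => η t (q i))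
        (fderiv ℝ H c fun i => η.vel (q i)) 0 := by
      refine HasFDerivAt.comp_hasDerivAt (0 : ℝ) ?_ (η.hasDerivAt_coords hr q)
      have h2 : (𝒢.coords q fun i => η 0 (q i)) = c := by
        funext i
        simp only [coords, η.apply_zero]
        rfl
      rw [h2]
      exact hHd.hasFDerivAt
    refine h1.congr_of_eventuallyEq ?_
    filter_upwards [η.eventually_mem_chart_source q] with t ht
    simp only [hH, Function.comp_apply]
    congr 2
    funext i
    rw [ofCoords_coords (ht i)]
  -- the isotopies which correspond to the coordinate directions of the flow box
  choose η hηt using fun j => Isotopy.exists_coordinate τ (σ.mem s) (β y).1 j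
  have hη : ∀ j, fderiv ℝ H c (fun i => (η j).vel (q i)) = (Pi.single j 1, 0) := by
    intro j
    have h1 : HasDerivAt (fun t : ℝ => ((β y).1 + Pi.single j t, (β y).2))
        (Pi.single j 1, 0) 0 :=
      ((hasDerivAt_single j (0 : ℝ)).const_add _).prodMk (hasDerivAt_const _ _)
    refine (hHη (η j)).unique (h1.congr_of_eventuallyEq ?_)
    have h2 : Tendsto (fun t : ℝ => ((β y).1 + Pi.single j t, (β y).2)) (𝓝 0) (𝓝 (β y)) := by
      have := h1.continuousAt.tendsto
      simpa using this
    filter_upwards [h2.eventually hβz] with t ht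
    rw [← ht]
    congr 2
    funext i
    rw [hηt, ← Bisection.smul_unit, ← mul_smul]
    have h3 : σ s • 𝒢.unit (q i) = Isotopy.multi τ (β y).1 • 𝒢.ofCoords q (c + (β y).2) i := by
      rw [← hβτ, ofCoords_coords (hs i), Bisection.smul_unit]
    rw [show σ s * ((σ s)⁻¹ * Isotopy.multi τ ((β y).1 + Pi.single j t) *
      ((Isotopy.multi τ (β y).1)⁻¹ * σ s)) = Isotopy.multi τ ((β y).1 + Pi.single j t) *
      ((Isotopy.multi τ (β y).1)⁻¹ * σ s) by group, mul_smul, mul_smul, h3, inv_smul_smul]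
  let η₀ : Isotopy Γ := Isotopy.ofJointlySmooth (fun t => (σ s)⁻¹ * σ (s + t))
    ((JointlySmooth.const _).mul (σ.jointlySmooth.comp (contDiff_const.add contDiff_id)))
    (fun t => mul_mem (inv_mem (σ.mem s)) (σ.mem _)) (by rw [add_zero, inv_mul_cancel])
  have hη₀ : fderiv ℝ H c (fun i => η₀.vel (q i)) = h' := by
    have h1 : HasDerivAt (fun t => β (𝒢.coords q fun i => σ (s + t) (q i))) h' 0 := by
      have h2 : HasDerivAt (β ∘ fun t => 𝒢.coords q fun i => σ t (q i)) h' (s + 0) := by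
        rwa [add_zero]
      exact h2.comp_const_add s 0
    refine (hHη η₀).unique (h1.congr_of_eventuallyEq (Eventually.of_forall fun t => ?_))
    change β (𝒢.coords q fun i => σ s • (((σ s)⁻¹ * σ (s + t)) (q i))) = _
    congr 2
    funext i
    rw [← Bisection.smul_unit, ← mul_smul, mul_inv_cancel_left, Bisection.smul_unit]
  rw [← hη₀]
  exact snd_eq_zero_of_map_eq_single (D := Submodule.span ℝ (range fun j => fun i =>
    (τ j).vel (q i))) ((finrank_span_eq_card hτ).trans (Fintype.card_fin d))
    (fderiv ℝ H c).toLinearMap (fun j => hall (η j)) hη (hall η₀)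

end Invariance

/-! ### The analytic case: velocities at several points -/

section C1Family

variable {E F M N : Type*}
  [NormedAddCommGroup E] [NormedSpace ℝ E] [NormedAddCommGroup F] [NormedSpace ℝ F]
  [TopologicalSpace M] [ChartedSpace E M] [IsManifold 𝓘(ℝ, E) 1 M]
  [TopologicalSpace N] [ChartedSpace F N] [IsManifold 𝓘(ℝ, F) 1 N]

theorem setOf_mapsTo_mem_nhds_c1FamilyTopologyOn {A : Set M} {f : ℝ → M → N}
    {K : Set (ℝ × TangentBundle 𝓘(ℝ, E) M)} {O : Set (TangentBundle 𝓘(ℝ, F) N)}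
    (hK : IsCompact K) (hKA : ∀ p ∈ K, p.2.proj ∈ A) (hO : IsOpen O)
    (hf : MapsTo (fun p => tangentMap 𝓘(ℝ, E) 𝓘(ℝ, F) (f p.1) p.2) K O) :
    {g : ℝ → M → N | MapsTo (fun p => tangentMap 𝓘(ℝ, E) 𝓘(ℝ, F) (g p.1) p.2) K O} ∈
      @nhds (ℝ → M → N) (c1FamilyTopologyOn E F A) f :=
  @IsOpen.mem_nhds _ (c1FamilyTopologyOn E F A) _ _
    (TopologicalSpace.isOpen_generateFrom_of_mem ⟨K, O, hK, hKA, hO, rfl⟩) hf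

/-- A condition on values at `a` is a condition on the tangent maps at the zero vector over `a`. -/
theorem setOf_forall_mem_nhds_c1FamilyTopologyOn {A : Set M} {f : ℝ → M → N} {a : M} (ha : a ∈ A)
    {S : Set ℝ} (hS : IsCompact S) {O : Set N} (hO : IsOpen O) (hf : ∀ s ∈ S, f s a ∈ O) :
    {g : ℝ → M → N | ∀ s ∈ S, g s a ∈ O} ∈
      @nhds (ℝ → M → N) (c1FamilyTopologyOn E F A) f := by
  have h := setOf_mapsTo_mem_nhds_c1FamilyTopologyOn (E := E) (F := F) (A := A) (f := f)
    (K := S ×ˢ {(⟨a, 0⟩ : TangentBundle 𝓘(ℝ, E) M)})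
    (O := Bundle.TotalSpace.proj ⁻¹' O) (hS.prod isCompact_singleton)
    (by rintro ⟨s, v⟩ ⟨-, rfl⟩; exact ha)
    (hO.preimage (FiberBundle.continuous_proj F (TangentSpace 𝓘(ℝ, F))))
    (by rintro ⟨s, v⟩ ⟨hs, rfl⟩; exact hf s hs)
  refine Filter.mem_of_superset h fun g hg s hs => ?_
  exact hg (show (s, (⟨a, 0⟩ : TangentBundle 𝓘(ℝ, E) M)) ∈ _ from ⟨hs, rfl⟩)

end C1Family

section Spanning

variable {r : WithTop ℕ∞} {E F M G : Type*}
  [NormedAddCommGroup E] [NormedSpace ℝ E] [NormedAddCommGroup F] [NormedSpace ℝ F]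
  [TopologicalSpace M] [ChartedSpace E M]
  [TopologicalSpace G] [ChartedSpace F G]
  {𝒢 : LieGroupoid r E F M G} {Γ : Subgroup 𝒢.Bisection} {ι : Type*}

theorem Isotopy.vel_sinReparam (hr : 1 ≤ r) (σ : Isotopy Γ) (ε : ℝ) (x : M) :
    (σ.sinReparam ε).vel x = ε • σ.vel x := by
  have h1 : HasDerivAt (fun t => ε * Real.sin t) ε 0 := by
    simpa using (Real.hasDerivAt_sin 0).const_mul ε
  have h2 : HasDerivAt (fun t => extChartAt 𝓘(ℝ, F) (𝒢.unit x) (σ t x)) (σ.vel x)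
      (ε * Real.sin 0) := by
    simpa using σ.hasDerivAt_vel hr x
  have h3 : HasDerivAt ((fun t => extChartAt 𝓘(ℝ, F) (𝒢.unit x) (σ t x)) ∘
      fun t => ε * Real.sin t) (ε • σ.vel x) 0 :=
    HasDerivAt.scomp (g₁ := fun t => extChartAt 𝓘(ℝ, F) (𝒢.unit x) (σ t x))
      (h := fun t => ε * Real.sin t) 0 h2 h1
  exact ((σ.sinReparam ε).hasDerivAt_vel hr x).unique h3

variable [FiniteDimensional ℝ E] [T2Space M]
  [IsManifold 𝓘(ℝ, E) 1 M] [IsManifold 𝓘(ℝ, F) 1 G]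

/-- In the analytic case, an isotopy can approximately be localized near one point of a
configuration. -/
theorem exists_localization [Finite ι] (hr : 1 ≤ r) (hω : r = ω) (hL : LCondition Γ) {z : ι → M}
    (hz : Function.Injective z) (i : ι) {V : Set M} (hV : IsOpen V) (hi : z i ∈ V)
    (σ : Isotopy Γ) : ∃ ε > 0, ∃ U V' : Set M, IsOpen U ∧ z i ∈ U ∧ IsOpen V' ∧
      IsCompact (closure V') ∧ closure V' ⊆ V ∧ (∀ j, j ≠ i → z j ∉ V') ∧
      ∀ W₁ ∈ @nhds (ℝ → M → G) (c1FamilyTopologyOn E F U) (fun t => σ.sinReparam ε t),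
      ∀ W₂ ∈ @nhds (ℝ → M → G) (c1FamilyTopologyOn E F V'ᶜ) (fun _ => 𝒢.unit),
      ∃ τ : Isotopy Γ, (fun t => (τ t : M → G)) ∈ W₁ ∧ (fun t => (τ t : M → G)) ∈ W₂ := by
  have := ChartedSpace.locallyCompactSpace E M
  have hfin : (z '' {j | j ≠ i}).Finite := toFinite _
  obtain ⟨U, V', hU, hV', hUc, hV'c, hzU, hUV', hV'V⟩ := exists_isOpen_nested
    (hV.sdiff hfin.isClosed) (z := z i) ⟨hi, by rintro ⟨j, hj, h⟩; exact hj (hz h)⟩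
  obtain ⟨W, hW, hWτ⟩ := hL U V' hU hV' hUc hV'c hUV'
  obtain ⟨ε, hε, hεW⟩ := σ.exists_sinReparam_mem hr hW
  exact ⟨ε, hε, U, V', hU, hzU, hV', hV'c, hV'V.trans sdiff_subset,
    fun j hj h => (hV'V (subset_closure h)).2 ⟨j, hj, rfl⟩, (hWτ _ hεW).2 hω⟩

variable [FiniteDimensional ℝ F] [IsManifold 𝓘(ℝ, F) r G]

/-- Suppose the vector is not in the span. The motion `γ` of the `i₀`-th coordinate alone then
leaves the zero slice of the flow box. By (L) some isotopy `θ` stays close enough to `γ` to have a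
nonzero transversal component at a time `s₀`; but this component starts at `0` and is constant along
`θ`. -/
theorem single_vel_mem_span [Fintype ι] [DecidableEq ι] (hr : 1 ≤ r) (hω : r = ω)
    (hL : LCondition Γ) {q : ι → M} (hq : Function.Injective q) {d : ℕ} (τ : Fin d → Isotopy Γ)
    (hτ : LinearIndependent ℝ fun j => fun i => (τ j).vel (q i))
    (hall : ∀ η : Isotopy Γ, (fun i => η.vel (q i)) ∈
      Submodule.span ℝ (range fun j => fun i => (τ j).vel (q i))) (i₀ : ι) (σ₀ : Isotopy Γ) :
    Pi.single i₀ (σ₀.vel (q i₀)) ∈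
      Submodule.span ℝ (range fun j => fun i => (τ j).vel (q i)) := by
  by_contra hnot
  set D := Submodule.span ℝ (range fun j => fun i => (τ j).vel (q i)) with hD
  set c := 𝒢.unitCoords q with hc
  obtain ⟨C, hC⟩ := D.exists_isCompl
  obtain ⟨β, hβ0, ⟨β', hβ', hβD⟩, hβgood⟩ := exists_flowBox hr q τ hτ hC
  obtain ⟨ε, hε, U, V', -, hqU, -, -, -, hqV', happrox⟩ :=
    exists_localization hr hω hL hq i₀ isOpen_univ (mem_univ _) σ₀
  set σ := σ₀.sinReparam ε with hσ
  obtain ⟨ρ, hρ, hball⟩ := Metric.mem_nhds_iff.1 hβgood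
  -- the motion of a single point, in charts
  let γ : ℝ → ι → F := fun s =>
    Function.update c i₀ (extChartAt 𝓘(ℝ, F) (𝒢.unit (q i₀)) (σ s (q i₀)))
  have hγ0 : γ 0 = c := by
    have : extChartAt 𝓘(ℝ, F) (𝒢.unit (q i₀)) (σ 0 (q i₀)) = c i₀ := by rw [σ.apply_zero]; rfl
    change Function.update c i₀ _ = c
    rw [this, Function.update_eq_self]
  have hγ' : HasDerivAt γ (Pi.single i₀ (σ.vel (q i₀))) 0 := by
    refine hasDerivAt_pi.2 fun i => ?_
    by_cases hi : i = i₀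
    · subst hi
      simpa [γ] using σ.hasDerivAt_vel hr (q i)
    · simpa [γ, Function.update_of_ne hi, Pi.single_eq_of_ne hi] using
        hasDerivAt_const (0 : ℝ) (c i)
  have hne : ∀ᶠ s in 𝓝[≠] 0, (β (γ s)).2 ≠ 0 := by
    have h1 : HasDerivAt (fun s => (β (γ s)).2) ((β' (Pi.single i₀ (σ.vel (q i₀)))).2) 0 := by
      have h2 : HasDerivAt (β ∘ γ) (β' (Pi.single i₀ (σ.vel (q i₀)))) 0 := by
        refine HasFDerivAt.comp_hasDerivAt (0 : ℝ) ?_ hγ'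
        rw [hγ0]; exact hβ'
      exact (hasFDerivAt_snd (𝕜 := ℝ) (p := β (γ 0))).comp_hasDerivAt 0 h2
    refine h1.eventually_ne fun h => hnot ?_
    have h3 := hβD _ h
    rw [hσ, Isotopy.vel_sinReparam hr, Pi.single_smul] at h3
    exact (D.smul_mem_iff hε.ne').1 h3
  -- As `ι → F` carries the sup norm, arrows in all `O i` have coordinates in the ball where the
  -- flow box is valid.
  let O : ι → Set G := fun i => (extChartAt 𝓘(ℝ, F) (𝒢.unit (q i))).source ∩
    extChartAt 𝓘(ℝ, F) (𝒢.unit (q i)) ⁻¹' Metric.ball (c i) ρ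
  have hO : ∀ i, IsOpen (O i) := fun i =>
    (continuousOn_extChartAt (𝒢.unit (q i))).isOpen_inter_preimage
      (isOpen_extChartAt_source _) Metric.isOpen_ball
  have hunitO : ∀ i, 𝒢.unit (q i) ∈ O i := fun i =>
    ⟨mem_extChartAt_source _, Metric.mem_ball_self hρ⟩
  have hσO : ∀ᶠ s in 𝓝 (0 : ℝ), σ s (q i₀) ∈ O i₀ := by
    have h := (σ.jointlySmooth.apply (q i₀)).continuous.tendsto 0
    rw [σ.apply_zero] at h
    exact h ((hO i₀).mem_nhds (hunitO i₀))
  obtain ⟨δ, hδ, hδO⟩ := Metric.eventually_nhds_iff.1 hσO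
  -- At `s₀` the one-point motion is off the slice, and up to then it stays in the domain of the
  -- flow box. Both are preserved by approximation, on `[0, s₀]` and at `s₀` respectively.
  obtain ⟨s₀, hs₀ne, hs₀⟩ : ∃ s₀, (β (γ s₀)).2 ≠ 0 ∧ 0 < s₀ ∧ s₀ < δ := by
    have h1 : ∀ᶠ s in 𝓝[>] (0 : ℝ), (β (γ s)).2 ≠ 0 :=
      nhdsWithin_mono _ (fun s (hs : 0 < s) => hs.ne') hne
    obtain ⟨s₀, h⟩ := (h1.and (Ioo_mem_nhdsGT hδ)).exists
    exact ⟨s₀, h.1, h.2.1, h.2.2⟩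
  have hσIcc : ∀ s ∈ Icc 0 s₀, σ s (q i₀) ∈ O i₀ := fun s hs => hδO (by
    rw [Real.dist_eq, sub_zero, abs_of_nonneg hs.1]; exact hs.2.trans_lt hs₀.2)
  have hmem_ball : ∀ k : ι → G, (∀ i, k i ∈ O i) → 𝒢.coords q k ∈ Metric.ball c ρ := fun k hk =>
    (dist_pi_lt_iff hρ).2 fun i => (hk i).2
  -- open conditions at time `s₀`
  have hγs₀ : γ s₀ ∈ Metric.ball c ρ := by
    refine (dist_pi_lt_iff hρ).2 fun i => ?_
    by_cases hi : i = i₀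
    · subst hi
      simpa [γ] using (hσIcc s₀ (right_mem_Icc.2 hs₀.1.le)).2
    · simpa [γ, Function.update_of_ne hi] using hρ
  have hβcont : ContinuousAt (fun y => (β y).2) (γ s₀) :=
    continuousAt_snd.comp (hball hγs₀).1.continuousAt
  obtain ⟨ρ', hρ', hball'⟩ := Metric.mem_nhds_iff.1 (hβcont (isOpen_ne.mem_nhds hs₀ne))
  let O' : ι → Set G := fun i => (extChartAt 𝓘(ℝ, F) (𝒢.unit (q i))).source ∩
    extChartAt 𝓘(ℝ, F) (𝒢.unit (q i)) ⁻¹' Metric.ball (γ s₀ i) ρ'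
  have hO' : ∀ i, IsOpen (O' i) := fun i =>
    (continuousOn_extChartAt (𝒢.unit (q i))).isOpen_inter_preimage
      (isOpen_extChartAt_source _) Metric.isOpen_ball
  obtain ⟨θ, ⟨hθ1, hθ2⟩, hθ3⟩ := happrox
    ({f | ∀ s ∈ Icc 0 s₀, f s (q i₀) ∈ O i₀} ∩ {f | ∀ s ∈ ({s₀} : Set ℝ), f s (q i₀) ∈ O' i₀})
    (by
      refine @Filter.inter_mem _ _ _ _ ?_ ?_
      · exact setOf_forall_mem_nhds_c1FamilyTopologyOn hqU isCompact_Icc (hO i₀) hσIcc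
      · refine setOf_forall_mem_nhds_c1FamilyTopologyOn hqU isCompact_singleton (hO' i₀) ?_
        rintro s rfl
        refine ⟨(hσIcc s (right_mem_Icc.2 hs₀.1.le)).1, ?_⟩
        simpa [γ] using hρ')
    (⋂ i : {i // i ≠ i₀}, {f | ∀ s ∈ Icc 0 s₀, f s (q i) ∈ O i} ∩
      {f | ∀ s ∈ ({s₀} : Set ℝ), f s (q i) ∈ O' i})
    (by
      refine Filter.iInter_mem.2 fun i => ?_
      refine @Filter.inter_mem _ _ _ _ ?_ ?_
      · exact setOf_forall_mem_nhds_c1FamilyTopologyOn (hqV' i i.2) isCompact_Icc (hO i)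
          fun s _ => hunitO i
      · refine setOf_forall_mem_nhds_c1FamilyTopologyOn (hqV' i i.2) isCompact_singleton (hO' i)
          fun s _ => ⟨mem_extChartAt_source _, ?_⟩
        have hγi : γ s₀ i = c i := Function.update_of_ne i.2 _ _
        change c i ∈ Metric.ball (γ s₀ i) ρ'
        rw [hγi]
        exact Metric.mem_ball_self hρ')
  have hθO : ∀ s ∈ Icc 0 s₀, ∀ i, θ s (q i) ∈ O i := by
    intro s hs i
    by_cases hi : i = i₀
    · subst hi; exact hθ1 s hs
    · exact (mem_iInter.1 hθ3 ⟨i, hi⟩).1 s hs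
  have hθO' : ∀ i, θ s₀ (q i) ∈ O' i := by
    intro i
    by_cases hi : i = i₀
    · subst hi; exact hθ2 s₀ rfl
    · exact (mem_iInter.1 hθ3 ⟨i, hi⟩).2 s₀ rfl
  have hderiv : ∀ s ∈ Icc 0 s₀,
      HasDerivAt (fun t => (β (𝒢.coords q fun i => θ t (q i))).2) 0 s := by
    intro s hs
    obtain ⟨h1, h2, h3⟩ := hball (hmem_ball _ (hθO s hs))
    exact hasDerivAt_snd_flowBox hr q τ hτ hall θ (fun i => (hθO s hs i).1) h1 h2 h3
  have hconst := constant_of_has_deriv_right_zero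
    (fun s hs => (hderiv s hs).continuousAt.continuousWithinAt)
    (fun s hs => (hderiv s (Ico_subset_Icc_self hs)).hasDerivWithinAt) s₀
    (right_mem_Icc.2 hs₀.1.le)
  have h0 : (𝒢.coords q fun i => θ 0 (q i)) = c := by
    funext i
    simp only [coords, θ.apply_zero]
    rfl
  simp only [h0] at hconst
  have hs₀mem : (𝒢.coords q fun i => θ s₀ (q i)) ∈ Metric.ball (γ s₀) ρ' :=
    (dist_pi_lt_iff hρ').2 fun i => (hθO' i).2
  refine hball' hs₀mem (hconst.trans ?_)
  rw [hβ0]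
  rfl

/-- In the analytic case, the velocities of isotopies at a configuration of distinct points span the
product of the tangent spaces of the source fibres. -/
theorem exists_isotopies_span [Fintype ι] (hr : 1 ≤ r) (hω : r = ω) (hL : LCondition Γ)
    (hT : FiberwiseTransitive Γ) {q : ι → M} (hq : Function.Injective q) :
    ∃ (d : ℕ) (τ : Fin d → Isotopy Γ), ∀ v : ι → F, (∀ i, v i ∈ 𝒢.fiberDir (q i)) →
      v ∈ Submodule.span ℝ (range fun j => fun i => (τ j).vel (q i)) := by
  classical
  -- A basis of the span of all joint velocities, taken from actual isotopies, so that a flow box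
  -- can be built from it.
  obtain ⟨f, hf, hspan, hli⟩ := Submodule.exists_fun_fin_finrank_span_eq ℝ
    (range fun (η : Isotopy Γ) => fun i => η.vel (q i))
  choose τ hτ using hf
  obtain rfl : (fun j => fun i => (τ j).vel (q i)) = f := funext hτ
  refine ⟨_, τ, fun v hv => ?_⟩
  have hall : ∀ η : Isotopy Γ, (fun i => η.vel (q i)) ∈
      Submodule.span ℝ (range fun j => fun i => (τ j).vel (q i)) := fun η => by
    rw [hspan]; exact Submodule.subset_span ⟨η, rfl⟩
  have hsum : v = ∑ i, Pi.single i (v i) := (Finset.univ_sum_single v).symm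
  rw [hsum]
  refine Submodule.sum_mem _ fun i _ => ?_
  obtain ⟨k, σ, -, hσ⟩ := hT.exists_span hr (q i)
  have hvi := hv i
  rw [← hσ] at hvi
  obtain ⟨b, hb⟩ := (Submodule.mem_span_range_iff_exists_fun ℝ).1 hvi
  have hvi' : (Pi.single i (v i) : ι → F) = ∑ j, b j • Pi.single i ((σ j).vel (q i)) := by
    rw [← hb]
    change LinearMap.single ℝ (fun _ : ι => F) i _ = _
    rw [map_sum]
    simp_rw [map_smul]
    rfl
  rw [hvi']
  exact Submodule.sum_mem _ fun j _ => Submodule.smul_mem _ _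
    (single_vel_mem_span hr hω hL hq τ hli hall i (σ j))

end Spanning

/-! ### The analytic case: approximate motions and exact corrections -/

section Correction

variable {r : WithTop ℕ∞} {E F M G : Type*}
  [NormedAddCommGroup E] [NormedSpace ℝ E] [NormedAddCommGroup F] [NormedSpace ℝ F]
  [TopologicalSpace M] [ChartedSpace E M] [IsManifold 𝓘(ℝ, E) 1 M]
  [TopologicalSpace G] [ChartedSpace F G]
  {𝒢 : LieGroupoid r E F M G} {Γ : Subgroup 𝒢.Bisection} {A B : Set M}

variable (𝒢) in
/-- The filter of bisections whose base maps are `C^1` close to the identity over `A`. -/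
def c1Filter (A : Set M) : Filter 𝒢.Bisection :=
  comap Bisection.baseMap (@nhds (M → M) (c1TopologyOn E E A) id)

theorem tendsto_c1Filter_iff {α : Type*} {l : Filter α} {a : α → 𝒢.Bisection} :
    Tendsto a l (𝒢.c1Filter A) ↔ ∀ K O : Set (TangentBundle 𝓘(ℝ, E) M), IsCompact K →
      (∀ v ∈ K, v.proj ∈ A) → IsOpen O → K ⊆ O →
      ∀ᶠ p in l, MapsTo (tangentMap 𝓘(ℝ, E) 𝓘(ℝ, E) (a p).baseMap) K O := by
  rw [c1Filter, tendsto_comap_iff, TopologicalSpace.tendsto_nhds_generateFrom_iff]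
  constructor
  · intro h K O hK hKA hO hKO
    refine h _ ⟨K, O, hK, hKA, hO, rfl⟩ ?_
    change MapsTo (tangentMap 𝓘(ℝ, E) 𝓘(ℝ, E) id) K O
    rw [tangentMap_id]
    exact fun v hv => hKO hv
  · rintro h _ ⟨K, O, hK, hKA, hO, rfl⟩ hKO
    change MapsTo (tangentMap 𝓘(ℝ, E) 𝓘(ℝ, E) id) K O at hKO
    rw [tangentMap_id] at hKO
    exact h K O hK hKA hO fun v hv => hKO hv

theorem c1Filter_anti (h : A ⊆ B) : 𝒢.c1Filter B ≤ 𝒢.c1Filter A :=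
  tendsto_id'.1 <| tendsto_c1Filter_iff.2 fun K O hK hKA hO hKO =>
    tendsto_c1Filter_iff.1 tendsto_id K O hK (fun v hv => h (hKA v hv)) hO hKO

theorem pure_one_le_c1Filter : pure 1 ≤ 𝒢.c1Filter A :=
  tendsto_id'.1 <| tendsto_c1Filter_iff.2 fun K O _ _ _ hKO => by
    rw [eventually_pure, id, Bisection.baseMap_one, tangentMap_id]
    exact hKO

/-- The inner tangent map sends `K` into the interior of a compact `K'` around `K`, and the outer
one sends `K'` into `O`. Openness of `A` leaves room for `K'` over `A`; this is why closeness is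
later measured on complements of compact sets `Q`. -/
theorem tendsto_mul_c1Filter [FiniteDimensional ℝ E] (hr : 1 ≤ r) (hA : IsOpen A) :
    Tendsto (fun p : 𝒢.Bisection × 𝒢.Bisection => p.1 * p.2)
      (𝒢.c1Filter A ×ˢ 𝒢.c1Filter A) (𝒢.c1Filter A) := by
  rw [tendsto_c1Filter_iff]
  intro K O hK hKA hO hKO
  have : LocallyCompactSpace (ModelProd E E) := inferInstanceAs (LocallyCompactSpace (E × E))
  have := ChartedSpace.locallyCompactSpace (ModelProd E E) (TangentBundle 𝓘(ℝ, E) M)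
  have hA' : IsOpen (O ∩ Bundle.TotalSpace.proj ⁻¹' A) :=
    hO.inter (hA.preimage (FiberBundle.continuous_proj E (TangentSpace 𝓘(ℝ, E))))
  obtain ⟨K', hK', hKK', hK'O⟩ := exists_compact_between hK hA' fun v hv => ⟨hKO hv, hKA v hv⟩
  have h1 := tendsto_c1Filter_iff.1 (tendsto_id (x := 𝒢.c1Filter A)) K' O hK'
    (fun v hv => (hK'O hv).2) hO fun v hv => (hK'O hv).1
  have h2 := tendsto_c1Filter_iff.1 (tendsto_id (x := 𝒢.c1Filter A)) K (interior K') hK hKA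
    isOpen_interior hKK'
  filter_upwards [h1.prod_inl _, h2.prod_inr _] with p hp1 hp2
  have hd : ∀ σ : 𝒢.Bisection, MDifferentiable 𝓘(ℝ, E) 𝓘(ℝ, E) σ.baseMap := fun σ =>
    σ.contMDiff_baseMap.mdifferentiable (zero_lt_one.trans_le hr).ne'
  rw [Bisection.baseMap_mul, tangentMap_comp (hd _) (hd _)]
  exact hp1.comp (hp2.mono_right interior_subset)

theorem JointlySmooth.tendsto_c1Filter {P : Type*} [NormedAddCommGroup P] [NormedSpace ℝ P]
    (hr : 1 ≤ r) {a : P → 𝒢.Bisection} (ha : JointlySmooth a) {p₀ : P} (h0 : a p₀ = 1) :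
    Tendsto a (𝓝 p₀) (𝒢.c1Filter A) := by
  rw [tendsto_c1Filter_iff]
  intro K O hK _ hO hKO
  have hc := continuous_tangentMap_family (ha.baseMap.of_le hr)
  refine hK.eventually_forall_of_forall_eventually
    (P := fun p v => tangentMap 𝓘(ℝ, E) 𝓘(ℝ, E) (a p).baseMap v ∈ O) fun v hv => ?_
  refine (hc.tendsto (p₀, v)).eventually (hO.mem_nhds ?_)
  change tangentMap 𝓘(ℝ, E) 𝓘(ℝ, E) (a p₀).baseMap v ∈ O
  rw [h0, Bisection.baseMap_one, tangentMap_id]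
  exact hKO hv

theorem Isotopy.tendsto_eval_c1Filter [IsManifold 𝓘(ℝ, F) 1 G] (hr : 1 ≤ r) (t : ℝ) :
    Tendsto (fun τ : Isotopy Γ => τ t)
      (comap (fun τ : Isotopy Γ => fun t => (τ t : M → G))
        (@nhds (ℝ → M → G) (c1FamilyTopologyOn E F A) fun _ => 𝒢.unit)) (𝒢.c1Filter A) := by
  rw [tendsto_c1Filter_iff]
  intro K O hK hKA hO hKO
  have hr0 : r ≠ 0 := (zero_lt_one.trans_le hr).ne'
  have hcomp : ∀ σ : 𝒢.Bisection, tangentMap 𝓘(ℝ, E) 𝓘(ℝ, E) σ.baseMap =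
      tangentMap 𝓘(ℝ, F) 𝓘(ℝ, E) 𝒢.tgt ∘ tangentMap 𝓘(ℝ, E) 𝓘(ℝ, F) σ := fun σ =>
    tangentMap_comp (𝒢.contMDiff_tgt.mdifferentiable hr0) (σ.contMDiff_toFun.mdifferentiable hr0)
  have h := setOf_mapsTo_mem_nhds_c1FamilyTopologyOn (E := E) (F := F) (A := A)
    (f := fun _ : ℝ => 𝒢.unit) (K := {t} ×ˢ K)
    (O := tangentMap 𝓘(ℝ, F) 𝓘(ℝ, E) 𝒢.tgt ⁻¹' O) (isCompact_singleton.prod hK)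
    (fun p hp => hKA _ hp.2) (hO.preimage (𝒢.contMDiff_tgt.continuous_tangentMap hr))
    (fun p hp => by
      have h1 := hcomp 1
      rw [Bisection.baseMap_one, tangentMap_id] at h1
      change (tangentMap 𝓘(ℝ, F) 𝓘(ℝ, E) 𝒢.tgt ∘ tangentMap 𝓘(ℝ, E) 𝓘(ℝ, F)
        (1 : 𝒢.Bisection)) p.2 ∈ O
      rw [← h1]
      exact hKO hp.2)
  filter_upwards [preimage_mem_comap h] with τ hτ v hv
  rw [hcomp]
  exact hτ (show (t, v) ∈ {t} ×ˢ K from ⟨rfl, hv⟩)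

variable [FiniteDimensional ℝ E] [FiniteDimensional ℝ F] [T2Space M]
  [IsManifold 𝓘(ℝ, E) r M] [IsManifold 𝓘(ℝ, F) 1 G] [IsManifold 𝓘(ℝ, F) r G]

/-- In the analytic case, nearby arrows in the source fibres are related by small elements of
`Γ`. -/
theorem eventually_exists_correction {ι : Type*} [Finite ι] (hr : 1 ≤ r) (hω : r = ω)
    (hL : LCondition Γ) (hT : FiberwiseTransitive Γ) {l : ι → G}
    (hl : Function.Injective fun i => 𝒢.tgt (l i)) {S : Set 𝒢.Bisection}
    (hS : S ∈ 𝒢.c1Filter A) :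
    ∀ᶠ k in 𝓝 l, (∀ i, 𝒢.src (k i) = 𝒢.src (l i)) → ∃ ρ ∈ Γ, ρ ∈ S ∧ ∀ i, ρ • k i = l i := by
  have := Fintype.ofFinite ι
  obtain ⟨d, τ, hτ⟩ := exists_isotopies_span hr hω hL hT hl
  have h := Isotopy.eventually_exists_multi hr _ τ hτ
    ((Isotopy.multi_jointlySmooth τ).tendsto_c1Filter hr (Isotopy.multi_zero τ) hS)
  -- The quotients of `l i` by `k i` are arrows near the units at the distinct points `tgt (l i)`,
  -- hence values of one product family at a common small time. A box neighbourhood allows each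
  -- quotient to be controlled separately within its source fibre.
  obtain ⟨u, hu, hu'⟩ := isOpen_pi_iff'.1 isOpen_interior _ (mem_interior_iff_mem_nhds.2 h)
  have h1 : ∀ i, ∀ᶠ k in 𝓝 (l i), 𝒢.src k = 𝒢.src (l i) → 𝒢.mul (l i) (𝒢.inv k) ∈ u i := by
    intro i
    have h2 : Tendsto (fun k : G => (k, l i)) (𝓝[𝒢.src ⁻¹' {𝒢.src (l i)}] (l i))
        (𝓝[𝒢.src ⁻¹' {𝒢.src (l i)}] (l i) ×ˢ 𝓝[𝒢.src ⁻¹' {𝒢.src (l i)}] (l i)) :=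
      tendsto_id.prodMk (tendsto_const_pure.mono_right
        (pure_le_nhdsWithin (show l i ∈ 𝒢.src ⁻¹' {𝒢.src (l i)} from rfl)))
    exact eventually_nhdsWithin_iff.1 (((tendsto_mul_inv (l i)).comp h2).eventually
      ((hu i).1.mem_nhds (hu i).2))
  filter_upwards [(eventually_all.2 fun i => (continuous_apply i).continuousAt.eventually (h1 i))]
    with k hk hkl
  obtain ⟨t, ht, hut⟩ := interior_subset (hu' (a := fun i => 𝒢.mul (l i) (𝒢.inv (k i)))
    fun i _ => hk i (hkl i))
  refine ⟨_, Isotopy.multi_mem τ t, ht, fun i => ?_⟩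
  have h3 := hut i
  rw [src_mul_inv (hkl i).symm] at h3
  rw [Bisection.smul_def, ← h3, mul_inv_mul (hkl i).symm]

/-- In the analytic case, `C^1` small perturbations of the identity outside compact subsets of `V`
realize motions of single points inside `V`. -/
theorem isMotionRel_frequently (hr : 1 ≤ r) (hω : r = ω) (hL : LCondition Γ)
    (hT : FiberwiseTransitive Γ) {V : Set M} (hV : IsOpen V) (n : ℕ) :
    IsMotionRel Γ V fun z z' : Fin n → M => ∃ Q ⊆ V, IsCompact Q ∧
      ∃ᶠ σ in 𝒢.c1Filter Qᶜ, σ ∈ Γ ∧ ∀ i, σ.baseMap (z i) = z' i where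
  refl z := by
    refine ⟨∅, empty_subset V, isCompact_empty, Frequently.filter_mono ?_ pure_one_le_c1Filter⟩
    rw [frequently_pure]
    exact ⟨one_mem _, fun i => by rw [Bisection.baseMap_one, id]⟩
  trans := by
    rintro z z' z'' ⟨Q, hQV, hQ, h⟩ ⟨Q', hQV', hQ', h'⟩
    refine ⟨Q ∪ Q', union_subset hQV hQV', hQ.union hQ', ?_⟩
    have h1 := h.filter_mono (c1Filter_anti (compl_subset_compl.2 (subset_union_left (t := Q'))))
    have h2 := h'.filter_mono (c1Filter_anti (compl_subset_compl.2 (subset_union_right (s := Q))))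
    rw [frequently_iff]
    intro S hS
    obtain ⟨S₁, hS₁, S₂, hS₂, hSS⟩ := mem_prod_iff.1
      (tendsto_mul_c1Filter hr (hQ.union hQ').isClosed.isOpen_compl hS)
    obtain ⟨σ, hσ, hσΓ, hσz⟩ := frequently_iff.1 h1 hS₂
    obtain ⟨σ', hσ', hσΓ', hσz'⟩ := frequently_iff.1 h2 hS₁
    refine ⟨σ' * σ, hSS (mk_mem_prod hσ' hσ), mul_mem hσΓ' hσΓ, fun i => ?_⟩
    rw [Bisection.baseMap_mul, Function.comp_apply, hσz, hσz']
  realized := by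
    intro z hz i hi σ
    obtain ⟨ε, hε, U, V', hU, hzU, -, hV'c, hV'V, hzV', happrox⟩ :=
      exists_localization hr hω hL hz i hV hi σ
    have hfin : (z '' {j | j ≠ i}).Finite := toFinite _
    have hb : Tendsto (fun p : ℝ × M => (σ p.1).baseMap p.2) (𝓝 (0, z i)) (𝓝 (z i)) := by
      have h := σ.jointlySmooth.baseMap.continuous.tendsto (0, z i)
      simp only [σ.map_zero, Bisection.baseMap_one] at h
      exact h
    have hzi : (z '' {j | j ≠ i})ᶜ ∈ 𝓝 (z i) := hfin.isClosed.isOpen_compl.mem_nhds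
      (by rintro ⟨j, hj, h⟩; exact hj (hz h))
    filter_upwards [(σ.eventually_exists_sinReparam hε).prod_inl_nhds (z i),
      Eventually.prod_inr_nhds (hU.mem_nhds hzU) (0 : ℝ), hb hzi] with ⟨s, a⟩ hs ha hsb
    obtain ⟨t, ht⟩ := hs
    -- The closeness that (L) gives outside `V'` is used only outside its closure, an open set where
    -- products remain small. `S₂` is reserved for the approximating bisection and `S₁` for its
    -- correction.
    refine ⟨closure V', hV'V, hV'c, frequently_iff.2 fun {S} hS => ?_⟩
    obtain ⟨S₁, hS₁, S₂, hS₂, hSS⟩ := mem_prod_iff.1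
      (tendsto_mul_c1Filter hr hV'c.isClosed.isOpen_compl hS)
    -- the arrows to be realized
    set l : Fin n → G := Function.update (fun j => 𝒢.unit (z j)) i (σ s a) with hl
    have hltgt : ∀ j, 𝒢.tgt (l j) = Function.update z i ((σ s).baseMap a) j := fun j => by
      by_cases hj : j = i
      · subst hj; simp only [hl, Function.update_self]; rfl
      · simp only [hl, Function.update_of_ne hj, 𝒢.tgt_unit]
    have hlsrc : ∀ j, 𝒢.src (l j) = Function.update z i a j := fun j => by
      by_cases hj : j = i
      · subst hj; simp only [hl, Function.update_self, (σ s).src_toFun]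
      · simp only [hl, Function.update_of_ne hj, 𝒢.src_unit]
    have hinj : Function.Injective fun j => 𝒢.tgt (l j) := by
      simp only [hltgt]
      exact injective_update hz fun j hj h => hsb ⟨j, hj, h⟩
    obtain ⟨O, hO, hO'⟩ := isOpen_pi_iff'.1 isOpen_interior _ (mem_interior_iff_mem_nhds.2
      (eventually_exists_correction hr hω hL hT hinj hS₁))
    obtain ⟨W, hW, hWS⟩ := Isotopy.tendsto_eval_c1Filter (Γ := Γ) hr t
      (c1Filter_anti (compl_subset_compl.2 subset_closure) hS₂)
    obtain ⟨τ, hτ₁, hτW, hτ₂⟩ := happrox {f | ∀ t' ∈ ({t} : Set ℝ), f t' a ∈ O i}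
      (setOf_forall_mem_nhds_c1FamilyTopologyOn ha isCompact_singleton (hO i).1 (by
        rintro _ rfl
        have h := (hO i).2
        simp only [hl, Function.update_self, ht] at h
        exact h))
      (W ∩ ⋂ j : {j // j ≠ i}, {f | ∀ t' ∈ ({t} : Set ℝ), f t' (z j) ∈ O j})
      (@Filter.inter_mem _ _ _ _ hW (Filter.iInter_mem.2 fun j =>
        setOf_forall_mem_nhds_c1FamilyTopologyOn (hzV' j j.2) isCompact_singleton (hO j).1
          fun _ _ => by
            have h := (hO j).2
            simp only [hl, Function.update_of_ne j.2] at h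
            exact h))
    -- The bisection `τ t` sends the configuration to arrows close to `l` with the same sources, and
    -- a small `ρ` in `Γ` carries them exactly to `l`.
    obtain ⟨ρ, hρ, hρS, hρl⟩ := interior_subset
      (hO' (a := fun j => τ t (Function.update z i a j)) fun j _ => by
        by_cases hj : j = i
        · subst hj; simpa only [Function.update_self] using hτ₁ t rfl
        · simpa only [Function.update_of_ne hj] using mem_iInter.1 hτ₂ ⟨j, hj⟩ t rfl)
      fun j => by rw [hlsrc, (τ t).src_toFun]
    refine ⟨ρ * τ t, hSS (mk_mem_prod hρS (hWS hτW)), mul_mem hρ (τ.mem t), fun j => ?_⟩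
    rw [Bisection.baseMap, Bisection.mul_apply_eq_smul, hρl, hltgt]

end Correction

end LieGroupoid

/-! ### The theorem -/

theorem corollary1p4 {r : WithTop ℕ∞} (hr : 1 ≤ r) {E F M G : Type*}
    [NormedAddCommGroup E] [NormedSpace ℝ E] [FiniteDimensional ℝ E]
    [NormedAddCommGroup F] [NormedSpace ℝ F] [FiniteDimensional ℝ F]
    [TopologicalSpace M] [T2Space M] [ChartedSpace E M]
    [IsManifold 𝓘(ℝ, E) 1 M] [IsManifold 𝓘(ℝ, E) r M]
    [TopologicalSpace G] [T2Space G] [ChartedSpace F G]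
    [IsManifold 𝓘(ℝ, F) 1 G] [IsManifold 𝓘(ℝ, F) r G]
    (𝒢 : LieGroupoid r E F M G) (Γ : Subgroup 𝒢.Bisection)
    (hL : LieGroupoid.LCondition Γ) (hT : LieGroupoid.FiberwiseTransitive Γ)
    (n : ℕ) (x : Fin n → M) (hx : Function.Injective x)
    (hdim : ∀ i, 2 ≤ 𝒢.leafDim (x i) ∨ ∀ j, j ≠ i → x j ∉ 𝒢.leaf (x i))
    (y : Fin n → M) (hy : Function.Injective y) (hxy : ∀ i, y i ∈ 𝒢.leaf (x i))
    (V : Fin n → Set M) (hV : ∀ i, IsOpen (V i)) (hLV : ∀ i, 𝒢.leaf (x i) ⊆ V i) :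
    (r ≠ ω → ∃ σ ∈ Γ, (∀ i, 𝒢.tgt (σ (x i)) = y i) ∧ σ.baseSupport ⊆ ⋃ i, V i) ∧
    (r = ω → ∀ W ∈ @nhds (M → M) (c1TopologyOn E E (⋃ i, V i)ᶜ) id,
      ∃ σ ∈ Γ, (∀ i, 𝒢.tgt (σ (x i)) = y i) ∧ σ.baseMap ∈ W) := by
  have hxV : ∀ i, 𝒢.leaf (x i) ⊆ ⋃ i, V i := fun i => (hLV i).trans (subset_iUnion V i)
  refine ⟨fun hω => ?_, fun hω W hW => ?_⟩
  · obtain ⟨σ, hσ, hσV, h⟩ := (LieGroupoid.isMotionRel_supported hr hω hL (isOpen_iUnion hV) n).rel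
      hr hT hx hdim hy hxy hxV
    exact ⟨σ, hσ, h, hσV⟩
  -- Since `Q` lies in the union of the `V i`, closeness over the complement of `Q` implies
  -- closeness over the smaller set in the claim.
  · obtain ⟨Q, hQV, -, h⟩ := (LieGroupoid.isMotionRel_frequently hr hω hL hT
      (isOpen_iUnion hV) n).rel hr hT hx hdim hy hxy hxV
    obtain ⟨σ, ⟨hσ, hσx⟩, hσW⟩ := (h.and_eventually
      (LieGroupoid.c1Filter_anti (compl_subset_compl.2 hQV) (preimage_mem_comap hW))).exists
    exact ⟨σ, hσ, hσx, hσW⟩
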